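/- **Proposition.** The problem $\mathrm{Reach}(\mathcal F,\mathrm{BV})$ for floating-point arithmetic, defined below, is in $\mathsf{NEXPTIME}$: there are a polynomial $q$ and a deterministic Turing machine $V$ running in time polynomial in the length of its whole input $(s,w)$ such that a string $s$ is (the code of) a yes-instance if and only if $V$ accepts $(s,w)$ for some bit string $w$ with $|w|\le 2^{q(|s|)}$. *Arithmetic.* A floating-point arithmetic $\mathbb F$ is given by a significand width $p\ge 0$, an exponent width $e\ge 2$ and a rounding mode. Its set of numbers is $$\mathbb Q_{p,e}=\{(-1)^s(1+k/2^p)\,2^E : s\in\{0,1\},\ 0\le k\le 2^p-1,\ E\in\mathbb Z,\ -(2^{e-1}-2)\le E\le 2^{e-1}-1\}.$$ The rounding map $r:\mathbb Q\to\mathbb Q_{p,e}$ is one of the five IEEE 754 modes: to nearest (ties to the number with even last bit, or ties away from zero), toward zero, toward $+\infty$, toward $-\infty$. It takes values in $\mathbb Q_{p,e}$, so it saturates: if no element of $\mathbb Q_{p,e}$ lies on the side of $x$ required by a directed mode, the element nearest to $x$ is taken (for rounding toward zero: the nearest one with the sign of $x$, where $0$ counts as positive); rounding $0$ to nearest gives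 the smallest positive element. The operations are $x+_{\mathbb F}y=r(x+y)$, $x\cdot_{\mathbb F}y=r(xy)$ and $\mathrm{relu}_{\mathbb F}(x)=r(\max(0,x))$; sums of several terms are evaluated from left to right, and the empty sum is $r(0)$. A number is represented by the bit-vector of length $\ell=1+e+p$ consisting of $s$, then $E+2^{e-1}-1$ in $e$ bits, then $k$ in $p$ bits (most significant bit first). *Networks.* A rational FNN $N$ is a sequence $(A^{(i)},b^{(i)})_{i=1}^{K}$, $K\ge1$, of rational matrices $A^{(i)}$ and vectors $b^{(i)}$ with matching dimensions; let $d$ be its input dimension and $m$ its output dimension. The network $N|_{\mathbb F}$ applies to $x\in\mathbb F^d$ successively, for $i=1,\dots,K$, the map $x\mapsto \mathrm{relu}_{\mathbb F}\bigl(r(A^{(i)})\cdot_{\mathbb F}x+_{\mathbb F}r(b^{(i)})\bigr)$, where $r$ and $\mathrm{relu}_{\mathbb F}$ are applied entrywise and all operations are those of $\mathbb F$. *Formulas.* Bit-vector formulas of width $\ell$ are $\varphi::=(t_1=t_2)\mid\neg\varphi\mid\varphi\wedge\varphi$ over terms $t::=x_i\mid c\mid{\sim}t\mid t\,\&\,t\mid(t\,|\,t)$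 with constants $0\le c\le 2^\ell-1$, interpreted over bit-vectors of length $\ell$ with the bitwise operations NOT, AND, OR. *Problem.* Given a floating-point arithmetic $\mathbb F$, a rational FNN $N$ and bit-vector formulas $\varphi_1,\varphi_2$ of width $\ell$ over $d$ and $m$ variables respectively, decide whether there is $x\in\mathbb F^d$ such that (the bit-vectors representing the entries of) $x$ satisfy $\varphi_1$ and (those of) $N|_{\mathbb F}(x)$ satisfy $\varphi_2$. Instances are written as strings over a fixed finite alphabet: the widths $p,e$, the numerators and denominators of the entries of $N$ (as fractions, not necessarily in lowest terms), the constants and the indices of variables are written in binary, the dimensions of the layers in unary. -/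

import Mathlib

namespace QuantFNN

/-! ### Nondeterministic exponential time -/

/-- `L` is in `NEXPTIME` (certificate form): there are a polynomial `q` and a verifier `V`, computable
by a deterministic Turing machine in time polynomial in the length of its input `(x, w)`, such that
`x ∈ L` iff `V` accepts `(x, w)` for some bit string `w` of length at most `2 ^ q(|x|)`.
A pair `(x, w)` is written on the tape as the string `x` followed by the string `w`, over the
disjoint union of the two alphabets. -/
def InNEXPTIME {Γ : Type} [Fintype Γ] (L : Language Γ) : Prop :=
  ∃ (q : Polynomial ℕ) (V : List Γ × List Bool → Bool),
    Nonempty (Turing.TM2ComputableInPolyTime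
      (Computability.encodingProd
        (Computability.encodingList Γ) (Computability.encodingList Bool)).encode
      Computability.encodeBool V) ∧
    ∀ x : List Γ, x ∈ L ↔ ∃ w : List Bool, w.length ≤ 2 ^ q.eval x.length ∧ V (x, w) = true

/-! ### Floating-point arithmetic -/

/-- The number `(-1) ^ s * (1 + k / 2 ^ p) * 2 ^ E` with `p`-bit significand and `e`-bit exponent. -/
structure FloatNum (p e : ℕ) where
  /-- the sign bit `s` -/
  sign : Bool
  /-- the exponent `E` -/
  exponent : Finset.Icc (-(2 ^ (e - 1) - 2) : ℤ) (2 ^ (e - 1) - 1)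
  /-- the significand bits `k` -/
  frac : Fin (2 ^ p)

instance (p e : ℕ) : Finite (FloatNum p e) :=
  Finite.of_injective (fun y : FloatNum p e => (y.sign, y.exponent, y.frac)) <| by
    rintro ⟨s, E, k⟩ ⟨s', E', k'⟩ h
    simpa using h

/-- The rational number represented by `y`. -/
def FloatNum.val {p e : ℕ} (y : FloatNum p e) : ℚ :=
  (-1) ^ y.sign.toNat * (1 + (y.frac : ℕ) / 2 ^ p) * 2 ^ (y.exponent : ℤ)

/-- The bit-vector representing `y`: sign bit (most significant), then the exponent in `e` bits
with bias `2 ^ (e - 1) - 1`, then the `p` significand bits. -/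
def FloatNum.toBits {p e : ℕ} (y : FloatNum p e) : BitVec (1 + e + p) :=
  BitVec.ofBool y.sign ++ BitVec.ofNat e ((y.exponent : ℤ) + (2 ^ (e - 1) - 1)).toNat
    ++ BitVec.ofNat p y.frac

/-- The rounding modes of IEEE 754. -/
inductive RoundingMode
  | nearestEven
  | nearestAway
  | towardZero
  | towardPos
  | towardNeg

/-- A floating-point arithmetic: significand width, exponent width and rounding mode.
For `e < 2` the set of representable numbers is empty or ill-defined. -/
structure FloatArith where
  p : ℕ
  e : ℕ
  mode : RoundingMode
  two_le_e : 2 ≤ e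

namespace FloatArith

variable (F : FloatArith)

/-- The set of numbers of the arithmetic `F`. -/
abbrev Num : Type := FloatNum F.p F.e

/-- The length of the bit-vectors representing the numbers of `F`. -/
abbrev width : ℕ := 1 + F.e + F.p

instance : Nonempty F.Num :=
  ⟨⟨false, ⟨0, by
    have h : (2 : ℤ) ^ 1 ≤ 2 ^ (F.e - 1) :=
      pow_le_pow_right₀ (by norm_num) (by have := F.two_le_e; omega)
    rw [Finset.mem_Icc]; constructor <;> linarith⟩, ⟨0, by positivity⟩⟩⟩

/-- The criteria, most important first, by which rounding of `x` chooses the number `y`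
(smaller is better).
* To nearest: the distance to `x`; among two nearest numbers, the one with even last bit
  (`nearestEven`) or of larger magnitude (`nearestAway`); for `x = 0`, which has the two nearest
  numbers `±2 ^ (-(2 ^ (e - 1) - 2))`, the positive one.
* Toward zero: the number next to `x` among those with the same sign as `x` (zero counting as
  positive) that do not exceed `x` in magnitude. If there is none, the number next to `x` with the
  same sign as `x`.
* Toward `+∞` (`-∞`): the number next to `x` among those `≥ x` (`≤ x`). If there is none, the
  number next to `x`, that is, the largest (smallest) number. -/
def roundingCost (x : ℚ) (y : F.Num) : ℚ ×ₗ ℚ ×ₗ ℚ :=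
  match F.mode with
  | .nearestEven =>
      toLex (|y.val - x|, toLex (if Even y.toBits.toNat then 0 else 1, if 0 < y.val then 0 else 1))
  | .nearestAway =>
      toLex (|y.val - x|, toLex (-|y.val|, if 0 < y.val then 0 else 1))
  | .towardZero =>
      toLex (if 0 < y.val ↔ 0 ≤ x then 0 else 1,
        toLex (if |y.val| ≤ |x| then 0 else 1, |y.val - x|))
  | .towardPos => toLex (if x ≤ y.val then 0 else 1, toLex (|y.val - x|, 0))
  | .towardNeg => toLex (if y.val ≤ x then 0 else 1, toLex (|y.val - x|, 0))

/-- The rounding map `ℚ → F`. -/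
noncomputable def round (x : ℚ) : F.Num :=
  Classical.choose (Finite.exists_min (F.roundingCost x))

/-- Addition in `F`. -/
noncomputable def add (a b : F.Num) : F.Num := F.round (a.val + b.val)

/-- Multiplication in `F`. -/
noncomputable def mul (a b : F.Num) : F.Num := F.round (a.val * b.val)

/-- The ReLU function in `F`. -/
noncomputable def relu (a : F.Num) : F.Num := F.round (max 0 a.val)

/-- Sums in `F`, evaluated from left to right. -/
noncomputable def sum : List F.Num → F.Num
  | [] => F.round 0
  | a :: l => l.foldl F.add a

/-- The inner product in `F`. -/
noncomputable def dot {n : ℕ} (a x : Fin n → F.Num) : F.Num :=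
  F.sum (List.ofFn fun j => F.mul (a j) (x j))

end FloatArith

/-! ### Feedforward neural networks -/

/-- A fraction, given by a numerator and a positive denominator (not necessarily in lowest terms). -/
structure Frac where
  num : ℤ
  den : ℕ+

/-- The rational number given by a fraction. -/
def Frac.val (a : Frac) : ℚ := a.num / (a.den : ℕ)

/-- A layer with `n` inputs and `m` neurons: a rational `m × n` matrix and a rational vector. -/
structure Layer (n m : ℕ) where
  A : Matrix (Fin m) (Fin n) Frac
  b : Fin m → Frac

/-- A rational FNN with input dimension `n` and output dimension `m`: a non-empty sequence of
layers with matching dimensions. -/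
inductive FNN : ℕ → ℕ → Type
  | single {n m : ℕ} (L : Layer n m) : FNN n m
  | cons {n l m : ℕ} (L : Layer n l) (N : FNN l m) : FNN n m

/-- The function `relu(A x + b)` computed in `F` by a layer after rounding its parameters to `F`. -/
noncomputable def Layer.eval (F : FloatArith) {n m : ℕ} (L : Layer n m) (x : Fin n → F.Num) :
    Fin m → F.Num := fun i =>
  F.relu (F.add (F.dot (fun j => F.round (L.A i j).val) x) (F.round (L.b i).val))

/-- The function computed by the network quantised to `F`. -/
noncomputable def FNN.eval (F : FloatArith) :
    {n m : ℕ} → FNN n m → (Fin n → F.Num) → (Fin m → F.Num)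
  | _, _, .single L, x => L.eval F x
  | _, _, .cons L N, x => N.eval F (L.eval F x)

/-! ### Bit-vector logic -/

/-- Bit-vector terms of bit-width `w` over the variables `x_0, …, x_{n-1}`. -/
inductive BVTerm (w n : ℕ) : Type
  | var (i : Fin n)
  | const (c : Fin (2 ^ w))
  | not (t : BVTerm w n)
  | and (t₁ t₂ : BVTerm w n)
  | or (t₁ t₂ : BVTerm w n)

/-- Bit-vector formulas of bit-width `w` over the variables `x_0, …, x_{n-1}`. -/
inductive BVFormula (w n : ℕ) : Type
  | eq (t₁ t₂ : BVTerm w n)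
  | not (φ : BVFormula w n)
  | and (φ₁ φ₂ : BVFormula w n)

/-- The value of a term under the assignment `θ`. -/
def BVTerm.eval {w n : ℕ} (θ : Fin n → BitVec w) : BVTerm w n → BitVec w
  | .var i => θ i
  | .const c => BitVec.ofFin c
  | .not t => ~~~ t.eval θ
  | .and t₁ t₂ => t₁.eval θ &&& t₂.eval θ
  | .or t₁ t₂ => t₁.eval θ ||| t₂.eval θ

/-- `θ ⊨ φ`. -/
def BVFormula.Sat {w n : ℕ} (θ : Fin n → BitVec w) : BVFormula w n → Prop
  | .eq t₁ t₂ => t₁.eval θ = t₂.eval θ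
  | .not φ => ¬ φ.Sat θ
  | .and φ₁ φ₂ => φ₁.Sat θ ∧ φ₂.Sat θ

/-! ### The reachability problem -/

/-- An instance: a floating-point arithmetic, a rational FNN, an input and an output formula. -/
structure Instance where
  F : FloatArith
  inDim : ℕ
  outDim : ℕ
  N : FNN inDim outDim
  φ₁ : BVFormula F.width inDim
  φ₂ : BVFormula F.width outDim

/-- Some input vector over `F` satisfies `φ₁` while the output of the quantised network satisfies
`φ₂`. -/
def Instance.Reachable (I : Instance) : Prop :=
  ∃ x : Fin I.inDim → I.F.Num,
    I.φ₁.Sat (fun i => (x i).toBits) ∧ I.φ₂.Sat (fun i => (I.N.eval I.F x i).toBits)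

/-! ### Instances as strings

Integers are written in binary, so that in particular the significand width and the exponent width
are given in binary. Only the dimensions of matrices are written in unary. Terms and formulas are
written in prefix notation. -/

/-- The input alphabet. -/
inductive Sym
  | bit (b : Bool)
  | sep
  | var
  | const
  | eq
  | not
  | and
  | or
deriving DecidableEq, Fintype

/-- Binary representation (least significant bit first), with end marker. -/
def encodeNat (n : ℕ) : List Sym := (Computability.encodeNat n).map .bit ++ [.sep]

/-- Unary representation, with end marker. -/
def encodeUnary (n : ℕ) : List Sym := List.replicate n (.bit true) ++ [.sep]

def Frac.encode (a : Frac) : List Sym :=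
  .bit (decide (a.num < 0)) :: encodeNat a.num.natAbs ++ encodeNat a.den

/-- The number of neurons in unary, then for each neuron its weights and its bias. -/
def Layer.encode {n m : ℕ} (L : Layer n m) : List Sym :=
  encodeUnary m ++ (List.ofFn fun i =>
    (List.ofFn fun j => (L.A i j).encode).flatten ++ (L.b i).encode).flatten

/-- The layers, each preceded by a bit that tells whether further layers follow. -/
def FNN.encode : {n m : ℕ} → FNN n m → List Sym
  | _, _, .single L => .bit false :: L.encode
  | _, _, .cons L N => .bit true :: (L.encode ++ N.encode)

def BVTerm.encode {w n : ℕ} : BVTerm w n → List Sym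
  | .var i => .var :: encodeNat i
  | .const c => .const :: encodeNat c
  | .not t => .not :: t.encode
  | .and t₁ t₂ => .and :: (t₁.encode ++ t₂.encode)
  | .or t₁ t₂ => .or :: (t₁.encode ++ t₂.encode)

def BVFormula.encode {w n : ℕ} : BVFormula w n → List Sym
  | .eq t₁ t₂ => .eq :: (t₁.encode ++ t₂.encode)
  | .not φ => .not :: φ.encode
  | .and φ₁ φ₂ => .and :: (φ₁.encode ++ φ₂.encode)

def RoundingMode.encode : RoundingMode → List Sym
  | .nearestEven => encodeNat 0
  | .nearestAway => encodeNat 1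
  | .towardZero => encodeNat 2
  | .towardPos => encodeNat 3
  | .towardNeg => encodeNat 4

def Instance.encode (I : Instance) : List Sym :=
  I.F.mode.encode ++ encodeNat I.F.p ++ encodeNat I.F.e ++ encodeUnary I.inDim ++
    I.N.encode ++ I.φ₁.encode ++ I.φ₂.encode

/-- `Reach(𝔽, BV)` for floating-point arithmetic, as a formal language. -/
def ReachFloatBV : Language Sym :=
  {s : List Sym | ∃ I : Instance, I.encode = s ∧ I.Reachable}

end QuantFNN

/-! The widths `p` and `e` are written in binary, so they may be exponential in the length of the
instance. A single number then has exponentially many bits. A certificate of exponential size can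
still hold everything: the two widths in unary, the input vector as signs and ranks, the parameters
of the network, and both formulas as lists of tokens. It remains to check such a certificate in time
polynomial in its own size.

Arithmetic: sums and products of floating-point numbers cannot be written out, since a value `2 ^ E`
has about `E` digits and `E` ranges up to `2 ^ (e - 1)`. They are kept as sums of terms `± m * 2 ^
E` with `m` and `E` in binary. The sign of such a sum is found by adding the terms in order of
descending exponents. As soon as the partial sum is nonzero and the next exponent is lower by at
least the bit length of the sum of all mantissas, the rest cannot change the sign
(`foldl_sumStep_lt_iff`). This sign test decides which of two adjacent numbers rounding prefers. The
preference is monotone along the chain of all numbers, so a number is the rounded value iff it beats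
its two neighbours (`isMin_iff_of_chain`, `toRaw_round_eq_iff`). Hence the result of rounding can be
guessed and recognized. Its size is bounded by the arithmetic alone, so nothing grows while a
network is evaluated (`RawArith.sz_le_of_lt`, `PolyFn.net`).

Formulas and syntax: a list of tokens in prefix order is evaluated from right to left on a stack. If
this succeeds, the tokens do spell terms and formulas (`exists_items_of_tokEval`). The check writes
out the code of the guessed instance and compares it with the given string. Thus neither a parser
nor injectivity of the encoding is needed (`RawInstance.mem_of_check`, `RawInstance.exists_check`).

Machines: the algorithms are nondeterministic programs on binary trees (`Code`). `PolyFn` collects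
the functions computed with a unique result at polynomial cost. It is closed under size-bounded
recursion (`PolyFn.recur`) and under guessing a value whose graph is decidable in polynomial time
(`PolyFn.of_graph`). A stack machine interprets a program in time proportional to its cost
(`accOps_of_ev`) and accepts only if an evaluation exists (`exists_ev_of_accOps`). The deterministic
verifier reads the bits of `w` as the choices of that machine, one bit per step, so it runs in
linear time (`inNEXPTIME_of_machine`). All of this is packaged in `inNEXPTIME_of_check`. -/

namespace QuantFNN

open Turing Function

/-! ### Nondeterministic stack machines -/

/-- What a nondeterministic stack machine does after the pushes of the current state. -/
inductive NNext (Q K : Type) (Γ : K → Type) : Type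
  | goto (q : Q)
  | pop (k : K) (f : Option (Γ k) → Q)
  | choose (q₁ q₂ : Q)
  | accept

/-- A nondeterministic machine with states `Q` and stacks `K`. -/
structure NMachine (Q K : Type) (Γ : K → Type) where
  push : Q → List (Σ k, Γ k)
  next : Q → NNext Q K Γ

section

set_option linter.unusedSectionVars false

variable {Q K A : Type} {Γ : K → Type} [DecidableEq K]

/-- Performs a list of pushes. -/
def pushAll : (∀ k, List (Γ k)) → List (Σ k, Γ k) → ∀ k, List (Γ k)
  | S, [] => S
  | S, p :: l => pushAll (update S p.1 (p.2 :: S p.1)) l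

/-- The run of the machine whose `i`-th step uses the `i`-th bit of the list for its choice. -/
def NMachine.accepts (M : NMachine Q K Γ) : Q → (∀ k, List (Γ k)) → List Bool → Bool
  | _, _, [] => false
  | q, S, b :: w =>
    match M.next q with
    | .accept => true
    | .goto q' => M.accepts q' (pushAll S (M.push q)) w
    | .choose q₁ q₂ => M.accepts (bif b then q₁ else q₂) (pushAll S (M.push q)) w
    | .pop k f => M.accepts (f (pushAll S (M.push q) k).head?)
        (update (pushAll S (M.push q)) k (pushAll S (M.push q) k).tail) w

/-- The stacks of the verifier: input, output, and those of the simulated machine. -/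
inductive VStack (K : Type) : Type
  | inp
  | out
  | data (k : K)
deriving DecidableEq, Fintype

/-- The alphabets of the stacks of the verifier. -/
abbrev VStack.Sym (A : Type) (Γ : K → Type) : VStack K → Type
  | .inp => A ⊕ Bool
  | .out => Bool
  | .data k => Γ k

/-- The labels of the verifier. -/
inductive VLabel (Q A : Type) : Type
  | start
  | read (q : Q)
  | letter (a : A)
  | act (q : Q) (b : Bool)
  | clean (b : Bool)
deriving Fintype

/-- The contents of all stacks of the verifier. -/
def vStacks (i : List (A ⊕ Bool)) (o : List Bool) (S : ∀ k, List (Γ k)) :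
    ∀ k : VStack K, List (k.Sym A Γ)
  | .inp => i
  | .out => o
  | .data k => S k

@[simp] theorem vStacks_inp (i : List (A ⊕ Bool)) (o : List Bool) (S : ∀ k, List (Γ k)) :
    vStacks i o S .inp = i := rfl

@[simp] theorem vStacks_out (i : List (A ⊕ Bool)) (o : List Bool) (S : ∀ k, List (Γ k)) :
    vStacks i o S .out = o := rfl

@[simp] theorem vStacks_data (i : List (A ⊕ Bool)) (o : List Bool) (S : ∀ k, List (Γ k)) (k : K) :
    vStacks i o S (.data k) = S k := rfl

@[simp] theorem update_vStacks_inp (i i' : List (A ⊕ Bool)) (o : List Bool)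
    (S : ∀ k, List (Γ k)) : update (vStacks i o S) .inp i' = vStacks i' o S := by
  funext k; cases k <;> simp [update, vStacks]

@[simp] theorem update_vStacks_out (i : List (A ⊕ Bool)) (o o' : List Bool)
    (S : ∀ k, List (Γ k)) : update (vStacks i o S) .out o' = vStacks i o' S := by
  funext k; cases k <;> simp [update, vStacks]

@[simp] theorem update_vStacks_data (i : List (A ⊕ Bool)) (o : List Bool)
    (S : ∀ k, List (Γ k)) (k : K) (l : List (Γ k)) :
    update (vStacks i o S) (.data k) l = vStacks i o (update S k l) := by
  funext k'
  cases k' with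
  | data k' =>
    by_cases h : k' = k
    · subst h; simp [vStacks]
    · have : VStack.data k' ≠ VStack.data k := by simpa using h
      rw [update_of_ne this]; simp [vStacks, update_of_ne h]
  | _ => simp [update, vStacks]

/-- The internal memory of the verifier: the last input symbol, a state, a flag. -/
abbrev VMem (Q A : Type) : Type := Option (A ⊕ Bool) × Q × Bool

/-- Statements of the verifier. -/
abbrev VStmt (Q A : Type) (Γ : K → Type) : Type :=
  TM2.Stmt (VStack.Sym A Γ) (VLabel Q A) (VMem Q A)

/-- Configurations of the verifier. -/
abbrev VCfg (Q A : Type) (Γ : K → Type) : Type :=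
  TM2.Cfg (VStack.Sym A Γ) (VLabel Q A) (VMem Q A)

/-- The statement performing a list of pushes. -/
def pushStmt (l : List (Σ k, Γ k)) (s : VStmt Q A Γ) : VStmt Q A Γ :=
  l.foldr (fun p s => .push (.data p.1) (fun _ => p.2) s) s

theorem stepAux_pushStmt (l : List (Σ k, Γ k)) (s : VStmt Q A Γ) (v : VMem Q A)
    (i : List (A ⊕ Bool)) (o : List Bool) (S : ∀ k, List (Γ k)) :
    TM2.stepAux (pushStmt l s) v (vStacks i o S) =
      TM2.stepAux s v (vStacks i o (pushAll S l)) := by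
  induction l generalizing S with
  | nil => rfl
  | cons p l ih =>
    simp only [pushStmt, List.foldr_cons, TM2.stepAux, pushAll, update_vStacks_data] at ih ⊢
    exact ih _

/-- The statement popping from a list of stacks, recording whether all were empty. -/
def popStmt (l : List K) (s : VStmt Q A Γ) : VStmt Q A Γ :=
  l.foldr (fun k s => .pop (.data k) (fun v c => (v.1, v.2.1, v.2.2 && c.isNone)) s) s

/-- One `TM2` step executes a whole statement, so a symbol can be removed from every stack at once.
As the list has no repetitions, all emptiness tests refer to the original contents. -/
theorem stepAux_popStmt (l : List K) (hl : l.Nodup) (s : VStmt Q A Γ) (c : Option (A ⊕ Bool))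
    (q : Q) (b : Bool) (i : List (A ⊕ Bool)) (o : List Bool) (S : ∀ k, List (Γ k)) :
    TM2.stepAux (popStmt l s) (c, q, b) (vStacks i o S) =
      TM2.stepAux s (c, q, b && l.all fun k => (S k).isEmpty)
        (vStacks i o fun k => if k ∈ l then (S k).tail else S k) := by
  induction l generalizing S b with
  | nil => simp [popStmt]
  | cons k l ih =>
    have hk := (List.nodup_cons.1 hl).1
    simp only [popStmt, List.foldr_cons, TM2.stepAux, update_vStacks_data] at ih ⊢
    rw [ih (List.nodup_cons.1 hl).2]
    congr 1
    · have : (l.all fun k' => (update S k (S k).tail k').isEmpty) =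
          l.all fun k' => (S k').isEmpty := by
        rw [Bool.eq_iff_iff, List.all_eq_true, List.all_eq_true]
        refine forall₂_congr fun k' hk' => ?_
        rw [update_of_ne (fun e : k' = k => hk (e ▸ hk'))]
      simp only [vStacks_data, this]
      cases h : S k <;> simp [h]
    · congr 1
      funext k'
      by_cases h : k' = k
      · subst h; simp [hk]
      · simp [h]

variable [Fintype K]

/-- The program of the verifier: it simulates `M`, whose choices are the bits of the certificate. -/
noncomputable def NMachine.verifierProg (M : NMachine Q K Γ) (q₀ : Q) (base : List (Σ k, Γ k))
    (letter : A → List (Σ k, Γ k)) : VLabel Q A → VStmt Q A Γ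
  | .start => pushStmt base (.goto fun _ => .read q₀)
  | .read q => .pop .inp (fun v c => (c, v.2)) <| .goto fun v => match v.1 with
      | none => .clean false
      | some (.inl a) => .letter a
      | some (.inr b) => .act q b
  | .letter a => pushStmt (letter a) (.goto fun _ => .read q₀)
  | .act q b => match M.next q with
      | .accept => .goto fun _ => .clean true
      | .goto q' => pushStmt (M.push q) (.goto fun _ => .read q')
      | .choose q₁ q₂ => pushStmt (M.push q) (.goto fun _ => .read (bif b then q₁ else q₂))
      | .pop k f => pushStmt (M.push q) <| .pop (.data k) (fun v c => (v.1, f c, v.2.2)) <|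
          .goto fun v => .read v.2.1
  | .clean b => .load (fun v => (v.1, v.2.1, true)) <|
      .pop .inp (fun v c => (v.1, v.2.1, c.isNone)) <| popStmt Finset.univ.toList <|
      .branch (fun v => v.2.2)
        (.push .out (fun _ => b) <| .load (fun _ => (none, q₀, false)) .halt)
        (.goto fun _ => .clean b)

/-! ### Running time of the verifier -/

/-- `f` leads from `a` to `b` in at most `n` steps. -/
def EvalsIn {σ : Type} (f : σ → Option σ) (n : ℕ) (a b : σ) : Prop :=
  ∃ m ≤ n, (flip bind f)^[m] (some a) = some b

theorem EvalsIn.refl {σ : Type} (f : σ → Option σ) (a : σ) (n : ℕ) : EvalsIn f n a a :=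
  ⟨0, Nat.zero_le _, rfl⟩

theorem EvalsIn.head {σ : Type} {f : σ → Option σ} {n : ℕ} {a a' b : σ} (h : f a = some a')
    (h' : EvalsIn f n a' b) : EvalsIn f (n + 1) a b := by
  obtain ⟨m, hm, e⟩ := h'
  refine ⟨m + 1, by omega, ?_⟩
  rw [iterate_succ_apply]
  simpa [flip, h] using e

theorem EvalsIn.mono {σ : Type} {f : σ → Option σ} {n n' : ℕ} {a b : σ} (h : EvalsIn f n a b)
    (hn : n ≤ n') : EvalsIn f n' a b := by
  obtain ⟨m, hm, e⟩ := h
  exact ⟨m, hm.trans hn, e⟩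

variable (M : NMachine Q K Γ) (q₀ : Q) (base : List (Σ k, Γ k)) (letter : A → List (Σ k, Γ k))

/-- A halting configuration in the sense of `haltList` has initial memory and empty stacks except
for the output. Each round pops all stacks simultaneously, so the rounds are counted by the tallest
stack, plus one that finds everything empty. -/
theorem evalsIn_clean (b : Bool) (n : ℕ) (v : VMem Q A) (i : List (A ⊕ Bool))
    (S : ∀ k, List (Γ k)) (hi : i.length ≤ n) (hS : ∀ k, (S k).length ≤ n) :
    EvalsIn (TM2.step (M.verifierProg q₀ base letter)) (n + 1)
      (⟨some (.clean b), v, vStacks i [] S⟩ : VCfg Q A Γ)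
      ⟨none, (none, q₀, false), vStacks [] [b] fun _ => []⟩ := by
  have hall : (Finset.univ.toList.all fun _ : K => true) = true := by
    rw [List.all_eq_true]; simp
  induction n generalizing v i S with
  | zero =>
    have hi' : i = [] := List.length_eq_zero_iff.1 (by omega)
    have hS' : S = fun _ => [] := by
      funext k; exact List.length_eq_zero_iff.1 (by have := hS k; omega)
    subst hi' hS'
    refine .head (a' := ⟨none, (none, q₀, false), vStacks [] [b] fun _ => []⟩) ?_ (.refl _ _ _)
    simp [TM2.step, NMachine.verifierProg, stepAux_popStmt _ (Finset.nodup_toList _), hall]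
  | succ n ih =>
    by_cases h : i = [] ∧ ∀ k, S k = []
    · obtain ⟨hi', hS'⟩ := h
      have hS' : S = fun _ => [] := funext hS'
      subst hi' hS'
      refine .head (a' := ⟨none, (none, q₀, false), vStacks [] [b] fun _ => []⟩) ?_ (.refl _ _ _)
      simp [TM2.step, NMachine.verifierProg, stepAux_popStmt _ (Finset.nodup_toList _), hall]
    · refine .head ?_ (ih (v.1, v.2.1, false) i.tail (fun k => (S k).tail) (by simp; omega)
        (fun k => by have := hS k; simp; omega))
      have h2 : (i.head?.isNone && Finset.univ.toList.all fun k => (S k).isEmpty) = false := by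
        by_contra hc
        rw [Bool.not_eq_false, Bool.and_eq_true, List.all_eq_true] at hc
        exact h ⟨by simpa using hc.1, fun k => by simpa using hc.2 k (by simp)⟩
      simp only [TM2.step, NMachine.verifierProg, TM2.stepAux, vStacks_inp, update_vStacks_inp,
        stepAux_popStmt _ (Finset.nodup_toList _)]
      erw [h2]
      simp

theorem length_pushAll_le (S : ∀ k, List (Γ k)) (l : List (Σ k, Γ k)) (k : K) :
    (pushAll S l k).length ≤ (S k).length + l.length := by
  induction l generalizing S with
  | nil => simp [pushAll]
  | cons p l ih =>
    refine (ih _).trans ?_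
    by_cases h : k = p.1
    · subst h; simp; omega
    · rw [update_of_ne h]; simp

/-- Each bit costs two steps, one to read it and one to act. It also raises every stack by at most
`D`, which is charged here because it delays the final cleaning. -/
theorem evalsIn_act (D : ℕ) (hD : ∀ q, (M.push q).length ≤ D) (w : List Bool) (q : Q)
    (S : ∀ k, List (Γ k)) (v : VMem Q A) (h : ℕ) (hS : ∀ k, (S k).length ≤ h) :
    EvalsIn (TM2.step (M.verifierProg q₀ base letter)) ((D + 3) * w.length + h + 3)
      (⟨some (.read q), v, vStacks (w.map .inr) [] S⟩ : VCfg Q A Γ)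
      ⟨none, (none, q₀, false), vStacks [] [M.accepts q S w] fun _ => []⟩ := by
  induction w generalizing q S v h with
  | nil =>
    have := evalsIn_clean M q₀ base letter false h (none, v.2) [] S (by simp) hS
    refine (EvalsIn.head ?_ this).mono (by simp)
    simp [TM2.step, NMachine.verifierProg]
  | cons b w ih =>
    have hstep : TM2.step (M.verifierProg q₀ base letter)
        (⟨some (.read q), v, vStacks ((b :: w).map .inr) [] S⟩ : VCfg Q A Γ) =
        some ⟨some (.act q b), (some (.inr b), v.2), vStacks (w.map .inr) [] S⟩ := by
      simp [TM2.step, NMachine.verifierProg]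
    have hp : ∀ k, (pushAll S (M.push q) k).length ≤ h + D := fun k =>
      (length_pushAll_le S _ k).trans (by have := hS k; have := hD q; omega)
    have e : (D + 3) * (b :: w).length + h + 3 = ((D + 3) * w.length + (h + D) + 3 + 1) + 1 + 1 := by
      rw [List.length_cons]; ring
    rw [e]
    refine .mono (EvalsIn.head hstep ?_) (n := ((D + 3) * w.length + (h + D) + 3 + 1) + 1) (by omega)
    cases hq : M.next q with
    | accept =>
      -- The unread part of the certificate is still on the input stack, so its length enters the
      -- height that has to be cleared.
      have := evalsIn_clean M q₀ base letter true (w.length + h) (some (.inr b), v.2)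
        (w.map .inr) S (by simp) (fun k => (hS k).trans (by omega))
      have e2 : M.accepts q S (b :: w) = true := by simp [NMachine.accepts, hq]
      rw [e2]
      refine (EvalsIn.head ?_ this).mono ?_
      · simp [TM2.step, NMachine.verifierProg, hq]
      · nlinarith
    | goto q' =>
      have := ih q' (pushAll S (M.push q)) (some (.inr b), v.2) (h + D) hp
      have e2 : M.accepts q S (b :: w) = M.accepts q' (pushAll S (M.push q)) w := by
        simp [NMachine.accepts, hq]
      rw [e2]
      refine EvalsIn.head ?_ this
      simp [TM2.step, NMachine.verifierProg, hq, stepAux_pushStmt]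
    | choose q₁ q₂ =>
      have := ih (bif b then q₁ else q₂) (pushAll S (M.push q)) (some (.inr b), v.2) (h + D) hp
      have e2 : M.accepts q S (b :: w) =
          M.accepts (bif b then q₁ else q₂) (pushAll S (M.push q)) w := by
        simp [NMachine.accepts, hq]
      rw [e2]
      refine EvalsIn.head ?_ this
      simp [TM2.step, NMachine.verifierProg, hq, stepAux_pushStmt]
    | pop k f =>
      have := ih (f (pushAll S (M.push q) k).head?)
        (update (pushAll S (M.push q)) k (pushAll S (M.push q) k).tail)
        (some (.inr b), f (pushAll S (M.push q) k).head?, v.2.2) (h + D) (fun k' => by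
          by_cases hk : k' = k
          · subst hk; have := hp k'; simp; omega
          · rw [update_of_ne hk]; exact hp k')
      have e2 : M.accepts q S (b :: w) = M.accepts (f (pushAll S (M.push q) k).head?)
          (update (pushAll S (M.push q)) k (pushAll S (M.push q) k).tail) w := by
        simp [NMachine.accepts, hq]
      rw [e2]
      refine EvalsIn.head ?_ this
      simp [TM2.step, NMachine.verifierProg, hq, stepAux_pushStmt]

theorem pushAll_append (S : ∀ k, List (Γ k)) (l l' : List (Σ k, Γ k)) :
    pushAll S (l ++ l') = pushAll (pushAll S l) l' := by
  induction l generalizing S with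
  | nil => rfl
  | cons p l ih => exact ih _

/-- The letters precede the bits on the tape, and each of them leads back to `read q₀`. So the
simulation begins only when the whole input has been pushed. -/
theorem evalsIn_letter (D : ℕ) (hD : ∀ q, (M.push q).length ≤ D)
    (hL : ∀ a, (letter a).length ≤ D) (x : List A) (w : List Bool)
    (S : ∀ k, List (Γ k)) (v : VMem Q A) (h : ℕ) (hS : ∀ k, (S k).length ≤ h) :
    EvalsIn (TM2.step (M.verifierProg q₀ base letter)) ((D + 3) * (x.length + w.length) + h + 3)
      (⟨some (.read q₀), v, vStacks (x.map .inl ++ w.map .inr) [] S⟩ : VCfg Q A Γ)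
      ⟨none, (none, q₀, false),
        vStacks [] [M.accepts q₀ (pushAll S (x.flatMap letter)) w] fun _ => []⟩ := by
  induction x generalizing S v h with
  | nil => simpa [pushAll] using evalsIn_act M q₀ base letter D hD w q₀ S v h hS
  | cons a x ih =>
    have := ih (pushAll S (letter a)) (some (.inl a), v.2) (h + D)
      (fun k => (length_pushAll_le S _ k).trans (by have := hS k; have := hL a; omega))
    rw [← pushAll_append, ← List.flatMap_cons] at this
    refine .mono (EvalsIn.head (a' := ⟨some (.letter a), (some (.inl a), v.2),
      vStacks (x.map .inl ++ w.map .inr) [] S⟩) ?_ (EvalsIn.head ?_ this)) ?_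
    · simp [TM2.step, NMachine.verifierProg]
    · simp [TM2.step, NMachine.verifierProg, stepAux_pushStmt]
    · rw [List.length_cons]; ring_nf; omega

/-! ### The verifier as a polynomial-time Turing machine -/

variable [Fintype Q] [Fintype A]

/-- The verifier as a Turing machine. -/
noncomputable def NMachine.verifier : FinTM2 where
  K := VStack K
  k₀ := .inp
  k₁ := .out
  Γ := VStack.Sym A Γ
  Λ := VLabel Q A
  main := .start
  σ := VMem Q A
  initialState := (none, q₀, false)
  Γk₀Fin := inferInstanceAs (Fintype (A ⊕ Bool))
  m := M.verifierProg q₀ base letter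

/-- A language whose members are the inputs accepted by a nondeterministic stack machine within
exponentially many steps is in `NEXPTIME`. -/
theorem inNEXPTIME_of_machine (L : Language A) (p : Polynomial ℕ)
    (hL : ∀ x, x ∈ L ↔ ∃ w : List Bool, w.length ≤ 2 ^ p.eval x.length ∧
      M.accepts q₀ (pushAll (fun _ => []) (base ++ x.flatMap letter)) w = true) :
    InNEXPTIME L := by
  classical
  refine ⟨p, fun z => M.accepts q₀ (pushAll (fun _ => []) (base ++ z.1.flatMap letter)) z.2,
    ⟨?_⟩, hL⟩
  let D : ℕ := (∑ q, (M.push q).length) + ∑ a, (letter a).length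
  have hD : ∀ q, (M.push q).length ≤ D := fun q =>
    (Finset.single_le_sum (f := fun q => (M.push q).length) (fun _ _ => Nat.zero_le _)
      (Finset.mem_univ q)).trans (Nat.le_add_right _ _)
  have hA : ∀ a, (letter a).length ≤ D := fun a =>
    (Finset.single_le_sum (f := fun a => (letter a).length) (fun _ _ => Nat.zero_le _)
      (Finset.mem_univ a)).trans (Nat.le_add_left _ _)
  have key : ∀ z : List A × List Bool, EvalsIn (TM2.step (M.verifierProg q₀ base letter))
      ((D + 3) * (z.1.length + z.2.length) + base.length + 3 + 1)
      (⟨some .start, (none, q₀, false), vStacks (z.1.map .inl ++ z.2.map .inr) [] fun _ => []⟩ :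
        VCfg Q A Γ)
      ⟨none, (none, q₀, false), vStacks []
        [M.accepts q₀ (pushAll (fun _ => []) (base ++ z.1.flatMap letter)) z.2] fun _ => []⟩ := by
    intro z
    have := evalsIn_letter M q₀ base letter D hD hA z.1 z.2 (pushAll (fun _ => []) base)
      (none, q₀, false) base.length (fun k => (length_pushAll_le _ _ k).trans (by simp))
    rw [← pushAll_append] at this
    refine EvalsIn.head ?_ this
    simp [TM2.step, NMachine.verifierProg, stepAux_pushStmt]
  refine
    { tm := M.verifier q₀ base letter
      inputAlphabet := Equiv.refl _
      outputAlphabet := Equiv.refl _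
      time := Polynomial.C (D + 3) * Polynomial.X + Polynomial.C (base.length + 4)
      outputsFun := fun z => ?_ }
  have h1 : initList (M.verifier q₀ base letter) (z.1.map .inl ++ z.2.map .inr) =
      (⟨some .start, (none, q₀, false), vStacks (z.1.map .inl ++ z.2.map .inr) [] fun _ => []⟩ :
        VCfg Q A Γ) := by
    unfold initList
    congr 1
    funext k
    cases k <;> rfl
  have h2 : ∀ b : Bool, haltList (M.verifier q₀ base letter) [b] =
      (⟨none, (none, q₀, false), vStacks [] [b] fun _ => []⟩ : VCfg Q A Γ) := by
    intro b
    unfold haltList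
    congr 1
    funext k
    cases k <;> rfl
  have h3 := key z
  rw [← h1, ← h2] at h3
  refine ⟨⟨h3.choose, ?_⟩, ?_⟩
  · have h5 : ∀ {β : Type} (l : List β), l.map id = l := fun l => List.map_id l
    have := h3.choose_spec.2
    simp only [Computability.encodingProd, Computability.encodingList, Computability.encodeBool,
      id, Equiv.invFun_as_coe, Equiv.refl_symm, Equiv.coe_refl]
    refine Eq.trans (congrArg (fun l => (flip bind (M.verifier q₀ base letter).step)^[h3.choose]
      (some (initList (M.verifier q₀ base letter) l))) (h5 _)) (this.trans ?_)
    exact congrArg (fun l => some (haltList (M.verifier q₀ base letter) l)) (h5 _).symm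
  · refine h3.choose_spec.1.trans ?_
    simp [Computability.encodingProd, Computability.encodingList]
    omega

end

/-! ### A language of nondeterministic programs on binary trees -/

/-- Binary trees, the universal data type. -/
inductive BinTree : Type
  | nil
  | node (a b : BinTree)
deriving DecidableEq

namespace BinTree

/-- The number of leaves and inner nodes. -/
def size : BinTree → ℕ
  | nil => 1
  | node a b => a.size + b.size + 1

theorem size_pos (x : BinTree) : 0 < x.size := by cases x <;> simp [size]

/-- Prefix code of a tree. -/
def code : BinTree → List Bool
  | nil => [false]
  | node a b => true :: (a.code ++ b.code)

theorem length_code (x : BinTree) : x.code.length = x.size := by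
  induction x with
  | nil => rfl
  | node a b iha ihb => simp [code, size, iha, ihb]

end BinTree

open BinTree

/-- Programs. `union` is nondeterministic choice; `recur b s c` either applies `b`, or splits its
argument by `s` into `node k (node x₁ x₂)`, calls itself on `x₁` and `x₂`, and combines the results
by `c`. -/
inductive Code : Type
  | id
  | nil
  | isNil
  | fst
  | snd
  | comp (f g : Code)
  | pair (f g : Code)
  | union (f g : Code)
  | recur (b s c : Code)
deriving DecidableEq

/-- `Ev c x y n`: on input `x` the program `c` can return `y` at cost `n`. -/
inductive Code.Ev : Code → BinTree → BinTree → ℕ → Prop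
  | id (x) : Ev .id x x 1
  | nil (x) : Ev .nil x .nil x.size
  | isNil : Ev .isNil .nil .nil 1
  | fst (a b) : Ev .fst (node a b) a (a.size + b.size)
  | snd (a b) : Ev .snd (node a b) b (a.size + b.size)
  | comp {f g x y z m n} : Ev f x y m → Ev g y z n → Ev (.comp f g) x z (m + n + 1)
  | pair {f g x y z m n} : Ev f x y m → Ev g x z n →
      Ev (.pair f g) x (node y z) (m + n + x.size + z.size)
  | unionLeft {f g x y n} : Ev f x y n → Ev (.union f g) x y (n + 1)
  | unionRight {f g x y n} : Ev g x y n → Ev (.union f g) x y (n + 1)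
  | recBase {b s c x y n} : Ev b x y n → Ev (.recur b s c) x y (n + 1)
  | recStep {b s c x k x₁ x₂ y₁ y₂ y n n₁ n₂ m} : Ev s x (node k (node x₁ x₂)) n →
      Ev (.recur b s c) x₁ y₁ n₁ → Ev (.recur b s c) x₂ y₂ n₂ →
      Ev c (node k (node y₁ y₂)) y m →
      Ev (.recur b s c) x y
        (n + n₁ + n₂ + m + (k.size + x₁.size + x₂.size + y₁.size + y₂.size))

/-- The subprograms of a program. -/
def Code.subs : Code → List Code
  | comp f g => comp f g :: (f.subs ++ g.subs)
  | pair f g => pair f g :: (f.subs ++ g.subs)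
  | union f g => union f g :: (f.subs ++ g.subs)
  | recur b s c => recur b s c :: (b.subs ++ s.subs ++ c.subs)
  | c => [c]

theorem Code.mem_subs_self (c : Code) : c ∈ c.subs := by cases c <;> simp [subs]

theorem Code.subs_trans {c d e : Code} (h : c ∈ d.subs) (h' : d ∈ e.subs) : c ∈ e.subs := by
  induction e with
  | comp f g hf hg | pair f g hf hg | union f g hf hg =>
    simp only [subs, List.mem_cons, List.mem_append] at h' ⊢
    rcases h' with rfl | h' | h'
    · simpa [subs] using h
    · exact .inr (.inl (hf h'))
    · exact .inr (.inr (hg h'))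
  | recur b s k hb hs hk =>
    simp only [subs, List.mem_cons, List.mem_append] at h' ⊢
    rcases h' with rfl | (h' | h') | h'
    · simpa [subs, or_assoc] using h
    · exact .inr (.inl (.inl (hb h')))
    · exact .inr (.inl (.inr (hs h')))
    · exact .inr (.inr (hk h'))
  | _ =>
    simp only [subs, List.mem_singleton] at h'
    subst h'
    simpa [subs] using h

/-- The instructions of an abstract machine with a stack of trees. -/
inductive Op : Type
  | code (c : Code)
  | dup
  | swap
  | drop
  | popNode
  | pushNode
  | popNil
  | pushNil

/-- The two alternative translations of a program into instructions. -/
def Code.expand : Code → Bool → List Op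
  | id, _ => []
  | nil, _ => [.drop, .pushNil]
  | isNil, _ => [.popNil, .pushNil]
  | fst, _ => [.popNode, .swap, .drop]
  | snd, _ => [.popNode, .drop]
  | comp f g, _ => [.code f, .code g]
  | pair f g, _ => [.dup, .code g, .swap, .code f, .pushNode]
  | union f g, b => [.code (bif b then f else g)]
  | recur b _ _, true => [.code b]
  | recur b s c, false => [.code s, .popNode, .swap, .popNode, .code (recur b s c), .swap,
      .code (recur b s c), .swap, .pushNode, .swap, .pushNode, .code c]

/-! ### The interpreter -/

/-- The stacks of the interpreter: trees, two auxiliary stacks, a counter, instructions. -/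
inductive IStack : Type
  | a
  | b
  | d
  | cnt
  | ctl
deriving DecidableEq

instance : Fintype IStack := ⟨{.a, .b, .d, .cnt, .ctl}, fun k => by cases k <;> simp⟩

/-- The alphabets of the stacks of the interpreter. -/
abbrev IStack.Sym : IStack → Type
  | .a | .b | .d => Bool
  | .cnt => Unit
  | .ctl => Op

/-- The loops of the interpreter. -/
inductive Loop : Type
  | dup₀ | dup₁ | dup₂ | dup₃ | swap₀ | swap₁ | swap₂ | swap₃ | drop
deriving DecidableEq

instance : Fintype Loop :=
  ⟨{.dup₀, .dup₁, .dup₂, .dup₃, .swap₀, .swap₁, .swap₂, .swap₃, .drop}, fun l => by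
    cases l <;> simp⟩

/-- The states of the interpreter of `c`. -/
inductive IState (c : Code) : Type
  | fetch
  | choose (d : {d // d ∈ c.subs})
  | expand (d : {d // d ∈ c.subs}) (b : Bool)
  | prim (o : Fin 4)
  | moveStart (l : Loop)
  | moveLoop (l : Loop)
  | moveRead (l : Loop)
  | moveWrite (l : Loop) (b : Bool)
  | pour (l : Loop)
  | pourWrite (l : Loop) (b : Bool)
  | accept
  | stuck
deriving Fintype

/-- The pushes by which a loop writes a bit. -/
def Loop.write : Loop → Bool → List (Σ k : IStack, k.Sym)
  | dup₀, b | dup₂, b | swap₀, b => [⟨.b, b⟩]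
  | swap₁, b => [⟨.d, b⟩]
  | dup₁, b => [⟨.a, b⟩, ⟨.d, b⟩]
  | dup₃, b | swap₂, b | swap₃, b => [⟨.a, b⟩]
  | drop, _ => []

/-- The state after a loop. -/
def Loop.after (c : Code) : Loop → IState c
  | dup₀ => .pour .dup₁
  | dup₁ => .pour .dup₂
  | dup₂ => .pour .dup₃
  | swap₀ => .moveStart .swap₁
  | swap₁ => .pour .swap₂
  | swap₂ => .pour .swap₃
  | dup₃ | swap₃ | drop => .fetch

/-- The action on reading a bit from the source of a loop. -/
def Loop.onRead (c : Code) (l : Loop) : Option Bool → IState c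
  | none => l.after c
  | some b => .pourWrite l b

/-- The state entered on fetching an instruction. -/
def fetchState (c : Code) : Option Op → IState c
  | none => .accept
  | some (.code d) => if h : d ∈ c.subs then .choose ⟨d, h⟩ else .stuck
  | some .dup => .moveStart .dup₀
  | some .swap => .moveStart .swap₀
  | some .drop => .moveStart .drop
  | some .popNode => .prim 0
  | some .pushNode => .prim 1
  | some .popNil => .prim 2
  | some .pushNil => .prim 3

/-- The pushes of the interpreter of `c`. -/
def interpPush (c : Code) : IState c → List (Σ k : IStack, k.Sym)
  | .expand d b => (d.1.expand b).reverse.map fun o => ⟨.ctl, o⟩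
  | .prim 1 => [⟨.a, true⟩]
  | .prim 3 => [⟨.a, false⟩]
  | .moveStart _ => [⟨.cnt, ()⟩]
  | .moveWrite l b => l.write b ++ bif b then [⟨.cnt, ()⟩, ⟨.cnt, ()⟩] else []
  | .pourWrite l b => l.write b
  | _ => []

/-- The transitions of the interpreter of `c`. -/
def interpNext (c : Code) : IState c → NNext (IState c) IStack IStack.Sym
  | .fetch => .pop .ctl (fetchState c)
  | .choose d => .choose (.expand d true) (.expand d false)
  | .expand _ _ => .goto .fetch
  | .prim 0 => .pop .a fun o => if o = some true then .fetch else .stuck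
  | .prim 2 => .pop .a fun o => if o = some false then .fetch else .stuck
  | .prim _ => .goto .fetch
  | .moveStart l => .goto (.moveLoop l)
  | .moveLoop l => .pop .cnt fun o => if o = none then l.after c else .moveRead l
  | .moveRead l => .pop .a fun o => o.elim .stuck (.moveWrite l)
  | .moveWrite l _ => .goto (.moveLoop l)
  | .pour .dup₂ => .pop .d (Loop.onRead c .dup₂)
  | .pour .swap₃ => .pop .d (Loop.onRead c .swap₃)
  | .pour l => .pop .b (Loop.onRead c l)
  | .pourWrite l _ => .goto (.pour l)
  | .accept => .accept
  | .stuck => .goto .stuck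

/-- The interpreter of `c`. -/
def interp (c : Code) : NMachine (IState c) IStack IStack.Sym := ⟨interpPush c, interpNext c⟩

@[simp] theorem interp_push (c : Code) : (interp c).push = interpPush c := rfl

/-- The contents of all stacks of the interpreter. -/
def iStacks (a b d : List Bool) (n : List Unit) (o : List Op) : ∀ k : IStack, List k.Sym
  | .a => a
  | .b => b
  | .d => d
  | .cnt => n
  | .ctl => o

section

variable (a b d a' b' d' : List Bool) (n n' : List Unit) (o o' : List Op)

@[simp] theorem iStacks_a : iStacks a b d n o .a = a := rfl
@[simp] theorem iStacks_b : iStacks a b d n o .b = b := rfl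
@[simp] theorem iStacks_d : iStacks a b d n o .d = d := rfl
@[simp] theorem iStacks_cnt : iStacks a b d n o .cnt = n := rfl
@[simp] theorem iStacks_ctl : iStacks a b d n o .ctl = o := rfl

@[simp] theorem update_iStacks_a : update (iStacks a b d n o) .a a' = iStacks a' b d n o := by
  funext k; cases k <;> rfl
@[simp] theorem update_iStacks_b : update (iStacks a b d n o) .b b' = iStacks a b' d n o := by
  funext k; cases k <;> rfl
@[simp] theorem update_iStacks_d : update (iStacks a b d n o) .d d' = iStacks a b d' n o := by
  funext k; cases k <;> rfl
@[simp] theorem update_iStacks_cnt : update (iStacks a b d n o) .cnt n' = iStacks a b d n' o := by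
  funext k; cases k <;> rfl
@[simp] theorem update_iStacks_ctl : update (iStacks a b d n o) .ctl o' = iStacks a b d n o' := by
  funext k; cases k <;> rfl

theorem pushAll_ctl (l : List Op) :
    pushAll (iStacks a b d n o) (l.reverse.map fun x => ⟨.ctl, x⟩) = iStacks a b d n (l ++ o) := by
  induction l generalizing o with
  | nil => rfl
  | cons x l ih =>
    rw [List.reverse_cons, List.map_append, pushAll_append, ih]
    simp [pushAll]

end

/-! ### Acceptance within a given number of steps -/

section

variable {Q K : Type} {Γ : K → Type} [DecidableEq K] (M : NMachine Q K Γ)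

/-- The machine can accept within `n` steps. -/
def NMachine.Acc (n : ℕ) (q : Q) (S : ∀ k, List (Γ k)) : Prop :=
  ∃ w : List Bool, w.length ≤ n ∧ M.accepts q S w = true

variable {M}

theorem NMachine.Acc.mono {n n' : ℕ} {q : Q} {S : ∀ k, List (Γ k)} (h : M.Acc n q S)
    (hn : n ≤ n') : M.Acc n' q S := by
  obtain ⟨w, hw, h⟩ := h
  exact ⟨w, hw.trans hn, h⟩

theorem NMachine.not_acc_zero {q : Q} {S : ∀ k, List (Γ k)} : ¬ M.Acc 0 q S := by
  rintro ⟨w, hw, h⟩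
  rw [List.length_eq_zero_iff.1 (Nat.le_zero.1 hw)] at h
  simp [accepts] at h

variable (M) in
/-- The configuration `(q, S)` leads to `(q', S')` in exactly `m` steps, whatever the choices. -/
def NMachine.Leads (m : ℕ) (q : Q) (S : ∀ k, List (Γ k)) (q' : Q) (S' : ∀ k, List (Γ k)) : Prop :=
  ∀ n, M.Acc n q S ↔ ∃ n', n = n' + m ∧ M.Acc n' q' S'

/-- With exact step counts and an equivalence of acceptance, chains of steps can be read in both
directions: forwards to bound the time of an evaluation, backwards to extract an evaluation from an
accepting run. -/
theorem NMachine.Leads.trans {m m' : ℕ} {q q' q'' : Q} {S S' S'' : ∀ k, List (Γ k)}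
    (h : M.Leads m q S q' S') (h' : M.Leads m' q' S' q'' S'') :
    M.Leads (m + m') q S q'' S'' := by
  intro n
  rw [h n]
  constructor
  · rintro ⟨k, rfl, hk⟩
    obtain ⟨l, rfl, hl⟩ := (h' k).1 hk
    exact ⟨l, by ring, hl⟩
  · rintro ⟨l, rfl, hl⟩
    exact ⟨l + m', by ring, (h' _).2 ⟨l, rfl, hl⟩⟩

theorem NMachine.Leads.cast {m m' : ℕ} {q q' : Q} {S S' : ∀ k, List (Γ k)}
    (h : M.Leads m q S q' S') (e : m = m') : M.Leads m' q S q' S' := e ▸ h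

theorem NMachine.Leads.goto {q q' : Q} (h : M.next q = .goto q') (S : ∀ k, List (Γ k)) :
    M.Leads 1 q S q' (pushAll S (M.push q)) := by
  intro n
  constructor
  · rintro ⟨_ | ⟨b, w⟩, hw, hacc⟩
    · simp [accepts] at hacc
    · simp only [accepts, h, List.length_cons] at hacc hw
      exact ⟨n - 1, by omega, w, by omega, hacc⟩
  · rintro ⟨n', rfl, w, hw, hacc⟩
    exact ⟨true :: w, by simpa using hw, by simpa [accepts, h] using hacc⟩

theorem NMachine.Leads.pop {q : Q} {k : K} {f : Option (Γ k) → Q} (h : M.next q = .pop k f)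
    (S : ∀ k, List (Γ k)) :
    M.Leads 1 q S (f (pushAll S (M.push q) k).head?)
      (update (pushAll S (M.push q)) k (pushAll S (M.push q) k).tail) := by
  intro n
  constructor
  · rintro ⟨_ | ⟨b, w⟩, hw, hacc⟩
    · simp [accepts] at hacc
    · simp only [accepts, h, List.length_cons] at hacc hw
      exact ⟨n - 1, by omega, w, by omega, hacc⟩
  · rintro ⟨n', rfl, w, hw, hacc⟩
    exact ⟨true :: w, by simpa using hw, by simpa [accepts, h] using hacc⟩

/-- Only at a choice does the consumed bit matter, so acceptance splits into a disjunction; `goto`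
and `pop` steps are covered by `Leads`. -/
theorem NMachine.acc_choose {q q₁ q₂ : Q} (h : M.next q = .choose q₁ q₂) (S : ∀ k, List (Γ k))
    (n : ℕ) : M.Acc (n + 1) q S ↔
      M.Acc n q₁ (pushAll S (M.push q)) ∨ M.Acc n q₂ (pushAll S (M.push q)) := by
  constructor
  · rintro ⟨_ | ⟨b, w⟩, hw, hacc⟩
    · simp [accepts] at hacc
    · simp only [accepts, h, List.length_cons] at hacc hw
      cases b
      · exact .inr ⟨w, by omega, hacc⟩
      · exact .inl ⟨w, by omega, hacc⟩
  · rintro (⟨w, hw, hacc⟩ | ⟨w, hw, hacc⟩)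
    · exact ⟨true :: w, by simpa using hw, by simpa [accepts, h] using hacc⟩
    · exact ⟨false :: w, by simpa using hw, by simpa [accepts, h] using hacc⟩

theorem NMachine.acc_accept {q : Q} (h : M.next q = .accept) (S : ∀ k, List (Γ k))
    (n : ℕ) : M.Acc (n + 1) q S :=
  ⟨[true], by simp, by simp [accepts, h]⟩

end

/-! ### Runs of the interpreter -/

section

variable (c : Code) {a b d : List Bool} {n : List Unit} {o : List Op}

/-- The state `stuck` only leads to itself, so every list of bits runs out there and is rejected. -/
theorem not_acc_stuck (m : ℕ) (S : ∀ k : IStack, List k.Sym) : ¬ (interp c).Acc m .stuck S := by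
  induction m with
  | zero => exact NMachine.not_acc_zero
  | succ m ih =>
    have := NMachine.Leads.goto (M := interp c) (q := .stuck) (q' := .stuck) rfl S (m + 1)
    rw [this]
    rintro ⟨n', h, h'⟩
    obtain rfl : n' = m := by omega
    exact ih h'

variable {c}

/-- A prefix code shows its own end: the counter holds the number of trees still to be read, every
bit uses up one of them, and an inner node adds two. Each bit takes three steps: test the counter,
read, write. The functions `f` and `g` describe what a written bit does to the stacks `b` and `d`.
-/
theorem leads_move {l : Loop} {f g : Bool → List Bool → List Bool}
    (hl : ∀ a b d n o x, pushAll (iStacks a b d n o) (l.write x) = iStacks a (f x b) (g x d) n o)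
    (t : BinTree) (a b d : List Bool) (n : List Unit) (o : List Op) :
    (interp c).Leads (3 * t.size) (.moveLoop l) (iStacks (t.code ++ a) b d (() :: n) o)
      (.moveLoop l) (iStacks a (t.code.foldl (fun b x => f x b) b)
        (t.code.foldl (fun d x => g x d) d) n o) := by
  induction t generalizing a b d n with
  | nil =>
    have h1 := NMachine.Leads.pop (M := interp c) (q := .moveLoop l) rfl
      (iStacks (false :: a) b d (() :: n) o)
    have h2 := NMachine.Leads.pop (M := interp c) (q := .moveRead l) rfl
      (iStacks (false :: a) b d n o)
    have h3 := NMachine.Leads.goto (M := interp c) (q := .moveWrite l false) rfl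
      (iStacks a b d n o)
    simp [interpPush, pushAll, hl] at h1 h2 h3
    exact (h1.trans (h2.trans h3)).cast rfl
  | node s t ihs iht =>
    have h1 := NMachine.Leads.pop (M := interp c) (q := .moveLoop l) rfl
      (iStacks (true :: (s.code ++ (t.code ++ a))) b d (() :: n) o)
    have h2 := NMachine.Leads.pop (M := interp c) (q := .moveRead l) rfl
      (iStacks (true :: (s.code ++ (t.code ++ a))) b d n o)
    have h3 := NMachine.Leads.goto (M := interp c) (q := .moveWrite l true) rfl
      (iStacks (s.code ++ (t.code ++ a)) b d n o)
    simp [interpPush, pushAll, hl, pushAll_append] at h1 h2 h3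
    have := (h1.trans (h2.trans h3)).trans ((ihs _ _ _ _).trans (iht _ _ _ _))
    simp only [BinTree.code, List.cons_append, List.append_assoc, List.foldl_cons,
      List.foldl_append]
    exact this.cast (by simp only [BinTree.size]; ring)

theorem leads_pour_b {l : Loop} {f g : Bool → List Bool → List Bool}
    (hn : (interp c).next (.pour l) = .pop .b (Loop.onRead c l))
    (hl : ∀ a b d n o x, pushAll (iStacks a b d n o) (l.write x) = iStacks (f x a) b (g x d) n o)
    (a b d : List Bool) (n : List Unit) (o : List Op) :
    (interp c).Leads (2 * b.length + 1) (.pour l) (iStacks a b d n o)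
      (l.after c) (iStacks (b.foldl (fun a x => f x a) a) [] (b.foldl (fun d x => g x d) d) n o) := by
  induction b generalizing a d with
  | nil =>
    have h1 := NMachine.Leads.pop hn (iStacks a [] d n o)
    simpa [interpPush, pushAll, Loop.onRead] using h1
  | cons x b ih =>
    have h1 := NMachine.Leads.pop hn (iStacks a (x :: b) d n o)
    have h2 := NMachine.Leads.goto (M := interp c) (q := .pourWrite l x) rfl
      (iStacks a b d n o)
    simp [interpPush, pushAll, hl, Loop.onRead] at h1 h2
    exact (h1.trans (h2.trans (ih _ _))).cast (by simp; ring)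

theorem leads_pour_d {l : Loop} {f g : Bool → List Bool → List Bool}
    (hn : (interp c).next (.pour l) = .pop .d (Loop.onRead c l))
    (hl : ∀ a b d n o x, pushAll (iStacks a b d n o) (l.write x) = iStacks (f x a) (g x b) d n o)
    (a b d : List Bool) (n : List Unit) (o : List Op) :
    (interp c).Leads (2 * d.length + 1) (.pour l) (iStacks a b d n o)
      (l.after c) (iStacks (d.foldl (fun a x => f x a) a) (d.foldl (fun b x => g x b) b) [] n o) := by
  induction d generalizing a b with
  | nil =>
    have h1 := NMachine.Leads.pop hn (iStacks a b [] n o)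
    simpa [interpPush, pushAll, Loop.onRead] using h1
  | cons x d ih =>
    have h1 := NMachine.Leads.pop hn (iStacks a b (x :: d) n o)
    have h2 := NMachine.Leads.goto (M := interp c) (q := .pourWrite l x) rfl
      (iStacks a b d n o)
    simp [interpPush, pushAll, hl, Loop.onRead] at h1 h2
    exact (h1.trans (h2.trans (ih _ _))).cast (by simp; ring)

theorem foldl_cons_eq {α : Type} (l m : List α) :
    l.foldl (fun b x => x :: b) m = l.reverse ++ m := by
  induction l generalizing m with
  | nil => rfl
  | cons x l ih => simp [ih]

theorem foldl_const_eq {α β : Type} (l : List α) (m : β) : l.foldl (fun b _ => b) m = m := by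
  induction l with
  | nil => rfl
  | cons x l ih => exact ih

/-- A complete run of a moving loop. -/
theorem leads_moveStart {l : Loop} {f g : Bool → List Bool → List Bool}
    (hl : ∀ a b d n o x, pushAll (iStacks a b d n o) (l.write x) = iStacks a (f x b) (g x d) n o)
    (t : BinTree) (a b d : List Bool) (o : List Op) :
    (interp c).Leads (3 * t.size + 2) (.moveStart l) (iStacks (t.code ++ a) b d [] o)
      (l.after c) (iStacks a (t.code.foldl (fun b x => f x b) b)
        (t.code.foldl (fun d x => g x d) d) [] o) := by
  have h1 := NMachine.Leads.goto (M := interp c) (q := .moveStart l) rfl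
    (iStacks (t.code ++ a) b d [] o)
  have h2 := NMachine.Leads.pop (M := interp c) (q := .moveLoop l) rfl
    (iStacks a (t.code.foldl (fun b x => f x b) b) (t.code.foldl (fun d x => g x d) d) [] o)
  simp [interpPush, pushAll] at h1 h2
  exact (h1.trans ((leads_move hl t a b d [] o).trans h2)).cast (by ring)

variable (c) in
/-- The configuration of the interpreter with given remaining instructions and stack of trees. -/
abbrev AccOps (n : ℕ) (o : List Op) (s : List BinTree) : Prop :=
  (interp c).Acc n .fetch (iStacks (s.flatMap code) [] [] [] o)

variable (c) in
/-- The instructions `o` with the stack `s` lead to `o'` and `s'` in `m` steps. -/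
abbrev LeadsOps (m : ℕ) (o : List Op) (s : List BinTree) (o' : List Op) (s' : List BinTree) :
    Prop :=
  (interp c).Leads m .fetch (iStacks (s.flatMap code) [] [] [] o) .fetch
    (iStacks (s'.flatMap code) [] [] [] o')

theorem leads_fetch (a : List Bool) (x : Op) (o : List Op) :
    (interp c).Leads 1 .fetch (iStacks a [] [] [] (x :: o)) (fetchState c (some x))
      (iStacks a [] [] [] o) := by
  have h1 := NMachine.Leads.pop (M := interp c) (q := .fetch) rfl (iStacks a [] [] [] (x :: o))
  simpa [interpPush, pushAll] using h1

theorem leadsOps_drop (o : List Op) (x : BinTree) (s : List BinTree) :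
    LeadsOps c (3 * x.size + 3) (.drop :: o) (x :: s) o s := by
  have h := leads_moveStart (c := c) (l := .drop) (f := fun _ b => b) (g := fun _ d => d)
    (by intros; rfl) x (s.flatMap code) [] [] o
  simp only [foldl_const_eq] at h
  exact ((leads_fetch _ _ _).trans h).cast (by ring)

theorem leadsOps_dup (o : List Op) (x : BinTree) (s : List BinTree) :
    LeadsOps c (9 * x.size + 6) (.dup :: o) (x :: s) o (x :: x :: s) := by
  -- The tree arrives on `b` reversed, and pouring it back leaves one copy on `a` and one on `d`.
  -- The second copy returns through `b`, because pouring it from `d` directly onto `a` would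
  -- reverse it.
  have h0 := leads_moveStart (c := c) (l := .dup₀) (f := fun x b => x :: b) (g := fun _ d => d)
    (by intros; simp [Loop.write, pushAll]) x (s.flatMap code) [] [] o
  have h1 := leads_pour_b (c := c) (l := .dup₁) (f := fun x b => x :: b) (g := fun x b => x :: b)
    rfl (by intros; simp [Loop.write, pushAll]) (s.flatMap code) x.code.reverse [] [] o
  have h2 := leads_pour_d (c := c) (l := .dup₂) (f := fun _ b => b) (g := fun x b => x :: b)
    rfl (by intros; simp [Loop.write, pushAll]) (x.code ++ s.flatMap code) [] x.code [] o
  have h3 := leads_pour_b (c := c) (l := .dup₃) (f := fun x b => x :: b) (g := fun _ b => b)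
    rfl (by intros; simp [Loop.write, pushAll]) (x.code ++ s.flatMap code) x.code.reverse [] [] o
  simp only [foldl_const_eq, foldl_cons_eq, List.append_nil, List.reverse_reverse,
    List.length_reverse, length_code] at h0 h1 h2 h3
  exact ((leads_fetch _ _ _).trans (h0.trans (h1.trans (h2.trans h3)))).cast (by ring)

theorem leadsOps_swap (o : List Op) (x y : BinTree) (s : List BinTree) :
    LeadsOps c (5 * (x.size + y.size) + 7) (.swap :: o) (x :: y :: s) o (y :: x :: s) := by
  have h0 := leads_moveStart (c := c) (l := .swap₀) (f := fun x b => x :: b) (g := fun _ d => d)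
    (by intros; simp [Loop.write, pushAll]) x (y.code ++ s.flatMap code) [] [] o
  have h1 := leads_moveStart (c := c) (l := .swap₁) (f := fun _ b => b) (g := fun x b => x :: b)
    (by intros; simp [Loop.write, pushAll]) y (s.flatMap code) x.code.reverse [] o
  have h2 := leads_pour_b (c := c) (l := .swap₂) (f := fun x b => x :: b) (g := fun _ b => b)
    rfl (by intros; simp [Loop.write, pushAll]) (s.flatMap code) x.code.reverse
    y.code.reverse [] o
  have h3 := leads_pour_d (c := c) (l := .swap₃) (f := fun x b => x :: b) (g := fun _ b => b)
    rfl (by intros; simp [Loop.write, pushAll]) (x.code ++ s.flatMap code) [] y.code.reverse [] o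
  simp only [foldl_const_eq, foldl_cons_eq, List.append_nil, List.reverse_reverse,
    List.length_reverse, length_code] at h0 h1 h2 h3
  exact ((leads_fetch _ _ _).trans (h0.trans (h1.trans (h2.trans h3)))).cast (by ring)

theorem leadsOps_popNode (o : List Op) (x y : BinTree) (s : List BinTree) :
    LeadsOps c 2 (.popNode :: o) (node x y :: s) o (x :: y :: s) := by
  have h1 := NMachine.Leads.pop (M := interp c) (q := .prim 0) rfl
    (iStacks (true :: (x.code ++ (y.code ++ s.flatMap code))) [] [] [] o)
  simp [interpPush, pushAll] at h1
  have := (leads_fetch (c := c) _ .popNode _).trans h1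
  simpa [LeadsOps, BinTree.code, fetchState] using this

theorem leadsOps_pushNode (o : List Op) (x y : BinTree) (s : List BinTree) :
    LeadsOps c 2 (.pushNode :: o) (x :: y :: s) o (node x y :: s) := by
  have h1 := NMachine.Leads.goto (M := interp c) (q := .prim 1) rfl
    (iStacks (x.code ++ (y.code ++ s.flatMap code)) [] [] [] o)
  simp [interpPush, pushAll] at h1
  have := (leads_fetch (c := c) _ .pushNode _).trans h1
  simpa [LeadsOps, BinTree.code, fetchState] using this

theorem leadsOps_popNil (o : List Op) (s : List BinTree) :
    LeadsOps c 2 (.popNil :: o) (.nil :: s) o s := by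
  have h1 := NMachine.Leads.pop (M := interp c) (q := .prim 2) rfl
    (iStacks (false :: s.flatMap code) [] [] [] o)
  simp [interpPush, pushAll] at h1
  have := (leads_fetch (c := c) _ .popNil _).trans h1
  simpa [LeadsOps, BinTree.code, fetchState] using this

theorem leadsOps_pushNil (o : List Op) (s : List BinTree) :
    LeadsOps c 2 (.pushNil :: o) s o (.nil :: s) := by
  have h1 := NMachine.Leads.goto (M := interp c) (q := .prim 3) rfl
    (iStacks (s.flatMap code) [] [] [] o)
  simp [interpPush, pushAll] at h1
  have := (leads_fetch (c := c) _ .pushNil _).trans h1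
  simpa [LeadsOps, BinTree.code, fetchState] using this

theorem not_acc_of_leads_stuck {m : ℕ} {q : IState c} {S S' : ∀ k : IStack, List k.Sym}
    (h : (interp c).Leads m q S .stuck S') (n : ℕ) : ¬ (interp c).Acc n q S := by
  rw [h n]
  rintro ⟨n', -, h'⟩
  exact not_acc_stuck c n' _ h'

theorem not_accOps_popNode_nil (n : ℕ) (o : List Op) (s : List BinTree) :
    ¬ AccOps c n (.popNode :: o) (.nil :: s) := by
  have h1 := NMachine.Leads.pop (M := interp c) (q := .prim 0) rfl
    (iStacks (false :: s.flatMap code) [] [] [] o)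
  simp [interpPush, pushAll] at h1
  exact not_acc_of_leads_stuck ((leads_fetch (c := c) _ _ _).trans h1) n

theorem not_accOps_popNil_node (n : ℕ) (o : List Op) (x y : BinTree) (s : List BinTree) :
    ¬ AccOps c n (.popNil :: o) (node x y :: s) := by
  have h1 := NMachine.Leads.pop (M := interp c) (q := .prim 2) rfl
    (iStacks (true :: (x.code ++ y.code ++ s.flatMap code)) [] [] [] o)
  simp [interpPush, pushAll] at h1
  have := not_acc_of_leads_stuck ((leads_fetch (c := c) _ .popNil _).trans h1) n
  simpa [AccOps, BinTree.code] using this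

theorem accOps_nil (n : ℕ) (s : List BinTree) : AccOps c (n + 2) [] s := by
  have h1 := NMachine.Leads.pop (M := interp c) (q := .fetch) rfl
    (iStacks (s.flatMap code) [] [] [] [])
  simp [interpPush, pushAll, fetchState] at h1
  exact (h1 _).2 ⟨n + 1, rfl, NMachine.acc_accept rfl _ _⟩

/-- Three steps: fetch, choose, push the expansion. For all programs but `union` and `recur` the two
expansions coincide, so the choice is immaterial. -/
theorem accOps_code {d : Code} (hd : d ∈ c.subs) (n : ℕ) (o : List Op) (s : List BinTree) :
    AccOps c n (.code d :: o) s ↔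
      ∃ n', n = n' + 3 ∧ (AccOps c n' (d.expand true ++ o) s ∨ AccOps c n' (d.expand false ++ o) s) := by
  have h1 := leads_fetch (c := c) (s.flatMap code) (.code d) o
  simp only [fetchState, hd, dif_pos] at h1
  have h2 : ∀ b, (interp c).Leads 1 (.expand ⟨d, hd⟩ b) (iStacks (s.flatMap code) [] [] [] o)
      .fetch (iStacks (s.flatMap code) [] [] [] (d.expand b ++ o)) := by
    intro b
    rw [← pushAll_ctl]
    exact NMachine.Leads.goto (M := interp c) rfl _
  rw [AccOps, h1 n]
  constructor
  · rintro ⟨_ | n', rfl, h⟩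
    · exact absurd h NMachine.not_acc_zero
    · rw [NMachine.acc_choose (M := interp c) rfl] at h
      rcases h with h | h
      · obtain ⟨k, rfl, hk⟩ := (h2 true _).1 h
        exact ⟨k, by ring, .inl hk⟩
      · obtain ⟨k, rfl, hk⟩ := (h2 false _).1 h
        exact ⟨k, by ring, .inr hk⟩
  · rintro ⟨n', rfl, h⟩
    refine ⟨n' + 2, by ring, ?_⟩
    rw [NMachine.acc_choose (M := interp c) rfl]
    rcases h with h | h
    · exact .inl ((h2 true _).2 ⟨n', rfl, h⟩)
    · exact .inr ((h2 false _).2 ⟨n', rfl, h⟩)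

end

theorem LeadsOps.acc {c : Code} {m : ℕ} {o o' : List Op} {s s' : List BinTree}
    (h : LeadsOps c m o s o' s') {n : ℕ} (h' : AccOps c n o s) :
    ∃ n', n = n' + m ∧ AccOps c n' o' s' := (h n).1 h'

theorem LeadsOps.acc_of {c : Code} {m : ℕ} {o o' : List Op} {s s' : List BinTree}
    (h : LeadsOps c m o s o' s') {n k : ℕ} (h' : AccOps c n o' s') (e : n + m ≤ k) :
    AccOps c k o s := ((h (n + m)).2 ⟨n, rfl, h'⟩).mono e

/-! ### Agreement of the interpreter with the evaluation of programs -/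

/-- Every accepting computation of the interpreter evaluates the first program. -/
theorem exists_ev_of_accOps {c : Code} (n : ℕ) (d : Code) (hd : d ∈ c.subs) (o : List Op)
    (x : BinTree) (s : List BinTree) (h₀ : AccOps c n (.code d :: o) (x :: s)) :
    ∃ y k n', n' < n ∧ d.Ev x y k ∧ AccOps c n' o (y :: s) := by
  -- The induction is on the remaining time, not on the program: a `recur` expands into calls of
  -- itself, but every expansion uses three steps.
  induction n using Nat.strong_induction_on generalizing d o x s with
  | _ n ih =>
  obtain ⟨n, rfl, h⟩ := (accOps_code hd _ _ _).1 h₀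
  clear h₀
  cases d with
  | id =>
    simp only [Code.expand, List.nil_append, or_self] at h
    exact ⟨x, _, n, by omega, .id x, h⟩
  | nil =>
    simp only [Code.expand, or_self, List.cons_append, List.nil_append] at h
    obtain ⟨n, _, h⟩ := (leadsOps_drop _ _ _).acc h
    obtain ⟨n, _, h⟩ := (leadsOps_pushNil _ _).acc h
    exact ⟨.nil, _, n, by omega, .nil x, h⟩
  | isNil =>
    simp only [Code.expand, or_self, List.cons_append, List.nil_append] at h
    cases x with
    | node x y => exact absurd h (not_accOps_popNil_node _ _ _ _ _)
    | nil =>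
      obtain ⟨n, _, h⟩ := (leadsOps_popNil _ _).acc h
      obtain ⟨n, _, h⟩ := (leadsOps_pushNil _ _).acc h
      exact ⟨.nil, _, n, by omega, .isNil, h⟩
  | fst =>
    simp only [Code.expand, or_self, List.cons_append, List.nil_append] at h
    cases x with
    | nil => exact absurd h (not_accOps_popNode_nil _ _ _)
    | node x y =>
      obtain ⟨n, _, h⟩ := (leadsOps_popNode _ _ _ _).acc h
      obtain ⟨n, _, h⟩ := (leadsOps_swap _ _ _ _).acc h
      obtain ⟨n, _, h⟩ := (leadsOps_drop _ _ _).acc h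
      exact ⟨x, _, n, by omega, .fst x y, h⟩
  | snd =>
    simp only [Code.expand, or_self, List.cons_append, List.nil_append] at h
    cases x with
    | nil => exact absurd h (not_accOps_popNode_nil _ _ _)
    | node x y =>
      obtain ⟨n, _, h⟩ := (leadsOps_popNode _ _ _ _).acc h
      obtain ⟨n, _, h⟩ := (leadsOps_drop _ _ _).acc h
      exact ⟨y, _, n, by omega, .snd x y, h⟩
  | comp f g =>
    have hf : f ∈ c.subs := Code.subs_trans (by simp [Code.subs, Code.mem_subs_self]) hd
    have hg : g ∈ c.subs := Code.subs_trans (by simp [Code.subs, Code.mem_subs_self]) hd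
    simp only [Code.expand, or_self, List.cons_append, List.nil_append] at h
    obtain ⟨y, k, n₁, h₁, hy, h⟩ := ih n (by omega) f hf _ _ _ h
    obtain ⟨z, l, n₂, h₂, hz, h⟩ := ih n₁ (by omega) g hg _ _ _ h
    exact ⟨z, _, n₂, by omega, .comp hy hz, h⟩
  | pair f g =>
    have hf : f ∈ c.subs := Code.subs_trans (by simp [Code.subs, Code.mem_subs_self]) hd
    have hg : g ∈ c.subs := Code.subs_trans (by simp [Code.subs, Code.mem_subs_self]) hd
    simp only [Code.expand, or_self, List.cons_append, List.nil_append] at h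
    obtain ⟨n, _, h⟩ := (leadsOps_dup _ _ _).acc h
    obtain ⟨z, l, n₁, h₁, hz, h⟩ := ih n (by omega) g hg _ _ _ h
    obtain ⟨n₁, _, h⟩ := (leadsOps_swap _ _ _ _).acc h
    obtain ⟨y, k, n₂, h₂, hy, h⟩ := ih n₁ (by omega) f hf _ _ _ h
    obtain ⟨n₂, _, h⟩ := (leadsOps_pushNode _ _ _ _).acc h
    exact ⟨_, _, n₂, by omega, .pair hy hz, h⟩
  | union f g =>
    have hf : f ∈ c.subs := Code.subs_trans (by simp [Code.subs, Code.mem_subs_self]) hd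
    have hg : g ∈ c.subs := Code.subs_trans (by simp [Code.subs, Code.mem_subs_self]) hd
    simp only [Code.expand, List.cons_append, List.nil_append, cond_true, cond_false] at h
    rcases h with h | h
    · obtain ⟨y, k, n₁, h₁, hy, h⟩ := ih n (by omega) f hf _ _ _ h
      exact ⟨y, _, n₁, by omega, .unionLeft hy, h⟩
    · obtain ⟨y, k, n₁, h₁, hy, h⟩ := ih n (by omega) g hg _ _ _ h
      exact ⟨y, _, n₁, by omega, .unionRight hy, h⟩
  | recur f g e =>
    have hf : f ∈ c.subs := Code.subs_trans (by simp [Code.subs, Code.mem_subs_self]) hd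
    have hg : g ∈ c.subs := Code.subs_trans (by simp [Code.subs, Code.mem_subs_self]) hd
    have he : e ∈ c.subs := Code.subs_trans (by simp [Code.subs, Code.mem_subs_self]) hd
    simp only [Code.expand, List.cons_append, List.nil_append] at h
    rcases h with h | h
    · obtain ⟨y, k, n₁, h₁, hy, h⟩ := ih n (by omega) f hf _ _ _ h
      exact ⟨y, _, n₁, by omega, .recBase hy, h⟩
    · obtain ⟨y, k, n₁, h₁, hy, h⟩ := ih n (by omega) g hg _ _ _ h
      cases y with
      | nil => exact absurd h (not_accOps_popNode_nil _ _ _)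
      | node u v =>
      obtain ⟨n₁, _, h⟩ := (leadsOps_popNode _ _ _ _).acc h
      obtain ⟨n₁, _, h⟩ := (leadsOps_swap _ _ _ _).acc h
      cases v with
      | nil => exact absurd h (not_accOps_popNode_nil _ _ _)
      | node x₁ x₂ =>
      obtain ⟨n₁, _, h⟩ := (leadsOps_popNode _ _ _ _).acc h
      obtain ⟨y₁, k₁, n₂, h₂, hy₁, h⟩ := ih n₁ (by omega) _ hd _ _ _ h
      obtain ⟨n₂, _, h⟩ := (leadsOps_swap _ _ _ _).acc h
      obtain ⟨y₂, k₂, n₃, h₃, hy₂, h⟩ := ih n₂ (by omega) _ hd _ _ _ h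
      obtain ⟨n₃, _, h⟩ := (leadsOps_swap _ _ _ _).acc h
      obtain ⟨n₃, _, h⟩ := (leadsOps_pushNode _ _ _ _).acc h
      obtain ⟨n₃, _, h⟩ := (leadsOps_swap _ _ _ _).acc h
      obtain ⟨n₃, _, h⟩ := (leadsOps_pushNode _ _ _ _).acc h
      obtain ⟨z, k₃, n₄, h₄, hz, h⟩ := ih n₃ (by omega) e he _ _ _ h
      exact ⟨z, _, n₄, by omega, .recStep hy hy₁ hy₂ hz, h⟩

/-- The interpreter follows every evaluation, in time proportional to its cost. -/
theorem accOps_of_ev {c d : Code} {x y : BinTree} {k : ℕ} (h : d.Ev x y k) (hd : d ∈ c.subs)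
    {o : List Op} {s : List BinTree} {n : ℕ} (h' : AccOps c n o (y :: s)) :
    AccOps c (n + 80 * k) (.code d :: o) (x :: s) := by
  -- Every stack operation takes time linear in the trees it moves, and the cost of an evaluation
  -- charges the sizes of these trees. The factor 80 absorbs all constants.
  induction h generalizing o s n with
  | id x =>
    exact (accOps_code hd _ _ _).2 ⟨_, rfl, .inl (h'.mono (by omega))⟩
  | nil x =>
    refine (accOps_code hd _ _ _).2 ⟨n + 80 * x.size - 3, by have := x.size_pos; omega, .inl ?_⟩
    refine (leadsOps_drop _ _ _).acc_of ((leadsOps_pushNil _ _).acc_of h' le_rfl) ?_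
    have := x.size_pos; omega
  | isNil =>
    refine (accOps_code hd _ _ _).2 ⟨_, rfl, .inl ?_⟩
    exact (leadsOps_popNil _ _).acc_of ((leadsOps_pushNil _ _).acc_of h' le_rfl) (by omega)
  | fst a b =>
    have ha := a.size_pos
    have hb := b.size_pos
    refine (accOps_code hd _ _ _).2 ⟨n + 80 * (a.size + b.size) - 3, by omega, .inl ?_⟩
    refine (leadsOps_popNode _ _ _ _).acc_of ((leadsOps_swap _ _ _ _).acc_of
      ((leadsOps_drop _ _ _).acc_of h' le_rfl) le_rfl) ?_
    omega
  | snd a b =>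
    have ha := a.size_pos
    have hb := b.size_pos
    refine (accOps_code hd _ _ _).2 ⟨n + 80 * (a.size + b.size) - 3, by omega, .inl ?_⟩
    refine (leadsOps_popNode _ _ _ _).acc_of ((leadsOps_drop _ _ _).acc_of h' le_rfl) ?_
    omega
  | @comp f g x y z k l hf hg ihf ihg =>
    have hf : f ∈ c.subs := Code.subs_trans (by simp [Code.subs, Code.mem_subs_self]) hd
    have hg : g ∈ c.subs := Code.subs_trans (by simp [Code.subs, Code.mem_subs_self]) hd
    refine (accOps_code hd _ _ _).2 ⟨n + 80 * (k + l + 1) - 3, by omega, .inl ?_⟩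
    exact (ihf hf (ihg hg h')).mono (by omega)
  | @pair f g x y z k l hf hg ihf ihg =>
    have hf : f ∈ c.subs := Code.subs_trans (by simp [Code.subs, Code.mem_subs_self]) hd
    have hg : g ∈ c.subs := Code.subs_trans (by simp [Code.subs, Code.mem_subs_self]) hd
    have hx := x.size_pos
    have hz := z.size_pos
    refine (accOps_code hd _ _ _).2 ⟨n + 80 * (k + l + x.size + z.size) - 3, by omega, .inl ?_⟩
    refine (leadsOps_dup _ _ _).acc_of (ihg hg ((leadsOps_swap _ _ _ _).acc_of
      (ihf hf ((leadsOps_pushNode _ _ _ _).acc_of h' le_rfl)) le_rfl)) ?_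
    omega
  | @unionLeft f g x y k hf ihf =>
    have hf : f ∈ c.subs := Code.subs_trans (by simp [Code.subs, Code.mem_subs_self]) hd
    refine (accOps_code hd _ _ _).2 ⟨n + 80 * (k + 1) - 3, by omega, .inl ?_⟩
    exact (ihf hf h').mono (by omega)
  | @unionRight f g x y k hg ihg =>
    have hg : g ∈ c.subs := Code.subs_trans (by simp [Code.subs, Code.mem_subs_self]) hd
    refine (accOps_code hd _ _ _).2 ⟨n + 80 * (k + 1) - 3, by omega, .inr ?_⟩
    exact (ihg hg h').mono (by omega)
  | @recBase f g e x y k hf ihf =>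
    have hf : f ∈ c.subs := Code.subs_trans (by simp [Code.subs, Code.mem_subs_self]) hd
    refine (accOps_code hd _ _ _).2 ⟨n + 80 * (k + 1) - 3, by omega, .inl ?_⟩
    exact (ihf hf h').mono (by omega)
  | @recStep f g e x k x₁ x₂ y₁ y₂ y l l₁ l₂ m h₁ h₂ h₃ h₄ ih₁ ih₂ ih₃ ih₄ =>
    have hg : g ∈ c.subs := Code.subs_trans (by simp [Code.subs, Code.mem_subs_self]) hd
    have he : e ∈ c.subs := Code.subs_trans (by simp [Code.subs, Code.mem_subs_self]) hd
    have p₁ := x₁.size_pos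
    have p₂ := x₂.size_pos
    have p₃ := y₁.size_pos
    have p₄ := y₂.size_pos
    have p₅ := k.size_pos
    refine (accOps_code hd _ _ _).2 ⟨n + 80 * (l + l₁ + l₂ + m + (k.size + x₁.size + x₂.size +
      y₁.size + y₂.size)) - 3, by omega, .inr ?_⟩
    refine (ih₁ hg ((leadsOps_popNode _ _ _ _).acc_of ((leadsOps_swap _ _ _ _).acc_of
      ((leadsOps_popNode _ _ _ _).acc_of (ih₂ hd ((leadsOps_swap _ _ _ _).acc_of
      (ih₃ hd ((leadsOps_swap _ _ _ _).acc_of ((leadsOps_pushNode _ _ _ _).acc_of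
      ((leadsOps_swap _ _ _ _).acc_of ((leadsOps_pushNode _ _ _ _).acc_of (ih₄ he h') le_rfl)
      le_rfl) le_rfl) le_rfl)) le_rfl)) le_rfl) le_rfl) le_rfl)).mono ?_
    simp only [BinTree.size]
    omega

/-! ### Polynomial bounds -/

/-- `B` is bounded by a polynomial. -/
@[fun_prop]
def PolyBd (B : ℕ → ℕ) : Prop := ∃ k, ∀ n, B n ≤ (n + 2) ^ k

@[fun_prop]
theorem PolyBd.id : PolyBd fun n => n := ⟨1, fun n => by simp⟩

-- The summand 2 in the base keeps it at least 2 even at `n = 0`, so that `m ≤ 2 ^ m` suffices.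
@[fun_prop]
theorem PolyBd.const (m : ℕ) : PolyBd fun _ => m :=
  ⟨m, fun n => (Nat.lt_two_pow_self).le.trans (Nat.pow_le_pow_left (by omega) m)⟩

@[fun_prop]
theorem PolyBd.mul {B C : ℕ → ℕ} (hB : PolyBd B) (hC : PolyBd C) :
    PolyBd fun n => B n * C n := by
  obtain ⟨k, hk⟩ := hB
  obtain ⟨l, hl⟩ := hC
  exact ⟨k + l, fun n => by rw [pow_add]; exact Nat.mul_le_mul (hk n) (hl n)⟩

@[fun_prop]
theorem PolyBd.add {B C : ℕ → ℕ} (hB : PolyBd B) (hC : PolyBd C) :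
    PolyBd fun n => B n + C n := by
  obtain ⟨k, hk⟩ := hB
  obtain ⟨l, hl⟩ := hC
  refine ⟨k + l + 1, fun n => ?_⟩
  have h1 : B n ≤ (n + 2) ^ (k + l) := (hk n).trans (Nat.pow_le_pow_right (by omega) (by omega))
  have h2 : C n ≤ (n + 2) ^ (k + l) := (hl n).trans (Nat.pow_le_pow_right (by omega) (by omega))
  rw [pow_succ]
  nlinarith

@[fun_prop]
theorem PolyBd.pow {B : ℕ → ℕ} (hB : PolyBd B) (m : ℕ) : PolyBd fun n => B n ^ m := by
  obtain ⟨k, hk⟩ := hB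
  exact ⟨k * m, fun n => by rw [pow_mul]; exact Nat.pow_le_pow_left (hk n) m⟩

/-! ### Deterministic evaluation -/

/-- On input `x`, the program returns `y` at cost at most `k`, and nothing else. -/
def Code.Runs (c : Code) (x y : BinTree) (k : ℕ) : Prop :=
  (∃ n ≤ k, c.Ev x y n) ∧ ∀ t n, c.Ev x t n → t = y

/-- On input `x`, the program returns nothing. -/
def Code.Fails (c : Code) (x : BinTree) : Prop := ∀ t n, ¬ c.Ev x t n

/-- Costs were chosen to include the trees that get duplicated, so a result can outgrow the input
only by what has been paid. Hence a bound on the cost is also a bound on the size of the value. -/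
theorem Code.Ev.size_le {c : Code} {x y : BinTree} {n : ℕ} (h : c.Ev x y n) :
    y.size ≤ x.size + n := by
  induction h with
  | @pair _ _ x _ _ _ _ _ _ ihf ihg => have := x.size_pos; simp only [BinTree.size]; omega
  | id x => omega
  | nil x => have := x.size_pos; simp only [BinTree.size]; omega
  | isNil | fst | snd => simp only [BinTree.size]; omega
  | recStep _ _ _ _ h₁ h₂ h₃ h₄ => simp only [BinTree.size] at h₁ h₄ ⊢; omega
  | _ => omega

namespace Code

variable {f g b s c : Code} {x y z : BinTree} {k l : ℕ}

theorem Runs.mono (h : f.Runs x y k) (hk : k ≤ l) : f.Runs x y l := by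
  obtain ⟨⟨n, hn, h⟩, h'⟩ := h
  exact ⟨⟨n, hn.trans hk, h⟩, h'⟩

theorem Runs.size_le (h : f.Runs x y k) : y.size ≤ x.size + k := by
  obtain ⟨⟨n, hn, h⟩, -⟩ := h
  have := h.size_le
  omega

theorem Runs.id (x : BinTree) : Code.id.Runs x x 1 :=
  ⟨⟨1, le_rfl, .id x⟩, by rintro _ _ ⟨⟩; rfl⟩

theorem Runs.nil (x : BinTree) : Code.nil.Runs x .nil x.size :=
  ⟨⟨_, le_rfl, .nil x⟩, by rintro _ _ ⟨⟩; rfl⟩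

theorem Runs.isNil : Code.isNil.Runs .nil .nil 1 :=
  ⟨⟨_, le_rfl, .isNil⟩, by rintro _ _ ⟨⟩; rfl⟩

theorem Runs.fst (x y : BinTree) : Code.fst.Runs (node x y) x (x.size + y.size) :=
  ⟨⟨_, le_rfl, .fst x y⟩, by rintro _ _ ⟨⟩; rfl⟩

theorem Runs.snd (x y : BinTree) : Code.snd.Runs (node x y) y (x.size + y.size) :=
  ⟨⟨_, le_rfl, .snd x y⟩, by rintro _ _ ⟨⟩; rfl⟩

theorem Fails.isNil (x y : BinTree) : Code.isNil.Fails (node x y) := by rintro _ _ ⟨⟩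

theorem Fails.fst : Code.fst.Fails .nil := by rintro _ _ ⟨⟩

theorem Runs.comp (hf : f.Runs x y k) (hg : g.Runs y z l) :
    (Code.comp f g).Runs x z (k + l + 1) := by
  obtain ⟨⟨n, hn, hf⟩, hf'⟩ := hf
  obtain ⟨⟨m, hm, hg⟩, hg'⟩ := hg
  refine ⟨⟨_, by omega, .comp hf hg⟩, ?_⟩
  rintro t _ (_ | _ | _ | _ | _ | ⟨h, h'⟩)
  obtain rfl := hf' _ _ h
  exact hg' _ _ h'

theorem Fails.comp (hf : f.Fails x) : (Code.comp f g).Fails x := by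
  rintro t _ (_ | _ | _ | _ | _ | ⟨h, h'⟩)
  exact hf _ _ h

theorem Fails.comp' (hf : f.Runs x y k) (hg : g.Fails y) : (Code.comp f g).Fails x := by
  rintro t _ (_ | _ | _ | _ | _ | ⟨h, h'⟩)
  obtain rfl := hf.2 _ _ h
  exact hg _ _ h'

/-- The cost of a pair includes the size of its second component, which is at most `x.size + l`;
hence the two factors 2. -/
theorem Runs.pair (hf : f.Runs x y k) (hg : g.Runs x z l) :
    (Code.pair f g).Runs x (node y z) (k + 2 * l + 2 * x.size) := by
  have hz := hg.size_le
  obtain ⟨⟨n, hn, hf⟩, hf'⟩ := hf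
  obtain ⟨⟨m, hm, hg⟩, hg'⟩ := hg
  refine ⟨⟨_, by omega, .pair hf hg⟩, ?_⟩
  intro t _ h
  cases h with
  | pair h h' => rw [hf' _ _ h, hg' _ _ h']

theorem Fails.pair (hf : f.Fails x) : (Code.pair f g).Fails x := by
  intro t _ h
  cases h with
  | pair h h' => exact hf _ _ h

theorem Fails.pair' (hg : g.Fails x) : (Code.pair f g).Fails x := by
  intro t _ h
  cases h with
  | pair h h' => exact hg _ _ h'

/-- Deterministic branching is obtained from nondeterministic choice by making one of the
alternatives fail. This is why failure is tracked alongside success. -/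
theorem Runs.unionLeft (hf : f.Runs x y k) (hg : g.Fails x) :
    (Code.union f g).Runs x y (k + 1) := by
  obtain ⟨⟨n, hn, hf⟩, hf'⟩ := hf
  refine ⟨⟨_, by omega, .unionLeft hf⟩, ?_⟩
  intro t _ h
  cases h with
  | unionLeft h => exact hf' _ _ h
  | unionRight h => exact absurd h (hg _ _)

theorem Runs.unionRight (hf : f.Fails x) (hg : g.Runs x y k) :
    (Code.union f g).Runs x y (k + 1) := by
  obtain ⟨⟨n, hn, hg⟩, hg'⟩ := hg
  refine ⟨⟨_, by omega, .unionRight hg⟩, ?_⟩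
  intro t _ h
  cases h with
  | unionLeft h => exact absurd h (hf _ _)
  | unionRight h => exact hg' _ _ h

theorem Fails.union (hf : f.Fails x) (hg : g.Fails x) : (Code.union f g).Fails x := by
  intro t _ h
  cases h with
  | unionLeft h => exact hf _ _ h
  | unionRight h => exact hg _ _ h

/-- A recursor is always free to stop or to split; it is deterministic only where exactly one of the
two programs has a result. -/
theorem Runs.recBase (hb : b.Runs x y k) (hs : s.Fails x) :
    (Code.recur b s c).Runs x y (k + 1) := by
  obtain ⟨⟨n, hn, hf⟩, hf'⟩ := hb
  refine ⟨⟨_, by omega, .recBase hf⟩, ?_⟩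
  intro t _ h
  cases h with
  | recBase h => exact hf' _ _ h
  | recStep h => exact absurd h (hs _ _)

theorem Runs.recStep {u x₁ x₂ y₁ y₂ : BinTree} {n₁ n₂ n₃ n₄ : ℕ} (hb : b.Fails x)
    (hs : s.Runs x (node u (node x₁ x₂)) n₁) (h₁ : (Code.recur b s c).Runs x₁ y₁ n₂)
    (h₂ : (Code.recur b s c).Runs x₂ y₂ n₃) (hc : c.Runs (node u (node y₁ y₂)) y n₄) :
    (Code.recur b s c).Runs x y
      (n₁ + n₂ + n₃ + n₄ + (u.size + x₁.size + x₂.size + y₁.size + y₂.size)) := by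
  obtain ⟨⟨m₁, hm₁, e₁⟩, hs'⟩ := hs
  obtain ⟨⟨m₂, hm₂, e₂⟩, h₁'⟩ := h₁
  obtain ⟨⟨m₃, hm₃, e₃⟩, h₂'⟩ := h₂
  obtain ⟨⟨m₄, hm₄, e₄⟩, hc'⟩ := hc
  refine ⟨⟨_, by omega, .recStep e₁ e₂ e₃ e₄⟩, ?_⟩
  intro t _ h
  cases h with
  | recBase h => exact absurd h (hb _ _)
  | recStep h h' h'' h''' =>
    have e := hs' _ _ h
    simp only [node.injEq] at e
    obtain ⟨rfl, rfl, rfl⟩ := e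
    obtain rfl := h₁' _ _ h'
    obtain rfl := h₂' _ _ h''
    exact hc' _ _ h'''

end Code

/-! ### Data types -/

/-- A representation of the elements of a type by trees. -/
class TEnc (α : Type) where
  enc : α → BinTree
  enc_inj : Function.Injective enc

/-- The size of the tree representing `x`. -/
abbrev sz {α : Type} [TEnc α] (x : α) : ℕ := (TEnc.enc x).size

open TEnc

instance : TEnc Unit := ⟨fun _ => .nil, fun _ _ _ => rfl⟩

instance : TEnc Bool := ⟨fun b => bif b then node .nil .nil else .nil, by
  intro a b; cases a <;> cases b <;> simp⟩

instance {α β : Type} [TEnc α] [TEnc β] : TEnc (α × β) :=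
  ⟨fun x => node (enc x.1) (enc x.2), fun x y h => by
    simp only [node.injEq] at h
    exact Prod.ext (enc_inj h.1) (enc_inj h.2)⟩

instance {α : Type} [TEnc α] : TEnc (Option α) :=
  ⟨fun x => x.elim .nil fun a => node (enc a) .nil, fun x y h => by
    cases x <;> cases y <;> simp_all [enc_inj.eq_iff]⟩

/-- The tree representing a list. -/
def encList {α : Type} [TEnc α] : List α → BinTree
  | [] => .nil
  | a :: l => node (enc a) (encList l)

instance {α : Type} [TEnc α] : TEnc (List α) :=
  ⟨encList, fun x y h => by
    induction x generalizing y with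
    | nil => cases y <;> simp_all [encList]
    | cons a x ih =>
      cases y with
      | nil => simp [encList] at h
      | cons b y =>
        simp only [encList, node.injEq] at h
        rw [enc_inj h.1, @ih y h.2]⟩

instance : TEnc ℕ :=
  ⟨fun n => enc (Computability.encodeNat n), fun m n h => by
    rw [← Computability.decode_encodeNat m, enc_inj h, Computability.decode_encodeNat]⟩

section

variable {α β : Type} [TEnc α] [TEnc β]

theorem enc_true : enc true = node .nil .nil := rfl
theorem enc_false : enc false = BinTree.nil := rfl
theorem enc_nil : enc ([] : List α) = .nil := rfl

theorem sz_pos (a : α) : 0 < sz a := size_pos _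
theorem sz_pair (a : α) (b : β) : sz (a, b) = sz a + sz b + 1 := rfl
theorem sz_nil : sz ([] : List α) = 1 := rfl
theorem sz_cons (a : α) (l : List α) : sz (a :: l) = sz a + sz l + 1 := rfl
theorem sz_bool_le (b : Bool) : sz b ≤ 3 := by cases b <;> simp [sz, enc_true, enc_false, size]
theorem sz_none : sz (none : Option α) = 1 := rfl
theorem sz_some (a : α) : sz (some a) = sz a + 2 := rfl

end

/-! ### Functions computable in nondeterministic polynomial time -/

/-- `f` is computed by a nondeterministic program with a unique result in polynomial time. -/
@[fun_prop]
def PolyFn {α β : Type} [TEnc α] [TEnc β] (f : α → β) : Prop :=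
  ∃ c : Code, ∃ k, ∀ x, c.Runs (enc x) (enc (f x)) ((sz x + 2) ^ k)

section

variable {α β γ δ : Type} [TEnc α] [TEnc β] [TEnc γ] [TEnc δ]

theorem PolyFn.of_runs {f : α → β} (c : Code) (B : ℕ → ℕ) (hB : PolyBd B)
    (h : ∀ x, c.Runs (enc x) (enc (f x)) (B (sz x))) : PolyFn f := by
  obtain ⟨k, hk⟩ := hB
  exact ⟨c, k, fun x => (h x).mono (hk _)⟩

theorem PolyFn.sz_le {f : α → β} (hf : PolyFn f) : ∃ k, ∀ x, sz (f x) ≤ (sz x + 2) ^ k := by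
  obtain ⟨c, k, h⟩ := hf
  obtain ⟨l, hl⟩ : PolyBd fun n => n + (n + 2) ^ k := by fun_prop
  exact ⟨l, fun x => (h x).size_le.trans (hl _)⟩

@[fun_prop]
theorem PolyFn.id : PolyFn fun x : α => x :=
  .of_runs .id (fun _ => 1) (by fun_prop) fun _ => .id _

@[fun_prop]
theorem PolyFn.comp {g : β → γ} {f : α → β} (hg : PolyFn g) (hf : PolyFn f) :
    PolyFn fun x => g (f x) := by
  obtain ⟨cf, k, hf⟩ := hf
  obtain ⟨cg, l, hg⟩ := hg
  refine .of_runs (.comp cf cg) (fun n => (n + 2) ^ k + (n + (n + 2) ^ k + 2) ^ l + 1)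
    (by fun_prop) fun x => ?_
  refine ((hf x).comp (hg (f x))).mono ?_
  have := (hf x).size_le
  gcongr

@[fun_prop]
theorem PolyFn.prodMk {f : α → β} {g : α → γ} (hf : PolyFn f) (hg : PolyFn g) :
    PolyFn fun x => (f x, g x) := by
  obtain ⟨cf, k, hf⟩ := hf
  obtain ⟨cg, l, hg⟩ := hg
  exact .of_runs (.pair cf cg) (fun n => (n + 2) ^ k + 2 * (n + 2) ^ l + 2 * n)
    (by fun_prop) fun x => (hf x).pair (hg x)

/-- The program returning a constant. -/
def Code.const : BinTree → Code
  | .nil => .nil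
  | .node a b => .pair (.const a) (.const b)

/-- Every leaf of the constant is made by the program `nil`, which discards its whole input and pays
for its size. -/
theorem Code.runs_const (t : BinTree) : ∃ k, ∀ x, (Code.const t).Runs x t (k * x.size) := by
  induction t with
  | nil => exact ⟨1, fun x => (Runs.nil x).mono (by omega)⟩
  | node a b iha ihb =>
    obtain ⟨k, hk⟩ := iha
    obtain ⟨l, hl⟩ := ihb
    exact ⟨k + 2 * l + 2, fun x => ((hk x).pair (hl x)).mono (by ring_nf; omega)⟩

@[fun_prop]
theorem PolyFn.const (b : β) : PolyFn fun _ : α => b := by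
  obtain ⟨k, hk⟩ := Code.runs_const (enc b)
  exact .of_runs (.const (enc b)) (fun n => k * n) (by fun_prop) fun x => hk _

@[fun_prop]
theorem PolyFn.fst : PolyFn (Prod.fst : α × β → α) :=
  .of_runs .fst (fun n => n) (by fun_prop) fun x =>
    (Code.Runs.fst (enc x.1) (enc x.2)).mono (Nat.le_succ _)

@[fun_prop]
theorem PolyFn.snd : PolyFn (Prod.snd : α × β → β) :=
  .of_runs .snd (fun n => n) (by fun_prop) fun x =>
    (Code.Runs.snd (enc x.1) (enc x.2)).mono (Nat.le_succ _)

end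

/-! ### Case distinction and branching -/

namespace Code

variable {c f g : Code} {x y t : BinTree} {k l m : ℕ}

/-- Case distinction on the result of `c`. -/
def cases (c f g : Code) : Code :=
  .comp (.pair c .id) <| .union
    (.comp (.pair (.comp .fst .isNil) .snd) (.comp .snd f))
    (.comp (.pair .snd (.pair (.comp .fst .fst) (.comp .fst .snd))) g)

theorem Runs.cases (hc : c.Runs x t k) (hf : t = .nil → f.Runs x y l)
    (hg : ∀ a b, t = .node a b → g.Runs (node x t) y l) :
    (Code.cases c f g).Runs x y (21 * k + l + 40 * x.size + 40) := by
  have ht := hc.size_le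
  have h1 := hc.pair (Runs.id x)
  have hx := x.size_pos
  cases t with
  | nil =>
    have h2 := ((Runs.fst .nil x).comp .isNil).pair (Runs.snd .nil x)
    have h3 := h2.comp ((Runs.snd .nil x).comp (hf rfl))
    -- The second branch takes the result of `c` apart and reassembles it. For a node this changes
    -- nothing; for `nil` it blocks the branch.
    have h4 : (Code.comp (.pair .snd (.pair (.comp .fst .fst) (.comp .fst .snd))) g).Fails
        (node .nil x) :=
      .comp (.pair' (.pair (.comp' (Runs.fst _ _) .fst)))
    refine (h1.comp (h3.unionLeft h4)).mono ?_
    simp only [BinTree.size] at ht ⊢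
    omega
  | node a b =>
    have h2 := (Runs.snd (node a b) x).pair
      (((Runs.fst (node a b) x).comp (Runs.fst a b)).pair
        ((Runs.fst (node a b) x).comp (Runs.snd a b)))
    have h3 := h2.comp (hg _ _ rfl)
    have h4 : (Code.comp (.pair (.comp .fst .isNil) .snd) (.comp .snd f)).Fails
        (node (node a b) x) :=
      .comp (.pair (.comp' (Runs.fst _ _) (.isNil _ _)))
    refine (h1.comp (Runs.unionRight h4 h3)).mono ?_
    simp only [BinTree.size] at ht ⊢
    omega

theorem Fails.cases (hc : c.Runs x t k) (hf : t = .nil → f.Fails x)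
    (hg : ∀ a b, t = .node a b → g.Fails (node x t)) :
    (Code.cases c f g).Fails x := by
  have h1 := hc.pair (Runs.id x)
  refine .comp' h1 ?_
  cases t with
  | nil =>
    exact .union (.comp' (((Runs.fst .nil x).comp .isNil).pair (Runs.snd .nil x))
      (.comp' (Runs.snd .nil x) (hf rfl)))
      (.comp (.pair' (.pair (.comp' (Runs.fst _ _) .fst))))
  | node a b =>
    refine .union (.comp (.pair (.comp' (Runs.fst _ _) (.isNil _ _)))) (.comp' ((Runs.snd _ _).pair
      (((Runs.fst _ _).comp (Runs.fst _ _)).pair ((Runs.fst _ _).comp (Runs.snd _ _))))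
      (hg _ _ rfl))

/-- The program without results. -/
def fail : Code := .comp .nil .fst

theorem fails_fail (x : BinTree) : fail.Fails x := .comp' (Runs.nil x) .fst

/-- Branching on a Boolean. -/
def cond (c f g : Code) : Code := cases c g (.comp .fst f)

theorem Runs.cond {b : Bool} (hc : c.Runs x (enc b) k) (hf : b = true → f.Runs x y l)
    (hg : b = false → g.Runs x y l) :
    (Code.cond c f g).Runs x y (21 * k + l + 41 * x.size + 50) := by
  cases b
  · exact (Runs.cases hc (fun _ => hg rfl) (by simp [enc_false])).mono (by omega)
  · refine (Runs.cases hc (l := x.size + 3 + l + 1) (by simp [enc_true])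
      (fun _ _ _ => (Runs.fst _ _).comp (hf rfl))).mono (by omega)

theorem Fails.cond {b : Bool} (hc : c.Runs x (enc b) k) (hf : b = true → f.Fails x)
    (hg : b = false → g.Fails x) : (Code.cond c f g).Fails x := by
  cases b
  · exact Fails.cases hc (fun _ => hg rfl) (by simp [enc_false])
  · exact Fails.cases hc (by simp [enc_true]) (fun _ _ _ => .comp' (Runs.fst _ _) (hf rfl))

end Code

/-! ### Closure properties of `PolyFn` -/

section

set_option linter.unusedSectionVars false

variable {α β γ δ : Type} [TEnc α] [TEnc β] [TEnc γ] [TEnc δ]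

@[fun_prop]
theorem PolyFn.cond {b : α → Bool} {f g : α → β} (hb : PolyFn b) (hf : PolyFn f)
    (hg : PolyFn g) : PolyFn fun x => bif b x then f x else g x := by
  obtain ⟨cb, k, hb⟩ := hb
  obtain ⟨cf, l, hf⟩ := hf
  obtain ⟨cg, m, hg⟩ := hg
  refine .of_runs (.cond cb cf cg)
    (fun n => 21 * (n + 2) ^ k + ((n + 2) ^ l + (n + 2) ^ m) + 41 * n + 50) (by fun_prop)
    fun x => Code.Runs.cond (hb x) (fun h => ?_) (fun h => ?_)
  · rw [h]; exact (hf x).mono (by omega)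
  · rw [h]; exact (hg x).mono (by omega)

@[fun_prop]
theorem PolyFn.not {b : α → Bool} (hb : PolyFn b) : PolyFn fun x => !b x := by
  have := hb.cond (.const false) (.const true)
  refine (funext fun x => ?_ : (fun x => !b x) = _) ▸ this
  cases b x <;> rfl

@[fun_prop]
theorem PolyFn.and {b c : α → Bool} (hb : PolyFn b) (hc : PolyFn c) :
    PolyFn fun x => b x && c x := by
  have := hb.cond hc (.const false)
  refine (funext fun x => ?_ : (fun x => b x && c x) = _) ▸ this
  cases b x <;> rfl

@[fun_prop]
theorem PolyFn.or {b c : α → Bool} (hb : PolyFn b) (hc : PolyFn c) :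
    PolyFn fun x => b x || c x := by
  have := hb.cond (.const true) hc
  refine (funext fun x => ?_ : (fun x => b x || c x) = _) ▸ this
  cases b x <;> rfl

/-- Case distinction on a list. -/
def listCase (l : List α) (b : β) (f : α → List α → β) : β :=
  match l with
  | [] => b
  | a :: t => f a t

@[simp] theorem listCase_nil (b : β) (f : α → List α → β) : listCase [] b f = b := rfl

@[simp] theorem listCase_cons (a : α) (l : List α) (b : β) (f : α → List α → β) :
    listCase (a :: l) b f = f a l := rfl

/-- Programs are closed and have no local variables, so the branch gets the context `x` as part of
its argument. The same shape recurs in `foldl`, `map`, `all` and their relatives, whose function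
arguments have to be given explicitly. -/
theorem PolyFn.listCase {l : α → List γ} {f : α → β} {g : α × γ × List γ → β}
    (hl : PolyFn l) (hf : PolyFn f) (hg : PolyFn g) :
    PolyFn fun x => listCase (l x) (f x) fun a t => g (x, a, t) := by
  obtain ⟨cl, k, hl⟩ := hl
  obtain ⟨cf, i, hf⟩ := hf
  obtain ⟨cg, m, hg⟩ := hg
  refine .of_runs (.cases cl cf cg) (fun n => 21 * (n + 2) ^ k +
    ((n + 2) ^ i + (n + (n + (n + 2) ^ k) + 1 + 2) ^ m) + 40 * n + 40) (by fun_prop)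
    fun x => Code.Runs.cases (hl x) (fun h => ?_) (fun a b h => ?_)
  · cases h' : l x with
    | nil => exact (hf x).mono (by omega)
    | cons a t => rw [h'] at h; cases h
  · cases h' : l x with
    | nil => rw [h'] at h; cases h
    | cons a t =>
      have h2 : sz (l x) ≤ sz x + _ := (hl x).size_le
      rw [h'] at h2
      refine (hg (x, a, t)).mono ?_
      refine le_trans (Nat.pow_le_pow_left ?_ m) (Nat.le_add_left _ _)
      have : sz (x, a, t) = sz x + sz (a :: t) + 1 := rfl
      omega

theorem PolyFn.optionElim {l : α → Option γ} {f : α → β} {g : α × γ → β}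
    (hl : PolyFn l) (hf : PolyFn f) (hg : PolyFn g) :
    PolyFn fun x => (l x).elim (f x) fun a => g (x, a) := by
  -- `some a` is represented by a node whose second child is empty, which is the tree of `()`. So
  -- the case program hands over a pair with a trivial second component.
  have hg' : PolyFn fun z : α × γ × Unit => g (z.1, z.2.1) := by fun_prop
  obtain ⟨cl, k, hl⟩ := hl
  obtain ⟨cf, i, hf⟩ := hf
  obtain ⟨cg, m, hg⟩ := hg'
  refine .of_runs (.cases cl cf cg) (fun n => 21 * (n + 2) ^ k +
    ((n + 2) ^ i + (n + (n + (n + 2) ^ k) + 1 + 2) ^ m) + 40 * n + 40) (by fun_prop)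
    fun x => Code.Runs.cases (hl x) (fun h => ?_) (fun a b h => ?_)
  · cases h' : l x with
    | none => exact (hf x).mono (by omega)
    | some a => rw [h'] at h; cases h
  · cases h' : l x with
    | none => rw [h'] at h; cases h
    | some a =>
      have h2 : sz (l x) ≤ sz x + _ := (hl x).size_le
      rw [h'] at h2
      refine (hg (x, a, ())).mono ?_
      refine le_trans (Nat.pow_le_pow_left ?_ m) (Nat.le_add_left _ _)
      have : sz (x, a, ()) = sz x + sz (some a) + 1 := rfl
      omega

@[fun_prop]
theorem PolyFn.some {f : α → β} (hf : PolyFn f) : PolyFn fun x => Option.some (f x) := by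
  obtain ⟨c, k, h⟩ := hf
  exact .of_runs (.pair c .nil) (fun n => (n + 2) ^ k + 2 * n + 2 * n) (by fun_prop)
    fun x => (h x).pair (Code.Runs.nil _)

@[fun_prop]
theorem PolyFn.cons {f : α → β} {g : α → List β} (hf : PolyFn f) (hg : PolyFn g) :
    PolyFn fun x => f x :: g x := by
  obtain ⟨cf, k, hf⟩ := hf
  obtain ⟨cg, l, hg⟩ := hg
  exact .of_runs (.pair cf cg) (fun n => (n + 2) ^ k + 2 * (n + 2) ^ l + 2 * n)
    (by fun_prop) fun x => (hf x).pair (hg x)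

-- A number and its list of binary digits are represented by the same tree, so the identity program
-- converts one into the other.
@[fun_prop]
theorem PolyFn.encodeNat : PolyFn Computability.encodeNat :=
  .of_runs .id (fun _ => 1) (by fun_prop) fun _ => .id _

/-- Computability is closed under linear recursion, if the depth of the recursion and the sizes of
all arguments and values are polynomially bounded. -/
theorem PolyFn.recur {e : γ → α} {f : α → β} {halt : α → Bool} {base : α → β} {h : α → α}
    {comb : α × β → β} (μ : α → ℕ) (he : PolyFn e) (hhalt : PolyFn halt) (hbase : PolyFn base)
    (hh : PolyFn h) (hcomb : PolyFn comb) (hf₁ : ∀ x, halt x = true → f x = base x)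
    (hf₂ : ∀ x, halt x = false → f x = comb (x, f (h x))) {B : ℕ → ℕ} (hB : PolyBd B)
    (hI : ∀ y, ∃ I : α → Prop, I (e y) ∧ ∀ x, I x → sz x ≤ B (sz y) ∧ sz (f x) ≤ B (sz y) ∧
      μ x ≤ B (sz y) ∧ (halt x = false → I (h x) ∧ μ (h x) < μ x)) :
    PolyFn fun y => f (e y) := by
  obtain ⟨ce, ke, he⟩ := he
  obtain ⟨cs, ks, hs⟩ := hhalt
  obtain ⟨cb, kb, hb⟩ := hbase
  obtain ⟨ch, kh, hh⟩ := hh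
  obtain ⟨cc, kc, hc⟩ := hcomb
  -- The recursor always makes two calls. The real argument is wrapped as `node x nil`, and the
  -- second call gets the dummy argument `nil`, on which the base program returns `nil` at once.
  let b : Code := .union .isNil (.comp .fst (.cond cs cb .fail))
  let s : Code := .comp .fst (.cond cs .fail (.pair .id (.pair (.pair ch .nil) .nil)))
  let c : Code := .comp (.pair .fst (.comp .snd .fst)) cc
  let R : Code := .recur b s c
  let C : ℕ → ℕ := fun M => 200 * (M + (M + 2) ^ ks + (M + 2) ^ kb + (M + 2) ^ kh +
    (M + M + 1 + 2) ^ kc + 1)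
  have hR0 : R.Runs .nil .nil 4 :=
    (Code.Runs.recBase (.unionLeft .isNil (.comp .fst)) (.comp .fst)).mono (by omega)
  -- A single bound `M` serves all arguments and values on the recursion path from a given start.
  -- Each level then costs at most `C M`, and `μ` limits the number of levels. Composing a
  -- polynomial size bound once per level could be exponential.
  have key : ∀ (M : ℕ) (I : α → Prop), (∀ x, I x → sz x ≤ M ∧ sz (f x) ≤ M ∧
      (halt x = false → I (h x) ∧ μ (h x) < μ x)) → ∀ m x, μ x < m → I x →
      R.Runs (node (enc x) .nil) (enc (f x)) (m * C M) := by
    intro M I hI m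
    induction m with
    | zero => intro x hx; omega
    | succ m ih =>
      intro x hx hIx
      obtain ⟨h1, h2, h3⟩ := hI x hIx
      have e1 : (sz x + 2) ^ ks ≤ (M + 2) ^ ks := Nat.pow_le_pow_left (by omega) _
      have e2 : (sz x + 2) ^ kb ≤ (M + 2) ^ kb := Nat.pow_le_pow_left (by omega) _
      have e3 : (sz x + 2) ^ kh ≤ (M + 2) ^ kh := Nat.pow_le_pow_left (by omega) _
      rw [add_mul, one_mul]
      cases hst : halt x with
      | true =>
        have hs' := hs x
        rw [hst] at hs'
        have r1 : b.Runs (node (enc x) .nil) (enc (f x)) _ := .unionRight (.isNil _ _)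
          ((Code.Runs.fst _ _).comp (hs'.cond (l := (sz x + 2) ^ kb)
            (fun _ => hf₁ x hst ▸ hb x) (by simp)))
        have r2 : s.Fails (node (enc x) .nil) :=
          .comp' (Code.Runs.fst _ _) (.cond hs' (fun _ => Code.fails_fail _) (by simp))
        refine (Code.Runs.recBase r1 r2).mono ?_
        simp only [sz, BinTree.size, C] at *
        omega
      | false =>
        obtain ⟨h4, h5⟩ := h3 hst
        have hs' := hs x
        rw [hst] at hs'
        have r1 : b.Fails (node (enc x) .nil) := .union (.isNil _ _)
          (.comp' (Code.Runs.fst _ _) (.cond hs' (by simp) (fun _ => Code.fails_fail _)))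
        have r2 : s.Runs (node (enc x) .nil)
            (node (enc x) (node (node (enc (h x)) .nil) .nil)) _ :=
          (Code.Runs.fst _ _).comp (hs'.cond (by simp) (fun _ =>
            (Code.Runs.id (enc x)).pair (((hh x).pair (Code.Runs.nil _)).pair (Code.Runs.nil _))))
        have r3 := ih (h x) (by omega) h4
        have r4 : c.Runs (node (enc x) (node (enc (f (h x))) .nil)) (enc (f x)) _ :=
          ((Code.Runs.fst _ _).pair ((Code.Runs.snd _ _).comp (Code.Runs.fst _ _))).comp
            (hf₂ x hst ▸ hc (x, f (h x)))
        refine (Code.Runs.recStep r1 r2 r3 hR0 r4).mono ?_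
        obtain ⟨h6, h7, -⟩ := hI _ h4
        have e4 : (sz (x, f (h x)) + 2) ^ kc ≤ (M + M + 1 + 2) ^ kc :=
          Nat.pow_le_pow_left (by rw [sz_pair]; omega) _
        simp only [sz, BinTree.size, C] at *
        omega
  refine .of_runs (.comp ce (.comp (.pair .id .nil) R))
    (fun n => (n + 2) ^ ke + (1 + 2 * (n + (n + 2) ^ ke) + 2 * (n + (n + 2) ^ ke) +
      (B n + 1) * C (B n) + 1) + 1) (by unfold C; fun_prop) fun y => ?_
  obtain ⟨I, hIy, hI⟩ := hI y
  have h1 := key (B (sz y)) I (fun x hx => ⟨(hI x hx).1, (hI x hx).2.1, (hI x hx).2.2.2⟩)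
    (B (sz y) + 1) (e y) (Nat.lt_succ_of_le (hI _ hIy).2.2.1) hIy
  have h2 := (he y).size_le
  refine ((he y).comp (((Code.Runs.id _).pair (Code.Runs.nil _)).comp h1)).mono ?_
  simp only [sz] at *
  omega

end

/-! ### Generators and computation by guessing -/

/-- The elements of `α` can be generated by a nondeterministic program. -/
class TGen (α : Type) [TEnc α] : Prop where
  exists_code : ∃ c : Code, ∃ k, (∀ t n, c.Ev .nil t n → ∃ a : α, t = enc a) ∧
    ∀ a : α, ∃ n ≤ (sz a + 2) ^ k, c.Ev .nil (enc a) n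

section

variable {α β γ δ : Type} [TEnc α] [TEnc β] [TEnc γ] [TEnc δ]

theorem TGen.of_bound (c : Code) (B : ℕ → ℕ) (hB : PolyBd B)
    (h : ∀ t n, c.Ev .nil t n → ∃ a : α, t = enc a)
    (h' : ∀ a : α, ∃ n ≤ B (sz a), c.Ev .nil (enc a) n) : TGen α := by
  obtain ⟨k, hk⟩ := hB
  refine ⟨c, k, h, fun a => ?_⟩
  obtain ⟨n, hn, hn'⟩ := h' a
  exact ⟨n, hn.trans (hk _), hn'⟩

instance : TGen Unit :=
  .of_bound .nil (fun _ => 1) (by fun_prop) (fun _ _ h => by cases h; exact ⟨(), rfl⟩)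
    fun _ => ⟨_, le_rfl, .nil _⟩

instance : TGen Bool := by
  refine .of_bound (.union .nil (.pair .nil .nil)) (fun _ => 10) (by fun_prop) ?_ ?_
  · intro t n h
    cases h with
    | unionLeft h => cases h; exact ⟨false, rfl⟩
    | unionRight h =>
      cases h with
      | pair h h' => cases h; cases h'; exact ⟨true, rfl⟩
  · rintro ⟨⟩
    · exact ⟨_, by simp [BinTree.size], .unionLeft (.nil _)⟩
    · exact ⟨_, by simp [BinTree.size], .unionRight (.pair (.nil _) (.nil _))⟩

instance [TGen α] [TGen β] : TGen (α × β) := by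
  obtain ⟨c, k, hc, hc'⟩ := TGen.exists_code (α := α)
  obtain ⟨d, l, hd, hd'⟩ := TGen.exists_code (α := β)
  refine .of_bound (.pair c d) (fun n => (n + 2) ^ k + (n + 2) ^ l + 1 + n) (by fun_prop) ?_ ?_
  · intro t n h
    cases h with
    | pair h h' =>
      obtain ⟨a, rfl⟩ := hc _ _ h
      obtain ⟨b, rfl⟩ := hd _ _ h'
      exact ⟨(a, b), rfl⟩
  · rintro ⟨a, b⟩
    obtain ⟨m, hm, h⟩ := hc' a
    obtain ⟨n, hn, h'⟩ := hd' b
    refine ⟨_, ?_, .pair h h'⟩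
    have e1 : (sz a + 2) ^ k ≤ (sz (a, b) + 2) ^ k :=
      Nat.pow_le_pow_left (by rw [sz_pair]; omega) _
    have e2 : (sz b + 2) ^ l ≤ (sz (a, b) + 2) ^ l :=
      Nat.pow_le_pow_left (by rw [sz_pair]; omega) _
    have e3 : sz b ≤ sz (a, b) := by rw [sz_pair]; omega
    simp only [sz, BinTree.size] at *
    omega

instance [TGen α] : TGen (List α) := by
  obtain ⟨c, k, hc, hc'⟩ := TGen.exists_code (α := α)
  -- On the empty tree, either stop with the empty list or guess a head. The first recursive call
  -- supplies the tail, and the result of the second is discarded.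
  let R : Code := .recur .isNil (.pair (.comp .nil c) (.pair .nil .nil))
    (.pair .fst (.comp .snd .fst))
  have hR : ∀ x t n, R.Ev x t n → ∃ l : List α, t = enc l := by
    intro x t n h
    generalize hr : R = r at h
    induction h with
    | recBase h =>
      simp only [R, Code.recur.injEq] at hr
      obtain ⟨rfl, rfl, rfl⟩ := hr
      cases h
      exact ⟨[], rfl⟩
    | recStep h₁ h₂ h₃ h₄ ih₁ ih₂ ih₃ ih₄ =>
      obtain ⟨l, rfl⟩ := ih₂ hr
      simp only [R, Code.recur.injEq] at hr
      obtain ⟨rfl, rfl, rfl⟩ := hr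
      cases h₄ with
      | pair e e' =>
        cases e
        cases e' with
        | comp e' e'' =>
          cases e'
          cases e''
          cases h₁ with
          | pair e e' =>
            cases e with
            | comp e e'' =>
              cases e
              obtain ⟨a, rfl⟩ := hc _ _ e''
              exact ⟨a :: l, rfl⟩
    | _ => simp [R] at hr
  refine .of_bound R (fun n => n * ((n + 2) ^ k + 20 * n + 20)) (by fun_prop) (hR _) ?_
  intro l
  induction l with
  | nil => exact ⟨_, by simp [sz, enc_nil, BinTree.size], .recBase .isNil⟩
  | cons a l ih =>
    obtain ⟨n, hn, ih⟩ := ih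
    obtain ⟨m, hm, h⟩ := hc' a
    refine ⟨_, ?_, .recStep (.pair (.comp (.nil _) h) (.pair (.nil _) (.nil _))) ih (.recBase .isNil)
      (.pair (.fst _ _) (.comp (.snd _ _) (.fst _ _)))⟩
    have e1 : (sz a + 2) ^ k ≤ (sz (a :: l) + 2) ^ k :=
      Nat.pow_le_pow_left (by rw [sz_cons]; omega) _
    have e2 : sz l * ((sz l + 2) ^ k + 20 * sz l + 20) ≤
        sz l * ((sz (a :: l) + 2) ^ k + 20 * sz (a :: l) + 20) := by
      have : sz l ≤ sz (a :: l) := by rw [sz_cons]; omega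
      gcongr
    have e3 : sz (a :: l) * ((sz (a :: l) + 2) ^ k + 20 * sz (a :: l) + 20) =
      sz l * ((sz (a :: l) + 2) ^ k + 20 * sz (a :: l) + 20) +
      (sz a + 1) * ((sz (a :: l) + 2) ^ k + 20 * sz (a :: l) + 20) := by
        generalize (sz (a :: l) + 2) ^ k + 20 * sz (a :: l) + 20 = X
        rw [sz_cons]; ring
    have e4 : 1 * ((sz (a :: l) + 2) ^ k + 20 * sz (a :: l) + 20) ≤
      (sz a + 1) * ((sz (a :: l) + 2) ^ k + 20 * sz (a :: l) + 20) :=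
        Nat.mul_le_mul_right _ (by omega)
    have e5 : sz (a :: l) = sz a + sz l + 1 := rfl
    have e6 : encList l = enc l := rfl
    simp only [sz, BinTree.size, e6] at *
    omega

/-- A function can be computed by guessing its value, if that value is recognized in polynomial
time. -/
theorem PolyFn.of_graph [TGen β] {f : α → β} {R : α → β → Bool}
    (hR : PolyFn fun z : α × β => R z.1 z.2) (h : ∀ x, R x (f x) = true)
    (h' : ∀ x y, R x y = true → y = f x) {B : ℕ → ℕ} (hB : PolyBd B)
    (hf : ∀ x, sz (f x) ≤ B (sz x)) : PolyFn f := by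
  obtain ⟨cr, k, hr⟩ := hR
  obtain ⟨cg, l, hg, hg'⟩ := TGen.exists_code (α := β)
  -- Guess `y`, keep it if `R x y` holds, and otherwise end without a result. By `h'` only the value
  -- of `f` survives, so the guessing program still has a unique result.
  refine .of_runs (.comp (.pair .id (.comp .nil cg)) (.cond cr .snd .fail))
    (fun n => (1 + (n + (B n + 2) ^ l + 1) + n + B n) +
      (21 * (n + B n + 1 + 2) ^ k + (n + B n) + 41 * (n + B n + 1) + 50) + 1)
    (by fun_prop) fun x => ⟨?_, ?_⟩
  · obtain ⟨n, hn, e⟩ := hg' (f x)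
    have h1 : cr.Runs (enc (x, f x)) (enc (R x (f x))) _ := hr (x, f x)
    rw [h] at h1
    have h2 := h1.cond (f := .snd) (g := .fail) (fun _ => Code.Runs.snd _ _) (by simp)
    obtain ⟨⟨m, hm, e2⟩, -⟩ := h2
    refine ⟨_, ?_, .comp (.pair (.id _) (.comp (.nil _) e)) e2⟩
    have h3 := hf x
    have h4 : (sz (f x) + 2) ^ l ≤ (B (sz x) + 2) ^ l := Nat.pow_le_pow_left (by omega) _
    have h5 : (sz (x, f x) + 2) ^ k ≤ (sz x + B (sz x) + 1 + 2) ^ k :=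
      Nat.pow_le_pow_left (by rw [sz_pair]; omega) _
    simp only [sz] at *
    have h6 : (enc (x, f x)).size = (enc x).size + (enc (f x)).size + 1 := rfl
    omega
  · intro t n e
    cases e with
    | comp e e' =>
      cases e with
      | pair e₁ e₂ =>
        cases e₁
        cases e₂ with
        | comp e₂ e₃ =>
          cases e₂
          obtain ⟨y, rfl⟩ := hg _ _ e₃
          have h1 : cr.Runs (enc (x, y)) (enc (R x y)) _ := hr (x, y)
          cases hy : R x y with
          | true =>
            rw [hy] at h1
            have h2 := h1.cond (f := .snd) (g := .fail) (fun _ => Code.Runs.snd _ _) (by simp)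
            rw [h2.2 _ _ e', h' x y hy]
          | false =>
            rw [hy] at h1
            exact absurd e' (Code.Fails.cond (f := .snd) h1 (by simp)
              (fun _ => Code.fails_fail _) _ _)

/-- Generate in `α` and apply `f`. The section `g` need not be computable: it only shows that each
element of `β` is hit by an argument of polynomially bounded size. -/
theorem TGen.map [TGen α] {f : α → β} (hf : PolyFn f) (g : β → α) (hg : ∀ b, f (g b) = b)
    {B : ℕ → ℕ} (hB : PolyBd B) (hs : ∀ b, sz (g b) ≤ B (sz b)) : TGen β := by
  obtain ⟨c, k, hc, hc'⟩ := TGen.exists_code (α := α)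
  obtain ⟨d, l, hd⟩ := hf
  refine .of_bound (.comp c d) (fun n => (B n + 2) ^ k + (B n + 2) ^ l + 1) (by fun_prop) ?_ ?_
  · intro t n h
    cases h with
    | comp h h' =>
      obtain ⟨a, rfl⟩ := hc _ _ h
      exact ⟨f a, (hd a).2 _ _ h'⟩
  · intro b
    obtain ⟨n, hn, h⟩ := hc' (g b)
    obtain ⟨⟨m, hm, h2⟩, -⟩ := hd (g b)
    rw [hg] at h2
    have := hs b
    refine ⟨_, ?_, .comp h h2⟩
    have h4 : (sz (g b) + 2) ^ l ≤ (B (sz b) + 2) ^ l := Nat.pow_le_pow_left (by omega) _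
    have h5 : (sz (g b) + 2) ^ k ≤ (B (sz b) + 2) ^ k := Nat.pow_le_pow_left (by omega) _
    omega

/-! ### Equality -/

/-- The program deciding equality of two trees. -/
def Code.eqTest : Code :=
  .recur
    (.cases .fst (.cases .snd (.const (enc true)) (.const (enc false)))
      (.comp .fst (.cases .snd (.const (enc false)) .fail)))
    (.cases .fst .fail (.comp .fst (.cases .snd .fail (.comp .fst
      (.pair .nil (.pair (.pair (.comp .fst .fst) (.comp .snd .fst))
        (.pair (.comp .fst .snd) (.comp .snd .snd))))))))
    (.comp .snd (.cond .fst .snd (.const (enc false))))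

/-- The two trees are descended simultaneously, so at most one pair of subtrees is visited for each
subtree of `x`. Each visit is linear in the sizes found there. -/
theorem Code.runs_eqTest : ∃ k, ∀ x y : BinTree,
    eqTest.Runs (node x y) (enc (decide (x = y))) (k * x.size * (x.size + y.size)) := by
  obtain ⟨k, hk⟩ := runs_const (enc true)
  obtain ⟨l, hl⟩ := runs_const (enc false)
  obtain ⟨K, hkK, hlK⟩ : ∃ K, k ≤ K ∧ l ≤ K := ⟨k + l, by omega, by omega⟩
  replace hk : ∀ x L, K * x.size ≤ L → (Code.const (enc true)).Runs x (enc true) L :=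
    fun x L h => (hk x).mono ((Nat.mul_le_mul_right _ hkK).trans h)
  replace hl : ∀ x L, K * x.size ≤ L → (Code.const (enc false)).Runs x (enc false) L :=
    fun x L h => (hl x).mono ((Nat.mul_le_mul_right _ hlK).trans h)
  have bound : ∀ m n C, 1 ≤ m → 1 ≤ n → C ≤ 1000 * (K * (m + n)) + 1000 * (m + n) →
      C ≤ 1000 * (K + 1) * m * (m + n) := by
    intro m n C hm hn h
    refine h.trans ?_
    calc 1000 * (K * (m + n)) + 1000 * (m + n) = 1000 * (K + 1) * 1 * (m + n) := by ring
      _ ≤ _ := by gcongr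
  refine ⟨1000 * (K + 1), fun x => ?_⟩
  induction x with
  | nil =>
    intro y
    have hy := y.size_pos
    have h1 := Fails.cases (f := .fail) (g := (.comp .fst (.cases .snd .fail (.comp .fst
      (.pair .nil (.pair (.pair (.comp .fst .fst) (.comp .snd .fst))
        (.pair (.comp .fst .snd) (.comp .snd .snd)))))))) (Runs.fst .nil y)
        (fun _ => fails_fail _) (by simp)
    have hK : K * (1 + 1) ≤ K * (1 + y.size) := by gcongr; omega
    have h2 : (Code.cases .snd (.const (enc true)) (.const (enc false))).Runs (node .nil y)
        (enc (decide (BinTree.nil = y))) _ :=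
      Runs.cases (l := 3 * (K * (1 + y.size))) (Runs.snd .nil y)
        (fun h => by
          subst h
          refine hk _ _ ?_
          simp only [BinTree.size]; omega)
        (fun a b h => by
          subst h
          refine hl _ _ ?_
          simp only [BinTree.size] at *
          calc _ ≤ K * (3 * (1 + (a.size + b.size + 1))) := by gcongr; omega
            _ = _ := by ring)
    refine (Runs.recBase (Runs.cases (Runs.fst .nil y) (fun _ => h2) (by simp)) h1).mono ?_
    refine bound _ _ _ le_rfl hy ?_
    simp only [BinTree.size]
    omega
  | node a b iha ihb =>
    intro y
    cases y with
    | nil =>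
      have ha := a.size_pos
      have hb := b.size_pos
      have h1 := Fails.cases (f := .fail) (g := (.comp .fst (.cases .snd .fail (.comp .fst
        (.pair .nil (.pair (.pair (.comp .fst .fst) (.comp .snd .fst))
          (.pair (.comp .fst .snd) (.comp .snd .snd)))))))) (Runs.fst (node a b) .nil)
          (by simp) (fun _ _ _ => .comp' (Runs.fst _ _) (.cases (Runs.snd _ _)
            (fun _ => fails_fail _) (by simp)))
      have h2 := Runs.cases (y := enc false) (f := .const (enc false)) (g := .fail)
        (l := K * ((a.size + b.size + 1) + 1 + 1)) (Runs.snd (node a b) .nil)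
        (fun _ => hl _ _ (by simp only [BinTree.size]; rfl)) (by simp)
      have h3 := Runs.cases (f := Code.cases .snd (.const (enc true)) (.const (enc false)))
        (g := .comp .fst (.cases .snd (.const (enc false)) .fail)) (y := enc false)
        (Runs.fst (node a b) .nil) (by simp) (fun _ _ _ => (Runs.fst _ _).comp h2)
      refine (Runs.recBase h3 h1).mono ?_
      refine bound _ _ _ (node a b).size_pos le_rfl ?_
      simp only [BinTree.size]
      have : K * (a.size + b.size + 1 + 1 + 1) ≤ 2 * (K * (a.size + b.size + 1 + 1)) := by
        rw [← mul_assoc, mul_comm 2 K, mul_assoc]; gcongr; omega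
      omega
    | node c d =>
      have ha := a.size_pos
      have hb := b.size_pos
      have hc := c.size_pos
      have hd := d.size_pos
      have h1 := Fails.cases (f := Code.cases .snd (.const (enc true)) (.const (enc false)))
        (g := .comp .fst (.cases .snd (.const (enc false)) .fail))
        (Runs.fst (node a b) (node c d)) (by simp) (fun _ _ _ => .comp' (Runs.fst _ _)
          (.cases (Runs.snd _ _) (by simp) (fun _ _ _ => fails_fail _)))
      have h2 := Runs.cases (f := .fail) (y := node .nil (node (node a c) (node b d)))
        (Runs.fst (node a b) (node c d)) (by simp)
        (fun _ _ _ => (Runs.fst (node (node a b) (node c d)) (node a b)).comp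
          (Runs.cases (f := .fail) (Runs.snd (node a b) (node c d)) (by simp)
          (fun _ _ _ => (Runs.fst (node (node a b) (node c d)) (node c d)).comp
            ((Runs.nil _).pair ((((Runs.fst _ _).comp (Runs.fst _ _)).pair
              ((Runs.snd _ _).comp (Runs.fst _ _))).pair
              (((Runs.fst _ _).comp (Runs.snd _ _)).pair
              ((Runs.snd _ _).comp (Runs.snd _ _))))))))
      have h3 := (Runs.snd .nil (node (enc (decide (a = c))) (enc (decide (b = d))))).comp
        (Runs.cond (f := .snd) (g := .const (enc false))
          (y := enc (decide (node a b = node c d))) (l := 7 + 7 * K) (Runs.fst _ _)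
          (fun h => by
            have : decide (node a b = node c d) = decide (b = d) := by
              rw [decide_eq_true_iff] at h; simp [h]
            rw [this]
            refine (Runs.snd _ _).mono ?_
            have := sz_bool_le (decide (a = c))
            have := sz_bool_le (decide (b = d))
            simp only [sz] at *; omega)
          (fun h => by
            have : decide (node a b = node c d) = false := by
              rw [decide_eq_false_iff_not] at h; simp [h]
            rw [this]
            refine hl _ _ ?_
            have := sz_bool_le (decide (a = c))
            have := sz_bool_le (decide (b = d))
            simp only [sz, BinTree.size] at *
            calc _ ≤ K * 7 := by gcongr; omega
              _ ≤ _ := by omega))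
      refine (Runs.recStep h1 h2 (iha c) (ihb d) h3).mono ?_
      have b1 := sz_bool_le (decide (a = c))
      have b2 := sz_bool_le (decide (b = d))
      simp only [sz, BinTree.size] at *
      generalize (enc (decide (a = c))).size = u at *
      generalize (enc (decide (b = d))).size = v at *
      generalize a.size = a at *
      generalize b.size = b at *
      generalize c.size = c at *
      generalize d.size = d at *
      -- The bound for two nodes exceeds the sum of the bounds for the pairs of children by the
      -- cross terms and a linear term. These pay for the present step.
      have e1 : 1000 * (K + 1) * (a + b + 1) * (a + b + 1 + (c + d + 1)) =
        1000 * (K + 1) * a * (a + c) + 1000 * (K + 1) * b * (b + d) +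
        1000 * (K + 1) * a * (b + d + 2) + 1000 * (K + 1) * b * (a + c + 2) +
        1000 * (K + 1) * (a + b + c + d + 2) := by ring
      have e2 : 1000 * (K + 1) * (a + b + c + d + 2) =
        1000 * (K * (a + b + c + d + 2)) + 1000 * (a + b + c + d + 2) := by ring
      have e3 : K * 6 ≤ K * (a + b + c + d + 2) := by gcongr; omega
      have e4 : 1 * 1 * (b + d + 2) ≤ 1000 * (K + 1) * a * (b + d + 2) := by gcongr <;> omega
      omega

-- Injectivity of the encoding reduces equality of values to equality of trees, so one program
-- serves all types.
@[fun_prop]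
theorem PolyFn.decide_eq [DecidableEq β] {f g : α → β} (hf : PolyFn f) (hg : PolyFn g) :
    PolyFn fun x => decide (f x = g x) := by
  have : PolyFn fun z : β × β => decide (z.1 = z.2) := by
    obtain ⟨k, hk⟩ := Code.runs_eqTest
    refine .of_runs .eqTest (fun n => k * n * (n + n)) (by fun_prop) fun z => ?_
    have h := hk (enc z.1) (enc z.2)
    have e : decide (enc z.1 = enc z.2) = decide (z.1 = z.2) := by
      simp [enc_inj.eq_iff]
    rw [e] at h
    refine h.mono ?_
    have e1 : (enc z.1).size ≤ sz z := by
      show _ ≤ (node (enc z.1) (enc z.2)).size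
      simp only [BinTree.size]; omega
    have e2 : (enc z.2).size ≤ sz z := by
      show _ ≤ (node (enc z.1) (enc z.2)).size
      simp only [BinTree.size]; omega
    gcongr
  exact this.comp (hf.prodMk hg)

end

section

variable {α β γ δ : Type} [TEnc α] [TEnc β] [TEnc γ] [TEnc δ]

/-! ### Lists -/

theorem length_le_sz (l : List α) : l.length < sz l := by
  induction l with
  | nil => simp [sz_nil]
  | cons a l ih => rw [List.length_cons, sz_cons]; omega

theorem sz_le_of_mem {a : α} {l : List α} (h : a ∈ l) : sz a < sz l := by
  induction l with
  | nil => simp at h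
  | cons b l ih =>
    rw [sz_cons]
    rcases List.mem_cons.1 h with rfl | h
    · omega
    · have := ih h; omega

theorem sz_list_le {l : List α} {M : ℕ} (h : ∀ a ∈ l, sz a ≤ M) :
    sz l ≤ l.length * (M + 1) + 1 := by
  induction l with
  | nil => simp [sz_nil]
  | cons a l ih =>
    have h1 := ih fun b hb => h b (List.mem_cons_of_mem _ hb)
    have h2 := h a List.mem_cons_self
    rw [sz_cons, List.length_cons, add_mul]
    omega

theorem sz_append (l m : List α) : sz (l ++ m) + 1 = sz l + sz m := by
  induction l with
  | nil => simp [sz_nil]; omega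
  | cons a l ih => rw [List.cons_append, sz_cons, sz_cons]; omega

theorem sz_tail_le (l : List α) : sz l.tail ≤ sz l := by
  cases l
  · rfl
  · rw [List.tail_cons, sz_cons]; omega

@[fun_prop]
theorem PolyFn.tail {l : α → List β} (hl : PolyFn l) : PolyFn fun x => (l x).tail := by
  have := hl.listCase (.const []) (g := fun z : α × β × List β => z.2.2) (by fun_prop)
  refine (funext fun x => ?_ : (fun x => (l x).tail) = _) ▸ this
  cases l x <;> rfl

@[fun_prop]
theorem PolyFn.head? {l : α → List β} (hl : PolyFn l) : PolyFn fun x => (l x).head? := by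
  have := hl.listCase (.const none) (g := fun z : α × β × List β => Option.some z.2.1) (by fun_prop)
  refine (funext fun x => ?_ : (fun x => (l x).head?) = _) ▸ this
  cases l x <;> rfl

@[fun_prop]
theorem PolyFn.isEmpty {l : α → List β} (hl : PolyFn l) : PolyFn fun x => (l x).isEmpty := by
  have := hl.listCase (.const true) (g := fun _ : α × β × List β => false) (by fun_prop)
  refine (funext fun x => ?_ : (fun x => (l x).isEmpty) = _) ▸ this
  cases l x <;> rfl

@[fun_prop]
theorem PolyFn.headD {l : α → List β} {d : α → β} (hl : PolyFn l) (hd : PolyFn d) :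
    PolyFn fun x => (l x).headD (d x) := by
  have := hl.listCase hd (g := fun z : α × β × List β => z.2.1) (by fun_prop)
  refine (funext fun x => ?_ : (fun x => (l x).headD (d x)) = _) ▸ this
  cases l x <;> rfl

/-- Iterating a polynomial-time step may square the size each time, so the states after all prefixes
of the list have to be bounded by hypothesis. In `foldr` the same is required of all suffixes. -/
theorem PolyFn.foldl {l : γ → List α} {seed : γ → β} {step : γ × β × α → β} (hl : PolyFn l)
    (hi : PolyFn seed) (hs : PolyFn step) {B : ℕ → ℕ} (hB : PolyBd B)
    (hb : ∀ x l₁ l₂, l x = l₁ ++ l₂ →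
      sz (l₁.foldl (fun s a => step (x, s, a)) (seed x)) ≤ B (sz x)) :
    PolyFn fun x => (l x).foldl (fun s a => step (x, s, a)) (seed x) := by
  have hh : PolyFn fun z : γ × List α × β =>
      QuantFNN.listCase z.2.1 z fun a t => (z.1, t, step (z.1, z.2.2, a)) :=
    PolyFn.listCase (g := fun w : (γ × List α × β) × α × List α =>
      (w.1.1, w.2.2, step (w.1.1, w.1.2.2, w.2.1))) (by fun_prop) (by fun_prop) (by fun_prop)
  obtain ⟨k, hk⟩ := hl.sz_le
  refine PolyFn.recur (e := fun x => (x, l x, seed x))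
    (f := fun z : γ × List α × β => z.2.1.foldl (fun s a => step (z.1, s, a)) z.2.2)
    (halt := fun z => z.2.1.isEmpty) (base := fun z => z.2.2) (comb := fun z => z.2)
    (μ := fun z => z.2.1.length) (by fun_prop) (by fun_prop) (by fun_prop) hh (by fun_prop)
    ?_ ?_ (B := fun n => n + (n + 2) ^ k + B n + 2) (by fun_prop) ?_
  · rintro ⟨x, _ | _, s⟩ h <;> simp_all
  · rintro ⟨x, _ | _, s⟩ h <;> simp_all
  · intro y
    -- The invariant records the consumed prefix; only through it does `hb` apply to the current
    -- state.
    refine ⟨fun z => ∃ l₁, z.1 = y ∧ l y = l₁ ++ z.2.1 ∧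
      z.2.2 = l₁.foldl (fun s a => step (y, s, a)) (seed y), ⟨[], rfl, rfl, rfl⟩, ?_⟩
    rintro ⟨x, m, s⟩ ⟨l₁, hx, h, hs⟩
    dsimp only at hx h hs ⊢
    subst hx hs
    have h1 := hb x l₁ m h
    have h2 := hb x (l₁ ++ m) [] (by simpa using h)
    rw [List.foldl_append] at h2
    have h3 := hk x
    have h4 := sz_append l₁ m
    rw [← h] at h4
    have h5 := sz_pos l₁
    have h6 := length_le_sz m
    refine ⟨by rw [sz_pair, sz_pair]; omega, by omega, by omega, ?_⟩
    cases m with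
    | nil => simp
    | cons a m => exact fun _ => ⟨⟨l₁ ++ [a], rfl, by simpa using h, by simp⟩, by simp⟩

theorem PolyFn.foldr {l : γ → List α} {seed : γ → β} {step : γ × α × β → β} (hl : PolyFn l)
    (hi : PolyFn seed) (hs : PolyFn step) {B : ℕ → ℕ} (hB : PolyBd B)
    (hb : ∀ x l₁ l₂, l x = l₁ ++ l₂ →
      sz (l₂.foldr (fun a s => step (x, a, s)) (seed x)) ≤ B (sz x)) :
    PolyFn fun x => (l x).foldr (fun a s => step (x, a, s)) (seed x) := by
  have hc : PolyFn fun z : (γ × List α) × β =>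
      QuantFNN.listCase z.1.2 z.2 fun a _ => step (z.1.1, a, z.2) :=
    PolyFn.listCase (g := fun w : ((γ × List α) × β) × α × List α =>
      step (w.1.1.1, w.2.1, w.1.2)) (by fun_prop) (by fun_prop) (by fun_prop)
  obtain ⟨k, hk⟩ := hl.sz_le
  refine PolyFn.recur (e := fun x => (x, l x))
    (f := fun z : γ × List α => z.2.foldr (fun a s => step (z.1, a, s)) (seed z.1))
    (halt := fun z => z.2.isEmpty) (base := fun z => seed z.1) (h := fun z => (z.1, z.2.tail))
    (μ := fun z => z.2.length) (by fun_prop) (by fun_prop) (by fun_prop) (by fun_prop) hc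
    ?_ ?_ (B := fun n => n + (n + 2) ^ k + B n + 2) (by fun_prop) ?_
  · rintro ⟨x, _ | _⟩ h <;> simp_all
  · rintro ⟨x, _ | _⟩ h <;> simp_all
  · intro y
    refine ⟨fun z => ∃ l₁, z.1 = y ∧ l y = l₁ ++ z.2, ⟨[], rfl, rfl⟩, ?_⟩
    rintro ⟨x, m⟩ ⟨l₁, rfl, h⟩
    dsimp only at h ⊢
    have h1 := hb x l₁ m h
    have h3 := hk x
    have h4 := sz_append l₁ m
    rw [← h] at h4
    have h5 := sz_pos l₁
    have h6 := length_le_sz m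
    refine ⟨by rw [sz_pair]; omega, by omega, by omega, ?_⟩
    cases m with
    | nil => simp
    | cons a m => exact fun _ => ⟨⟨l₁ ++ [a], rfl, by simpa using h⟩, by simp⟩

@[fun_prop]
theorem PolyFn.append {f g : α → List β} (hf : PolyFn f) (hg : PolyFn g) :
    PolyFn fun x => f x ++ g x := by
  obtain ⟨k, hk⟩ := hf.sz_le
  obtain ⟨l, hl⟩ := hg.sz_le
  have := PolyFn.foldr (step := fun z : α × β × List β => z.2.1 :: z.2.2) hf hg (by fun_prop)
    (B := fun n => (n + 2) ^ k + (n + 2) ^ l) (by fun_prop) (by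
      intro x l₁ l₂ h
      rw [List.foldr_cons_eq_append']
      have h1 := hk x
      have h2 := hl x
      have h3 := sz_append l₁ l₂
      have h4 := sz_append l₂ (g x)
      have h5 := sz_pos l₁
      rw [h] at h1
      omega)
  simpa using this

theorem PolyFn.map {l : γ → List α} {f : γ × α → β} (hl : PolyFn l) (hf : PolyFn f) :
    PolyFn fun x => (l x).map fun a => f (x, a) := by
  obtain ⟨k, hk⟩ := hl.sz_le
  obtain ⟨m, hm⟩ := hf.sz_le
  have := PolyFn.foldr (seed := fun _ : γ => ([] : List β))
    (step := fun z : γ × α × List β => f (z.1, z.2.1) :: z.2.2) hl (by fun_prop) (by fun_prop)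
    (B := fun n => (n + 2) ^ k * ((n + (n + 2) ^ k + 1 + 2) ^ m + 1) + 1) (by fun_prop) (by
      intro x l₁ l₂ h
      have h1 : l₂.foldr (fun a s => f (x, a) :: s) [] = l₂.map fun a => f (x, a) := by
        simp
      rw [h1]
      have hx := hk x
      refine (sz_list_le (M := (sz x + (sz x + 2) ^ k + 1 + 2) ^ m) ?_).trans ?_
      · simp only [List.mem_map, forall_exists_index, and_imp, forall_apply_eq_imp_iff₂]
        intro a ha
        refine (hm (x, a)).trans (Nat.pow_le_pow_left ?_ _)
        have := sz_le_of_mem (l := l x) (a := a) (by simp [h, ha])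
        rw [sz_pair]; omega
      · have := length_le_sz (l x)
        rw [h, List.length_append, ← h] at this
        rw [List.length_map]
        gcongr
        omega)
  simpa using this

@[fun_prop]
theorem PolyFn.flatten {l : γ → List (List α)} (hl : PolyFn l) : PolyFn fun x => (l x).flatten := by
  obtain ⟨k, hk⟩ := hl.sz_le
  have := PolyFn.foldr (seed := fun _ : γ => ([] : List α))
    (step := fun z : γ × List α × List α => z.2.1 ++ z.2.2) hl (by fun_prop) (by fun_prop)
    (B := fun n => (n + 2) ^ k) (by fun_prop) (by
      intro x l₁ l₂ h
      refine le_trans ?_ (hk x)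
      have h3 := sz_append l₁ l₂
      have h5 := sz_pos l₁
      rw [h]
      refine le_trans ?_ (by omega : sz l₂ ≤ _)
      clear h3 h
      induction l₂ with
      | nil => exact le_rfl
      | cons a l ih =>
        have := sz_append a (l.foldr (fun a s => a ++ s) [])
        rw [List.foldr_cons, sz_cons]
        dsimp only at *
        omega)
  refine (funext fun x => ?_ : (fun x => (l x).flatten) = _) ▸ this
  induction l x with
  | nil => rfl
  | cons a l ih => simpa using ih

theorem PolyFn.flatMap {l : γ → List α} {f : γ × α → List β} (hl : PolyFn l) (hf : PolyFn f) :
    PolyFn fun x => (l x).flatMap fun a => f (x, a) := by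
  have := (PolyFn.map hl hf).flatten
  simpa only [List.flatMap_def] using this

@[fun_prop]
theorem PolyFn.reverse {l : γ → List α} (hl : PolyFn l) : PolyFn fun x => (l x).reverse := by
  obtain ⟨k, hk⟩ := hl.sz_le
  have := PolyFn.foldr (seed := fun _ : γ => ([] : List α))
    (step := fun z : γ × α × List α => z.2.2 ++ [z.2.1]) hl (by fun_prop) (by fun_prop)
    (B := fun n => (n + 2) ^ k) (by fun_prop) (by
      intro x l₁ l₂ h
      refine le_trans ?_ (hk x)
      have h3 := sz_append l₁ l₂
      have h5 := sz_pos l₁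
      rw [h]
      refine le_trans ?_ (by omega : sz l₂ ≤ _)
      clear h3 h
      induction l₂ with
      | nil => exact le_rfl
      | cons a l ih =>
        have := sz_append (l.foldr (fun a s => s ++ [a]) []) [a]
        rw [sz_cons, sz_nil] at this
        rw [List.foldr_cons, sz_cons]
        dsimp only at *
        omega)
  refine (funext fun x => ?_ : (fun x => (l x).reverse) = _) ▸ this
  induction l x with
  | nil => rfl
  | cons a l ih => simp [ih]

theorem PolyFn.all {l : γ → List α} {p : γ × α → Bool} (hl : PolyFn l) (hp : PolyFn p) :
    PolyFn fun x => (l x).all fun a => p (x, a) := by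
  have := PolyFn.foldr (seed := fun _ : γ => true)
    (step := fun z : γ × α × Bool => p (z.1, z.2.1) && z.2.2) hl (by fun_prop) (by fun_prop)
    (B := fun _ => 3) (by fun_prop) (fun _ _ _ _ => sz_bool_le _)
  refine (funext fun x => ?_ : (fun x => (l x).all fun a => p (x, a)) = _) ▸ this
  induction l x with
  | nil => rfl
  | cons a l ih => simp [ih]

@[fun_prop]
theorem PolyFn.zip {l : γ → List α} {m : γ → List β} (hl : PolyFn l) (hm : PolyFn m) :
    PolyFn fun x => (l x).zip (m x) := by
  have hc : PolyFn fun z : (List α × List β) × List (α × β) =>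
      QuantFNN.listCase z.1.1 z.2 fun a _ => QuantFNN.listCase z.1.2 z.2 fun b _ =>
        (a, b) :: z.2 := by
    refine PolyFn.listCase (g := fun w : ((List α × List β) × List (α × β)) × α × List α =>
      QuantFNN.listCase w.1.1.2 w.1.2 fun b _ => (w.2.1, b) :: w.1.2)
      (by fun_prop) (by fun_prop) ?_
    exact PolyFn.listCase (g := fun v :
        (((List α × List β) × List (α × β)) × α × List α) × β × List β =>
        (v.1.2.1, v.2.1) :: v.1.1.2)
      (by fun_prop) (by fun_prop) (by fun_prop)
  have hsz : ∀ (l : List α) (m : List β), sz (l.zip m) ≤ sz l + sz m + l.length := by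
    intro l
    induction l with
    | nil => intro m; simp [sz_nil]
    | cons a l ih =>
      intro m
      cases m with
      | nil => simp [sz_nil]; omega
      | cons b m =>
        have := ih m
        simp only [List.zip_cons_cons, sz_cons, sz_pair, List.length_cons]
        omega
  have : PolyFn fun z : List α × List β => z.1.zip z.2 := by
    refine PolyFn.recur (e := fun x => x)
      (f := fun z : List α × List β => z.1.zip z.2)
      (halt := fun z => z.1.isEmpty || z.2.isEmpty) (base := fun _ => [])
      (h := fun z => (z.1.tail, z.2.tail))
      (μ := fun z => z.1.length) (by fun_prop) (by fun_prop) (by fun_prop) (by fun_prop) hc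
      ?_ ?_ (B := fun n => 2 * n) (by fun_prop) ?_
    · rintro ⟨_ | _, _ | _⟩ h <;> simp_all
    · rintro ⟨_ | _, _ | _⟩ h <;> simp_all
    · intro y
      refine ⟨fun z => sz z ≤ sz y, le_rfl, ?_⟩
      rintro ⟨l, m⟩ h
      have h1 := hsz l m
      have h2 := length_le_sz l
      have h3 := sz_tail_le l
      have h4 := sz_tail_le m
      dsimp only
      simp only [sz_pair] at *
      refine ⟨by omega, by omega, by omega, ?_⟩
      intro hs
      refine ⟨by omega, ?_⟩
      cases l with
      | nil => simp at hs
      | cons => simp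
  exact this.comp (hl.prodMk hm)

end

/-! ### Natural numbers -/

/-- Digits are listed with the least significant first. The side condition excludes a leading zero,
which the canonical code never contains. -/
theorem encodeNat_bit {b : Bool} {n : ℕ} (h : n = 0 → b = true) :
    Computability.encodeNat (Nat.bit b n) = b :: Computability.encodeNat n := by
  have key : ((Nat.bit b n : ℕ) : Num) = bif b then ((n : Num)).bit1 else ((n : Num)).bit0 := by
    cases b
    · simp [Nat.bit, Num.bit0_of_bit0, two_mul]
    · simp [Nat.bit, Num.bit1_of_bit1, two_mul]
  unfold Computability.encodeNat
  rw [key]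
  rcases hn : (n : Num) with _ | m
  · have : n = 0 := by
      have := congrArg (fun x : Num => (x : ℕ)) hn
      simpa using this
    rw [h this]
    rfl
  · cases b <;> rfl

theorem length_encodeNat (n : ℕ) : (Computability.encodeNat n).length = n.size := by
  induction n using Nat.binaryRec' with
  | zero => rfl
  | bit b n h ih =>
    rw [encodeNat_bit h, Nat.size_bit, List.length_cons, ih]
    rw [ne_eq, Nat.bit_eq_zero_iff]
    rintro ⟨rfl, rfl⟩
    simp at h

theorem foldr_bit_encodeNat (n : ℕ) : (Computability.encodeNat n).foldr Nat.bit 0 = n := by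
  induction n using Nat.binaryRec' with
  | zero => rfl
  | bit b n h ih => rw [encodeNat_bit h, List.foldr_cons, ih]

/-- Each digit contributes 2 or 4 to the tree of a number, so the size of the tree and the bit
length differ by a constant factor. These estimates convert bounds on values into bounds on trees.
-/
theorem size_lt_sz (n : ℕ) : n.size < sz n := by
  rw [← length_encodeNat]
  exact length_le_sz (Computability.encodeNat n)

theorem sz_nat_le (n : ℕ) : sz n ≤ 4 * n.size + 1 := by
  have := sz_list_le (l := Computability.encodeNat n) (M := 3) fun b _ => sz_bool_le b
  rw [length_encodeNat] at this
  exact this.trans (by omega)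

theorem lt_two_pow_sz (n : ℕ) : n < 2 ^ sz n :=
  Nat.lt_of_lt_of_le n.lt_size_self (Nat.pow_le_pow_right (by omega) (size_lt_sz n).le)

theorem sz_nat_le_of_lt {n k : ℕ} (h : n < 2 ^ k) : sz n ≤ 4 * k + 1 := by
  have := Nat.size_le.2 h
  have := sz_nat_le n
  omega

theorem sz_nat_mono {m n : ℕ} (h : m ≤ n) : sz m ≤ 4 * sz n + 1 :=
  sz_nat_le_of_lt (h.trans_lt (lt_two_pow_sz n))

theorem sz_nat_le_self (n : ℕ) : sz n ≤ 4 * n + 1 :=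
  sz_nat_le_of_lt n.lt_two_pow_self

/-! ### Binary arithmetic in polynomial time -/

section

variable {α β γ δ : Type} [TEnc α] [TEnc β] [TEnc γ] [TEnc δ]

theorem PolyFn.of_encodeNat {f : α → ℕ} (h : PolyFn fun x => Computability.encodeNat (f x)) :
    PolyFn f := by
  obtain ⟨c, k, h⟩ := h
  exact ⟨c, k, h⟩

@[fun_prop]
theorem PolyFn.natBit {b : α → Bool} {f : α → ℕ} (hb : PolyFn b) (hf : PolyFn f) :
    PolyFn fun x => Nat.bit (b x) (f x) := by
  refine .of_encodeNat ?_
  have hz : PolyFn fun x => decide (f x = 0) := hf.decide_eq (.const 0)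
  have he : PolyFn fun x => Computability.encodeNat (f x) := PolyFn.encodeNat.comp hf
  have := PolyFn.cond (b := fun x => decide (f x = 0) && !b x) (by fun_prop) (.const [])
    (hb.cons he)
  refine (funext fun x => ?_ : (fun x => Computability.encodeNat (Nat.bit (b x) (f x))) = _) ▸ this
  by_cases h : f x = 0
  · cases hb : b x
    · rw [h]; rfl
    · rw [encodeNat_bit (by simp)]; simp
  · rw [encodeNat_bit (by simp [h])]; simp [h]

theorem headD_encodeNat (n : ℕ) : (Computability.encodeNat n).headD false = n.bodd := by
  induction n using Nat.binaryRec' with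
  | zero => rfl
  | bit b n h ih => rw [encodeNat_bit h]; simp

theorem tail_encodeNat (n : ℕ) : (Computability.encodeNat n).tail =
    Computability.encodeNat n.div2 := by
  induction n using Nat.binaryRec' with
  | zero => rfl
  | bit b n h ih => rw [encodeNat_bit h]; simp

@[fun_prop]
theorem PolyFn.bodd {f : α → ℕ} (hf : PolyFn f) : PolyFn fun x => (f x).bodd := by
  have he : PolyFn fun x => Computability.encodeNat (f x) := PolyFn.encodeNat.comp hf
  simpa only [headD_encodeNat] using he.headD (.const false)

@[fun_prop]
theorem PolyFn.div2 {f : α → ℕ} (hf : PolyFn f) : PolyFn fun x => (f x).div2 := by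
  have he : PolyFn fun x => Computability.encodeNat (f x) := PolyFn.encodeNat.comp hf
  refine .of_encodeNat ?_
  simpa only [tail_encodeNat] using he.tail

@[fun_prop]
theorem PolyFn.toNat {b : α → Bool} (hb : PolyFn b) : PolyFn fun x => (b x).toNat := by
  have := hb.cond (.const 1) (.const 0)
  refine (funext fun x => ?_ : (fun x => (b x).toNat) = _) ▸ this
  cases b x <;> rfl

theorem size_div2_lt {n : ℕ} (h : n ≠ 0) : n.div2.size < n.size := by
  rw [← Nat.bit_bodd_div2 n] at h
  conv_rhs => rw [← Nat.bit_bodd_div2 n, Nat.size_bit h]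
  omega

theorem div2_le (n : ℕ) : n.div2 ≤ n := by
  rw [Nat.div2_val]; omega

theorem eq_bit (n : ℕ) : n = 2 * n.div2 + n.bodd.toNat := by
  have := Nat.bodd_add_div2 n
  cases h : n.bodd <;> simp_all; omega

/-- Bitwise recursion on two numbers with a carry bit. -/
theorem PolyFn.bitRec {f : ℕ × ℕ × Bool → ℕ} {digit carry : Bool × Bool × Bool → Bool}
    (hd : PolyFn digit) (hc : PolyFn carry) (h₀ : ∀ c, f (0, 0, c) = c.toNat)
    (hf : ∀ m n c, f (m, n, c) = Nat.bit (digit (m.bodd, n.bodd, c))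
      (f (m.div2, n.div2, carry (m.bodd, n.bodd, c))))
    (hb : ∀ m n c, f (m, n, c) ≤ m + n + 1) : PolyFn f := by
  refine PolyFn.recur (e := fun x => x) (f := f)
    (halt := fun z => decide (z.1 = 0) && decide (z.2.1 = 0)) (base := fun z => z.2.2.toNat)
    (h := fun z => (z.1.div2, z.2.1.div2, carry (z.1.bodd, z.2.1.bodd, z.2.2)))
    (comb := fun z => Nat.bit (digit (z.1.1.bodd, z.1.2.1.bodd, z.1.2.2)) z.2)
    (μ := fun z => z.1.size + z.2.1.size) (by fun_prop) (by fun_prop) (by fun_prop) (by fun_prop)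
    (by fun_prop) ?_ ?_ (B := fun n => 4 * n + 1 + (4 * n + 1) + 10 + 4 * (n + n + 2) + 1)
    (by fun_prop) ?_
  · rintro ⟨m, n, c⟩ h
    simp only [Bool.and_eq_true, decide_eq_true_eq] at h
    rw [h.1, h.2, h₀]
  · rintro ⟨m, n, c⟩ -
    exact hf m n c
  · rintro ⟨M, N, C⟩
    refine ⟨fun z => z.1 ≤ M ∧ z.2.1 ≤ N, ⟨le_rfl, le_rfl⟩, ?_⟩
    rintro ⟨m, n, c⟩ ⟨hm, hn⟩
    dsimp only at hm hn ⊢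
    have h1 := sz_nat_mono hm
    have h2 := sz_nat_mono hn
    have h3 := sz_bool_le c
    have h4 := size_lt_sz m
    have h5 := size_lt_sz n
    have h6 : f (m, n, c) < 2 ^ (sz M + sz N + 2) := by
      have h7 := lt_two_pow_sz M
      have h8 := lt_two_pow_sz N
      have h9 := hb m n c
      have e1 : 2 ^ sz M ≤ 2 ^ (sz M + sz N) := Nat.pow_le_pow_right (by omega) (by omega)
      have e2 : 2 ^ sz N ≤ 2 ^ (sz M + sz N) := Nat.pow_le_pow_right (by omega) (by omega)
      rw [pow_add]
      omega
    have h7 := sz_nat_le_of_lt h6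
    simp only [sz_pair]
    refine ⟨by omega, by omega, by omega, fun hs => ⟨⟨(div2_le m).trans hm, (div2_le n).trans hn⟩,
      ?_⟩⟩
    by_cases hm0 : m = 0
    · have hn0 : n ≠ 0 := by rintro rfl; simp [hm0] at hs
      have := size_div2_lt hn0
      subst hm0
      simpa using this
    · have e1 := size_div2_lt hm0
      have e2 := Nat.size_le_size (div2_le n)
      omega

@[fun_prop]
theorem PolyFn.add {f g : α → ℕ} (hf : PolyFn f) (hg : PolyFn g) : PolyFn fun x => f x + g x := by
  have := PolyFn.bitRec (f := fun z => z.1 + z.2.1 + z.2.2.toNat)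
    (digit := fun z => bif z.1 then (bif z.2.1 then z.2.2 else !z.2.2) else
      (bif z.2.1 then !z.2.2 else z.2.2))
    (carry := fun z => (z.1 && z.2.1) || (z.1 && z.2.2) || (z.2.1 && z.2.2))
    (by fun_prop) (by fun_prop) (by simp) (by
      intro m n c
      have h1 := eq_bit m
      have h2 := eq_bit n
      rw [Nat.bit_val]
      dsimp only
      generalize m.bodd = b at *
      generalize n.bodd = d at *
      cases b <;> cases d <;> cases c <;> simp at * <;> omega) (by
      intro m n c
      have := c.toNat_le
      dsimp only; omega)
  have h : PolyFn fun z : ℕ × ℕ => z.1 + z.2 + false.toNat :=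
    this.comp (f := fun z : ℕ × ℕ => (z.1, z.2, false)) (by fun_prop)
  exact h.comp (hf.prodMk hg)

@[fun_prop]
theorem PolyFn.land {f g : α → ℕ} (hf : PolyFn f) (hg : PolyFn g) :
    PolyFn fun x => f x &&& g x := by
  -- The carry stays false throughout. The values for a true carry are invented so that the
  -- recursion equation holds there too.
  have := PolyFn.bitRec (f := fun z => bif z.2.2 then 1 + 2 * (z.1.div2 &&& z.2.1.div2) else
      z.1 &&& z.2.1)
    (digit := fun z => z.2.2 || (z.1 && z.2.1)) (carry := fun _ => false)
    (by fun_prop) (by fun_prop) (by intro c; cases c <;> rfl) (by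
      intro m n c
      cases c
      · simp only [cond_false, Bool.false_or]
        conv_lhs => rw [← Nat.bit_bodd_div2 m, ← Nat.bit_bodd_div2 n, Nat.land_bit]
      · simp only [cond_true, cond_false, Bool.true_or, Nat.bit_val, Bool.toNat_true]
        omega) (by
      intro m n c
      have h1 : m &&& n ≤ m := Nat.and_le_left
      have h2 : m.div2 &&& n.div2 ≤ m.div2 := Nat.and_le_left
      have h3 := eq_bit m
      cases c <;> simp <;> omega)
  have h : PolyFn fun z : ℕ × ℕ => z.1 &&& z.2 :=
    this.comp (f := fun z : ℕ × ℕ => (z.1, z.2, false)) (by fun_prop)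
  exact h.comp (hf.prodMk hg)

@[fun_prop]
theorem PolyFn.mul {f g : α → ℕ} (hf : PolyFn f) (hg : PolyFn g) : PolyFn fun x => f x * g x := by
  have : PolyFn fun z : ℕ × ℕ => z.1 * z.2 := by
    refine PolyFn.recur (e := fun x => x) (f := fun z : ℕ × ℕ => z.1 * z.2)
      (halt := fun z => decide (z.1 = 0)) (base := fun z => 0)
      (h := fun z => (z.1.div2, z.2))
      (comb := fun z => z.2 + z.2 + (bif z.1.1.bodd then z.1.2 else 0))
      (μ := fun z => z.1.size) (by fun_prop) (by fun_prop) (by fun_prop) (by fun_prop)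
      (by fun_prop) ?_ ?_ (B := fun n => 4 * n + 1 + n + 4 * n + 1)
      (by fun_prop) ?_
    · rintro ⟨m, n⟩ h
      simp_all
    · rintro ⟨m, n⟩ -
      conv_lhs => rw [eq_bit m]
      cases m.bodd <;> simp <;> ring
    · rintro ⟨M, N⟩
      refine ⟨fun z => z.1 ≤ M ∧ z.2 = N, ⟨le_rfl, rfl⟩, ?_⟩
      rintro ⟨m, n⟩ ⟨hm, rfl⟩
      dsimp only at hm ⊢
      have h1 := sz_nat_mono hm
      have h4 := size_lt_sz m
      have h6 : m * n < 2 ^ (sz M + sz n) := by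
        have h7 := lt_two_pow_sz M
        have h8 := lt_two_pow_sz n
        rw [pow_add]
        exact Nat.mul_lt_mul'' (by omega) h8
      have h7 := sz_nat_le_of_lt h6
      simp only [sz_pair]
      refine ⟨by omega, by omega, by omega, fun hs => ⟨⟨(div2_le m).trans hm, trivial⟩, ?_⟩⟩
      exact size_div2_lt (by simpa using hs)
  exact this.comp (hf.prodMk hg)

/-- Any list of digits is read as a number, leading zeros included; it suffices that every number
comes from its canonical list. -/
instance : TGen ℕ := by
  have : PolyFn fun l : List Bool => l.foldr Nat.bit 0 := by
    refine PolyFn.foldr (step := fun z : List Bool × Bool × ℕ => Nat.bit z.2.1 z.2.2) .id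
      (.const 0) (by fun_prop) (B := fun n => 4 * n + 1) (by fun_prop) ?_
    intro x l₁ l₂ h
    have h1 : ∀ l : List Bool, l.foldr Nat.bit 0 < 2 ^ l.length := by
      intro l
      induction l with
      | nil => simp
      | cons a l ih =>
        rw [List.foldr_cons, List.length_cons, pow_succ, Nat.bit_val]
        have := a.toNat_le
        omega
    have h2 := sz_nat_le_of_lt (h1 l₂)
    have h3 := length_le_sz x
    rw [h, List.length_append, ← h] at h3
    exact h2.trans (by omega)
  exact TGen.map this Computability.encodeNat foldr_bit_encodeNat (B := fun n => n) (by fun_prop)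
    fun _ => le_rfl

/-- Both differences are guessed together: they are the only pair with `m + b = n + a` in which one
component vanishes. Checking this needs no more than addition and equality, and the order relations
follow from it. -/
theorem PolyFn.sub_pair : PolyFn fun z : ℕ × ℕ => (z.1 - z.2, z.2 - z.1) := by
  refine PolyFn.of_graph (R := fun x y => decide (x.1 + y.2 = x.2 + y.1) &&
    (decide (y.1 = 0) || decide (y.2 = 0))) (by fun_prop) ?_ ?_
    (B := fun n => 4 * n + 1 + (4 * n + 1) + 1) (by fun_prop) ?_
  · rintro ⟨m, n⟩
    simp
    omega
  · rintro ⟨m, n⟩ ⟨a, b⟩ h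
    simp at h
    ext <;> dsimp only <;> omega
  · rintro ⟨m, n⟩
    have h1 := sz_nat_mono (Nat.sub_le m n)
    have h2 := sz_nat_mono (Nat.sub_le n m)
    simp only [sz_pair]
    omega

@[fun_prop]
theorem PolyFn.sub {f g : α → ℕ} (hf : PolyFn f) (hg : PolyFn g) : PolyFn fun x => f x - g x :=
  PolyFn.fst.comp (PolyFn.sub_pair.comp (hf.prodMk hg))

@[fun_prop]
theorem PolyFn.decide_le {f g : α → ℕ} (hf : PolyFn f) (hg : PolyFn g) :
    PolyFn fun x => decide (f x ≤ g x) := by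
  have : PolyFn fun x => decide (f x - g x = 0) := by fun_prop
  simpa only [Nat.sub_eq_zero_iff_le] using this

@[fun_prop]
theorem PolyFn.decide_lt {f g : α → ℕ} (hf : PolyFn f) (hg : PolyFn g) :
    PolyFn fun x => decide (f x < g x) := by
  have : PolyFn fun x => decide (f x + 1 ≤ g x) := by fun_prop
  exact this

/-- Quotient and remainder are guessed and verified by a multiplication. For the divisor 0 the test
forces the quotient 0 and the dividend as remainder, in agreement with the conventions for `/` and
`%`. -/
theorem PolyFn.divMod : PolyFn fun z : ℕ × ℕ => (z.1 / z.2, z.1 % z.2) := by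
  refine PolyFn.of_graph (R := fun x y => decide (x.2 * y.1 + y.2 = x.1) &&
    bif decide (x.2 = 0) then decide (y.1 = 0) else decide (y.2 < x.2)) (by fun_prop) ?_ ?_
    (B := fun n => 4 * n + 1 + (4 * n + 1) + 1) (by fun_prop) ?_
  · rintro ⟨m, n⟩
    rcases Nat.eq_zero_or_pos n with rfl | hn
    · simp
    · simp [hn.ne', Nat.mod_lt _ hn, Nat.div_add_mod]
  · rintro ⟨m, n⟩ ⟨a, b⟩ h
    rcases Nat.eq_zero_or_pos n with rfl | hn
    · simp at h
      simp [h]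
    · simp [hn.ne'] at h
      obtain ⟨rfl, h⟩ := h
      simp [Nat.mul_add_div hn, Nat.div_eq_of_lt h, Nat.mod_eq_of_lt h]
  · rintro ⟨m, n⟩
    have h1 := sz_nat_mono (Nat.div_le_self m n)
    have h2 := sz_nat_mono (Nat.mod_le m n)
    simp only [sz_pair]
    omega

@[fun_prop]
theorem PolyFn.div {f g : α → ℕ} (hf : PolyFn f) (hg : PolyFn g) : PolyFn fun x => f x / g x :=
  PolyFn.fst.comp (PolyFn.divMod.comp (hf.prodMk hg))

@[fun_prop]
theorem PolyFn.mod {f g : α → ℕ} (hf : PolyFn f) (hg : PolyFn g) : PolyFn fun x => f x % g x :=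
  PolyFn.snd.comp (PolyFn.divMod.comp (hf.prodMk hg))

@[fun_prop]
theorem PolyFn.length {l : γ → List α} (hl : PolyFn l) : PolyFn fun x => (l x).length := by
  have : PolyFn fun l : List α => l.foldr (fun _ n => n + 1) 0 := by
    refine PolyFn.foldr (step := fun z : List α × α × ℕ => z.2.2 + 1) .id
      (.const 0) (by fun_prop) (B := fun n => 4 * n + 1) (by fun_prop) ?_
    intro x l₁ l₂ h
    have h1 : l₂.foldr (fun _ n => n + 1) 0 = l₂.length := by simp
    have h2 := sz_nat_le_self l₂.length
    have h3 := length_le_sz x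
    dsimp only at h ⊢
    rw [h, List.length_append, ← h] at h3
    rw [h1]
    omega
  have := this.comp hl
  simpa using this

/-- `2 ^ k`, with an upper bound for the exponent `k` in unary. -/
theorem PolyFn.two_pow_min {l : γ → List α} {f : γ → ℕ} (hl : PolyFn l) (hf : PolyFn f) :
    PolyFn fun x => 2 ^ min (f x) (l x).length := by
  -- Walk along the list and double while the countdown is positive. The unary list, not the binary
  -- exponent, limits the number of doublings.
  have key : ∀ (l : List α) (a c : ℕ), (l.foldl (fun (s : ℕ × ℕ) _ =>
      if s.1 = 0 then s else (s.1 - 1, s.2 + s.2)) (a, c)) =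
        (a - l.length, c * 2 ^ min a l.length) := by
    intro l
    induction l with
    | nil => simp
    | cons b l ih =>
      intro a c
      rw [List.foldl_cons]
      split_ifs with h
      · rw [ih]
        dsimp only at h
        subst h
        simp
      · rw [ih, List.length_cons]
        obtain ⟨a, rfl⟩ := Nat.exists_eq_succ_of_ne_zero h
        simp only [Nat.succ_eq_add_one, Nat.add_min_add_right, pow_succ]
        ext <;> dsimp only
        · omega
        · simp only [Nat.add_sub_cancel]; ring
  have : PolyFn fun z : List α × ℕ => (z.1.foldl (fun (s : ℕ × ℕ) _ =>
      bif decide (s.1 = 0) then s else (s.1 - 1, s.2 + s.2)) (z.2, 1)) := by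
    refine PolyFn.foldl (step := fun w : (List α × ℕ) × (ℕ × ℕ) × α =>
      bif decide (w.2.1.1 = 0) then w.2.1 else (w.2.1.1 - 1, w.2.1.2 + w.2.1.2))
      (by fun_prop) (by fun_prop) (by fun_prop) (B := fun n => 4 * n + 1 + (4 * (n + 1) + 1) + 1)
      (by fun_prop) ?_
    rintro ⟨x, n⟩ l₁ l₂ h
    simp only [Bool.cond_eq_ite, decide_eq_true_eq, key, one_mul] at h ⊢
    have h2 := sz_nat_mono (Nat.sub_le n l₁.length)
    have h3 : 2 ^ min n l₁.length < 2 ^ (sz x + 1) := by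
      refine Nat.pow_lt_pow_right (by omega) ?_
      have h3 := length_le_sz x
      rw [h, List.length_append, ← h] at h3
      omega
    have h4 := sz_nat_le_of_lt h3
    simp only [sz_pair]
    omega
  have := PolyFn.snd.comp (this.comp (hl.prodMk hf))
  simpa only [Bool.cond_eq_ite, decide_eq_true_eq, key, one_mul] using this

@[fun_prop]
theorem PolyFn.two_pow_length {l : γ → List α} (hl : PolyFn l) :
    PolyFn fun x => 2 ^ (l x).length := by
  have := PolyFn.two_pow_min hl (PolyFn.length hl)
  simpa using this

@[fun_prop]
theorem PolyFn.getElem? {l : γ → List α} {f : γ → ℕ} (hl : PolyFn l) (hf : PolyFn f) :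
    PolyFn fun x => (l x)[f x]? := by
  have : PolyFn fun z : List α × ℕ => z.1[z.2]? := by
    refine PolyFn.recur (e := fun x => x) (f := fun z : List α × ℕ => z.1[z.2]?)
      (halt := fun z => z.1.isEmpty || decide (z.2 = 0)) (base := fun z => z.1.head?)
      (h := fun z => (z.1.tail, z.2 - 1)) (comb := fun z => z.2)
      (μ := fun z => z.1.length) (by fun_prop) (by fun_prop) (by fun_prop) (by fun_prop)
      (by fun_prop) ?_ ?_ (B := fun n => 8 * n + 8)
      (by fun_prop) ?_
    · rintro ⟨_ | ⟨a, l⟩, n⟩ h <;> simp_all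
    · rintro ⟨_ | ⟨a, l⟩, n⟩ h
      · simp at h
      · cases n
        · simp at h
        · simp
    · rintro ⟨L, N⟩
      refine ⟨fun z => sz z.1 ≤ sz L ∧ z.2 ≤ N, ⟨le_rfl, le_rfl⟩, ?_⟩
      rintro ⟨l, n⟩ ⟨h1, h2⟩
      dsimp only at h1 h2 ⊢
      have h3 := sz_nat_mono h2
      have h4 := length_le_sz l
      have h5 : sz l[n]? ≤ sz L + 2 := by
        rcases h : l[n]? with _ | a
        · rw [sz_none]; omega
        · have := sz_le_of_mem (List.mem_of_getElem? h)
          rw [sz_some]; omega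
      simp only [sz_pair]
      refine ⟨by omega, by omega, by omega, fun hs => ⟨⟨(sz_tail_le l).trans h1, by omega⟩, ?_⟩⟩
      cases l with
      | nil => simp at hs
      | cons => simp
  exact this.comp (hl.prodMk hf)

end

/-! ### Membership in `NEXPTIME` by guessing and checking -/

theorem pushAll_a (a b d : List Bool) (n : List Unit) (o : List Op) (l : List Bool) :
    pushAll (iStacks a b d n o) (l.reverse.map fun x => ⟨.a, x⟩) =
      iStacks (l ++ a) b d n o := by
  induction l generalizing a with
  | nil => rfl
  | cons x l ih =>
    rw [List.reverse_cons, List.map_append, pushAll_append, ih]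
    simp [pushAll]

/-- A language is in `NEXPTIME` if membership is witnessed by data of exponential size that can be
checked in polynomial time. -/
theorem inNEXPTIME_of_check {A α : Type} [Fintype A] [TEnc A] [TEnc α] [TGen α] {L : Language A}
    {check : α × List A → Bool} (hc : PolyFn check) (q : Polynomial ℕ)
    (h₁ : ∀ x ∈ L, ∃ r : α, sz r ≤ 2 ^ q.eval x.length ∧ check (r, x.reverse) = true)
    (h₂ : ∀ (x : List A) (r : α), check (r, x.reverse) = true → x ∈ L) : InNEXPTIME L := by
  classical
  obtain ⟨cc, k, hc⟩ := hc
  obtain ⟨cg, l, hg, hg'⟩ := TGen.exists_code (α := α)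
  -- Guess a witness, pair it with the input, and return a result only if the check succeeds.
  let c : Code := .comp (.pair (.comp .nil cg) .id) (.cond cc .nil .fail)
  -- Pushing `true` and the code of `a` on top of the code of a list produces the code of the list
  -- with `a` in front. So letters read from left to right build up the reversed input, starting
  -- from the single bit `false` for the empty list.
  let letter : A → List (Σ k : IStack, k.Sym) := fun a =>
    (true :: (enc a).code).reverse.map fun x => ⟨.a, x⟩
  have hst : ∀ x : List A, pushAll (fun _ => []) ([⟨.ctl, .code c⟩, ⟨.a, false⟩] ++ x.flatMap letter)
      = iStacks ((enc x.reverse).code) [] [] [] [.code c] := by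
    intro x
    rw [pushAll_append]
    have e1 : pushAll (fun _ => []) [(⟨.ctl, .code c⟩ : Σ k : IStack, k.Sym), ⟨.a, false⟩] =
        iStacks ((enc ([] : List A)).code) [] [] [] [.code c] := by
      have : (fun _ => [] : ∀ k : IStack, List k.Sym) = iStacks [] [] [] [] [] := by
        funext k; cases k <;> rfl
      rw [this]
      simp [pushAll, enc_nil, BinTree.code]
    have e2 : ∀ x y : List A, pushAll (iStacks (enc y).code [] [] [] [.code c]) (x.flatMap letter) =
        iStacks (enc (x.reverse ++ y)).code [] [] [] [.code c] := by
      intro x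
      induction x with
      | nil => intro y; rfl
      | cons a x ih =>
        intro y
        have := ih (a :: y)
        rw [List.flatMap_cons, pushAll_append, pushAll_a, List.reverse_cons, List.append_assoc]
        exact this
    rw [e1, e2, List.append_nil]
  obtain ⟨C, hC⟩ : ∃ C, ∀ a : A, sz a + 1 ≤ C :=
    ⟨∑ a : A, (sz a + 1), fun a => Finset.single_le_sum (f := fun a : A => sz a + 1)
      (fun _ _ => Nat.zero_le _) (Finset.mem_univ a)⟩
  have hszx : ∀ x : List A, sz x ≤ x.length * C + 1 := by
    intro x
    induction x with
    | nil => simp [sz_nil]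
    | cons a x ih =>
      have := hC a
      rw [sz_cons, List.length_cons, add_mul]
      omega
  obtain ⟨m, hm⟩ : PolyBd fun n => 80 * ((1 + (n + 2) ^ l + 1 + n) + 2 * n + 2 * n +
      (21 * (n + n + 1 + 2) ^ k + (n + n + 1) + 41 * (n + n + 1) + 50) + 1) + 2 := by fun_prop
  -- The running time is at most `(N + 2) ^ m` with `N` the bound on the witness plus the size of
  -- the input. The sum `N + 2` is at most `2 ^ (q + C * |x| + 3)`, which gives the exponent.
  refine inNEXPTIME_of_machine (interp c) .fetch [⟨.ctl, .code c⟩, ⟨.a, false⟩] letter L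
    ((q + .C C * .X + .C 3) * .C m) fun x => ?_
  rw [hst]
  constructor
  · intro hx
    obtain ⟨r, hr, hr'⟩ := h₁ x hx
    obtain ⟨n, hn, e⟩ := hg' r
    have h1 : cc.Runs (enc (r, x.reverse)) (enc (check (r, x.reverse))) _ := hc _
    rw [hr'] at h1
    obtain ⟨⟨i, hi, e2⟩, -⟩ := h1.cond (f := .nil) (g := .fail) (fun _ => Code.Runs.nil _) (by simp)
    have e3 : c.Ev (enc x.reverse) .nil _ := .comp (.pair (.comp (.nil _) e) (.id _)) e2
    have := accOps_of_ev (c := c) e3 c.mem_subs_self (accOps_nil 0 [.nil])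
    refine NMachine.Acc.mono (by simpa [AccOps] using this) ?_
    have hx := hszx x.reverse
    rw [List.length_reverse] at hx
    set N := 2 ^ q.eval x.length + (x.length * C + 1) with hN
    have b1 : (sz r + 2) ^ l ≤ (N + 2) ^ l := Nat.pow_le_pow_left (by omega) _
    have b2 : (sz (r, x.reverse) + 2) ^ k ≤ (N + N + 1 + 2) ^ k :=
      Nat.pow_le_pow_left (by rw [sz_pair]; omega) _
    have b3 : (N + 2) ^ m ≤ 2 ^ ((q + .C C * .X + .C 3) * .C m : Polynomial ℕ).eval x.length := by
      simp only [Polynomial.eval_mul, Polynomial.eval_add, Polynomial.eval_C, Polynomial.eval_X]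
      rw [pow_mul]
      refine Nat.pow_le_pow_left ?_ _
      have : x.length * C < 2 ^ (C * x.length) := by rw [mul_comm]; exact Nat.lt_two_pow_self
      have h2 : 2 ^ q.eval x.length ≤ 2 ^ q.eval x.length * 2 ^ (C * x.length) :=
        Nat.le_mul_of_pos_right _ (by positivity)
      have h3 : 2 ^ (C * x.length) ≤ 2 ^ q.eval x.length * 2 ^ (C * x.length) :=
        Nat.le_mul_of_pos_left _ (by positivity)
      rw [pow_add, pow_add]
      omega
    refine le_trans ?_ ((hm N).trans b3)
    have b4 : (enc (r, x.reverse)).size = (enc r).size + (enc x.reverse).size + 1 := rfl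
    simp only [sz] at *
    omega
  -- An accepting run yields an evaluation, and the tree guessed in it represents some `r`; its size
  -- plays no role in this direction.
  · rintro ⟨w, hw, h⟩
    have h' : AccOps c w.length [.code c] [enc x.reverse] := by
      refine ⟨w, le_rfl, ?_⟩
      simpa using h
    obtain ⟨y, i, n', -, e, -⟩ := exists_ev_of_accOps _ c c.mem_subs_self _ _ _ h'
    replace e : (Code.comp (.pair (.comp .nil cg) .id) (.cond cc .nil .fail)).Ev
      (enc x.reverse) y i := e
    cases e with
    | comp e e' =>
      cases e with
      | pair e₁ e₂ =>
        cases e₂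
        cases e₁ with
        | comp e₁ e₃ =>
          cases e₁
          obtain ⟨r, rfl⟩ := hg _ _ e₃
          have h1 : cc.Runs (enc (r, x.reverse)) (enc (check (r, x.reverse))) _ := hc _
          refine h₂ x r ?_
          by_contra hr
          rw [Bool.not_eq_true] at hr
          rw [hr] at h1
          exact Code.Fails.cond (f := .nil) h1 (by simp) (fun _ => Code.fails_fail _) _ _ e'

/-! ### Floating-point numbers as pairs of a sign and a rank -/

/-- The magnitude of the number of rank `M`, in units of the last place of the smallest number. -/
def magnitude (p M : ℕ) : ℕ := (2 ^ p + M % 2 ^ p) * 2 ^ (M / 2 ^ p)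

theorem magnitude_pos (p M : ℕ) : 0 < magnitude p M := by unfold magnitude; positivity

/-- Within one exponent the significand grows by a unit. At the boundary, `(2 ^ (p + 1) - 1) * 2 ^
E` is followed by `2 ^ p * 2 ^ (E + 1)`. -/
theorem magnitude_strictMono (p : ℕ) : StrictMono (magnitude p) := by
  refine strictMono_nat_of_lt_succ fun M => ?_
  have hp : 0 < 2 ^ p := by positivity
  have hM := Nat.div_add_mod M (2 ^ p)
  have hlt := Nat.mod_lt M hp
  unfold magnitude
  rcases Nat.lt_or_ge (M % 2 ^ p + 1) (2 ^ p) with h | h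
  · have e : M + 1 = 2 ^ p * (M / 2 ^ p) + (M % 2 ^ p + 1) := by omega
    have e1 : (M + 1) / 2 ^ p = M / 2 ^ p := by
      rw [e, Nat.mul_add_div hp, Nat.div_eq_of_lt h, Nat.add_zero]
    have e2 : (M + 1) % 2 ^ p = M % 2 ^ p + 1 := by
      rw [e, Nat.mul_add_mod, Nat.mod_eq_of_lt h]
    rw [e1, e2]
    exact Nat.mul_lt_mul_of_pos_right (by omega) (by positivity)
  · have e : M + 1 = 2 ^ p * (M / 2 ^ p + 1) := by rw [mul_add]; omega
    have e1 : (M + 1) / 2 ^ p = M / 2 ^ p + 1 := by rw [e, Nat.mul_div_cancel_left _ hp]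
    have e2 : (M + 1) % 2 ^ p = 0 := by rw [e, Nat.mul_mod_right]
    rw [e1, e2, pow_succ, add_zero, mul_comm (2 ^ (M / 2 ^ p)) 2, ← mul_assoc]
    exact Nat.mul_lt_mul_of_pos_right (by omega) (by positivity)

/-- The position of a number among all numbers: the positive ones are `0, 1, …`, the negative ones
`-1, -2, …`. -/
def position (r : Bool × ℕ) : ℤ := bif r.1 then -1 - r.2 else r.2

/-- The signed magnitude. -/
def signedMagnitude (p : ℕ) (r : Bool × ℕ) : ℤ :=
  bif r.1 then -magnitude p r.2 else magnitude p r.2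

/-- Since zero is not a number of the arithmetic, the smallest positive number directly follows the
largest negative one. Numbering them 0 and -1 turns the order into that of consecutive integers. -/
theorem signedMagnitude_lt_iff {p : ℕ} {r r' : Bool × ℕ} :
    signedMagnitude p r < signedMagnitude p r' ↔ position r < position r' := by
  obtain ⟨s, M⟩ := r
  obtain ⟨s', M'⟩ := r'
  have h := magnitude_pos p M
  have h' := magnitude_pos p M'
  have h1 := (magnitude_strictMono p).lt_iff_lt (a := M) (b := M')
  have h2 := (magnitude_strictMono p).lt_iff_lt (a := M') (b := M)
  unfold signedMagnitude position
  cases s <;> cases s' <;> simp only [cond_true, cond_false] <;> omega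

theorem position_injective : Function.Injective position := by
  rintro ⟨s, M⟩ ⟨s', M'⟩ h
  unfold position at h
  cases s <;> cases s' <;> simp at h ⊢ <;> omega

namespace FloatNum

variable {p e : ℕ}

/-- The sign and the rank of a number among those with its sign. -/
def toRaw (y : FloatNum p e) : Bool × ℕ :=
  (y.sign, ((y.exponent : ℤ) + (2 ^ (e - 1) - 2)).toNat * 2 ^ p + y.frac)

theorem toRaw_snd_div (y : FloatNum p e) :
    y.toRaw.2 / 2 ^ p = ((y.exponent : ℤ) + (2 ^ (e - 1) - 2)).toNat := by
  rw [toRaw, mul_comm]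
  dsimp only
  rw [Nat.mul_add_div (by positivity), Nat.div_eq_of_lt y.frac.2, add_zero]

theorem toRaw_snd_mod (y : FloatNum p e) : y.toRaw.2 % 2 ^ p = y.frac := by
  rw [toRaw, mul_comm]
  dsimp only
  rw [Nat.mul_add_mod, Nat.mod_eq_of_lt y.frac.2]

theorem toNat_exponent (y : FloatNum p e) :
    ((((y.exponent : ℤ) + (2 ^ (e - 1) - 2)).toNat : ℕ) : ℤ) =
      (y.exponent : ℤ) + (2 ^ (e - 1) - 2) := by
  have := Finset.mem_Icc.1 y.exponent.2
  omega

theorem toRaw_injective : Function.Injective (toRaw (p := p) (e := e)) := by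
  intro y z h
  have h1 := congrArg Prod.fst h
  have h2 := y.toRaw_snd_div
  have h3 := y.toRaw_snd_mod
  rw [h, z.toRaw_snd_div] at h2
  rw [h, z.toRaw_snd_mod] at h3
  have h4 := y.toNat_exponent
  rw [← h2, z.toNat_exponent] at h4
  obtain ⟨s, E, k⟩ := y
  obtain ⟨s', E', k'⟩ := z
  dsimp only [toRaw] at h1 h3 h4
  subst h1
  obtain rfl : E = E' := Subtype.ext (by omega)
  obtain rfl : k = k' := Fin.ext h3.symm
  rfl

theorem two_pow_pred (he : 2 ≤ e) : 2 ^ e = 2 * 2 ^ (e - 1) ∧ 2 ≤ 2 ^ (e - 1) := by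
  obtain ⟨e, rfl⟩ := Nat.exists_eq_add_of_le he
  rw [show 2 + e - 1 = e + 1 by omega, pow_add, pow_succ]
  have : 0 < 2 ^ e := by positivity
  omega

/-- There are `2 ^ e - 2` exponents, each with `2 ^ p` significands; conversely `exists_toRaw` shows
that every rank below the product occurs. -/
theorem toRaw_snd_lt (he : 2 ≤ e) (y : FloatNum p e) : y.toRaw.2 < (2 ^ e - 2) * 2 ^ p := by
  have h1 := Finset.mem_Icc.1 y.exponent.2
  have h2 := y.toNat_exponent
  have h3 := two_pow_pred he
  have h4 : y.toRaw.2 / 2 ^ p < 2 ^ e - 2 := by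
    rw [toRaw_snd_div]
    zify [show 2 ≤ 2 ^ e by omega]
    zify at h3
    rw [h3.1]
    omega
  exact (Nat.div_lt_iff_lt_mul (by positivity)).1 h4

theorem exists_toRaw (he : 2 ≤ e) {r : Bool × ℕ} (h : r.2 < (2 ^ e - 2) * 2 ^ p) :
    ∃ y : FloatNum p e, y.toRaw = r := by
  have h4 := (Nat.div_lt_iff_lt_mul (k := 2 ^ p) (by positivity)).2 h
  have h3 := two_pow_pred he
  refine ⟨⟨r.1, ⟨(r.2 / 2 ^ p : ℕ) - (2 ^ (e - 1) - 2), ?_⟩, ⟨r.2 % 2 ^ p, Nat.mod_lt _ (by positivity)⟩⟩, ?_⟩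
  · generalize r.2 / 2 ^ p = q at h4
    rw [Finset.mem_Icc]
    zify [show 2 ≤ 2 ^ e by omega] at h4
    zify at h3
    constructor <;> omega
  · unfold toRaw
    dsimp only
    rw [sub_add_cancel, Int.toNat_natCast, mul_comm, Nat.div_add_mod]

/-- The exponent of the unit in which magnitudes are measured. -/
def unitExponent (p e : ℕ) : ℕ := p + (2 ^ (e - 1) - 2)

/-- All numbers are integer multiples of the last place of the smallest one. This common denominator
reduces comparisons to integers. -/
theorem val_eq (he : 2 ≤ e) (y : FloatNum p e) :
    y.val = signedMagnitude p y.toRaw / 2 ^ unitExponent p e := by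
  have h1 := y.toNat_exponent
  have h3 := two_pow_pred he
  have h5 : (2 : ℚ) ^ (y.exponent : ℤ) = 2 ^ (y.toRaw.2 / 2 ^ p) / 2 ^ (2 ^ (e - 1) - 2) := by
    rw [toRaw_snd_div, eq_div_iff (by positivity), ← zpow_natCast, ← zpow_natCast,
      ← zpow_add₀ (by norm_num)]
    congr 1
    rw [h1]
    push_cast [h3.2]
    ring
  have h6 : ((magnitude p y.toRaw.2 : ℕ) : ℚ) = (2 ^ p + y.frac) * 2 ^ (y.toRaw.2 / 2 ^ p) := by
    rw [magnitude, toRaw_snd_mod]; push_cast; rfl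
  have h7 : y.val = (-1) ^ y.sign.toNat * (magnitude p y.toRaw.2 / 2 ^ unitExponent p e) := by
    rw [FloatNum.val, h5, h6, unitExponent, pow_add]
    field_simp
  rw [h7, signedMagnitude]
  have : y.toRaw.1 = y.sign := rfl
  rw [this]
  cases y.sign <;> simp [neg_div]

/-- The biased exponent starts at 1, one more than the index of the exponent, which accounts for the
summand `2 ^ p`. Apart from the sign bit, the bit-vector is the rank shifted by a constant. -/
theorem toNat_toBits (he : 2 ≤ e) (y : FloatNum p e) :
    y.toBits.toNat = y.sign.toNat * 2 ^ (e + p) + 2 ^ p + y.toRaw.2 := by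
  have h1 := Finset.mem_Icc.1 y.exponent.2
  have h2 := y.toNat_exponent
  have h3 := two_pow_pred he
  have h4 : ((y.exponent : ℤ) + (2 ^ (e - 1) - 1)).toNat =
      ((y.exponent : ℤ) + (2 ^ (e - 1) - 2)).toNat + 1 := by omega
  have h5 : ((y.exponent : ℤ) + (2 ^ (e - 1) - 2)).toNat + 1 < 2 ^ e := by
    zify; zify at h3; rw [h2, h3.1]; omega
  unfold toBits
  rw [BitVec.toNat_append, BitVec.toNat_append, BitVec.toNat_ofNat, BitVec.toNat_ofNat,
    BitVec.toNat_ofBool, Nat.mod_eq_of_lt y.frac.2, h4, Nat.mod_eq_of_lt h5,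
    ← Nat.shiftLeft_add_eq_or_of_lt h5, ← Nat.shiftLeft_add_eq_or_of_lt y.frac.2,
    Nat.shiftLeft_eq, Nat.shiftLeft_eq, toRaw, pow_add]
  ring

theorem val_lt_iff (he : 2 ≤ e) (y z : FloatNum p e) :
    y.val < z.val ↔ position y.toRaw < position z.toRaw := by
  rw [val_eq he, val_eq he, ← signedMagnitude_lt_iff (p := p),
    div_lt_div_iff_of_pos_right (by positivity), Int.cast_lt]

theorem val_neg_iff (he : 2 ≤ e) (y : FloatNum p e) : y.val < 0 ↔ y.sign = true := by
  have h := magnitude_pos p y.toRaw.2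
  rw [val_eq he, div_lt_iff₀ (by positivity), zero_mul, ← Int.cast_zero, Int.cast_lt,
    signedMagnitude, show y.toRaw.1 = y.sign from rfl]
  cases y.sign <;> simp; omega

theorem val_pos_iff (he : 2 ≤ e) (y : FloatNum p e) : 0 < y.val ↔ y.sign = false := by
  have h := magnitude_pos p y.toRaw.2
  rw [val_eq he, lt_div_iff₀ (by positivity), zero_mul, ← Int.cast_zero, Int.cast_lt,
    signedMagnitude, show y.toRaw.1 = y.sign from rfl]
  cases y.sign <;> simp; omega

end FloatNum

/-! ### Rounding -/

/-- The criterion preferring the larger of two adjacent numbers `l < h` when rounding `x`. -/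
def RoundingMode.PreferUpper (mode : RoundingMode) (l h x : ℚ) (even : Prop) : Prop :=
  match mode with
  | .nearestEven => l + h < 2 * x ∨ l + h = 2 * x ∧ (even ∨ l < 0 ∧ 0 < h)
  | .nearestAway => l + h < 2 * x ∨ l + h = 2 * x ∧ 0 < h
  | .towardZero => 0 ≤ x ∧ (l < 0 ∨ h ≤ x) ∨ x < 0 ∧ h < 0 ∧ l < x
  | .towardPos => l < x
  | .towardNeg => h ≤ x

/-- If the upper of two neighbours is preferred, then `x` lies high enough for the same to hold at
every lower pair. In the nearest modes the lower midpoint is strictly smaller, so ties and parities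
no longer matter there. -/
theorem RoundingMode.PreferUpper.anti {mode : RoundingMode} {l h l' h' x : ℚ} {even even' : Prop}
    (hl : l < h) (hh : h ≤ l') (hl' : l' < h') (H : mode.PreferUpper l' h' x even') :
    mode.PreferUpper l h x even := by
  cases mode <;> simp only [PreferUpper] at H ⊢
  · left; rcases H with H | H <;> linarith
  · left; rcases H with H | H <;> linarith
  · rcases H with ⟨H, H' | H'⟩ | ⟨H, H', H''⟩
    · exact .inl ⟨H, .inl (by linarith)⟩
    · exact .inl ⟨H, .inr (by linarith)⟩
    · exact .inr ⟨H, by linarith, by linarith⟩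
  · linarith
  · linarith

/-- If the preferences between neighbours in a finite chain are monotone, an element is the minimum
iff it is preferred to both neighbours. -/
theorem isMin_iff_of_chain {ι κ : Type} [LinearOrder κ] {pos : ι → ℤ} {a b : ℤ}
    (hinj : Function.Injective pos) (hmem : ∀ i, a ≤ pos i ∧ pos i ≤ b)
    (hsurj : ∀ n, a ≤ n → n ≤ b → ∃ i, pos i = n) (cost : ι → κ) (P : ι → ι → Prop)
    (hP : ∀ i j, pos j = pos i + 1 → (cost j < cost i ↔ P i j) ∧ (cost i < cost j ↔ ¬ P i j))
    (hanti : ∀ i j k l, pos j = pos i + 1 → pos l = pos k + 1 → pos j ≤ pos k → P k l → P i j)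
    (y : ι) : (∀ z, cost y ≤ cost z) ↔
      (∀ z, pos z = pos y + 1 → ¬ P y z) ∧ (∀ z, pos y = pos z + 1 → P z y) := by
  constructor
  · intro h
    refine ⟨fun z hz hp => ?_, fun z hz => ?_⟩
    · exact absurd ((hP y z hz).1.2 hp) (not_lt.2 (h z))
    · by_contra hp
      exact absurd ((hP z y hz).2.2 hp) (not_lt.2 (h z))
  · rintro ⟨h₁, h₂⟩
    -- Above `y` the upper neighbour is not preferred at the first step, hence by `hanti` at no
    -- later step, and the cost keeps increasing. Below `y` the argument is symmetric.
    have up : ∀ n : ℕ, ∀ z, pos z = pos y + n → cost y ≤ cost z := by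
      intro n
      induction n with
      | zero => intro z hz; rw [hinj (a₁ := z) (a₂ := y) (by simpa using hz)]
      | succ n ih =>
        intro z hz
        push_cast at hz
        have hz' := hmem z
        have hy' := hmem y
        obtain ⟨w, hw⟩ := hsurj (pos y + n) (by omega) (by omega)
        refine (ih w hw).trans (((hP w z (by omega)).2.2 fun hp => ?_).le)
        obtain ⟨v, hv⟩ := hsurj (pos y + 1) (by omega) (by omega)
        refine h₁ v hv ?_
        rcases Nat.eq_zero_or_pos n with rfl | hn
        · rwa [hinj (a₁ := y) (a₂ := w) (by omega), hinj (a₁ := v) (a₂ := z) (by omega)]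
        · exact hanti y v w z hv (by omega) (by omega) hp
    have down : ∀ n : ℕ, ∀ z, pos y = pos z + n → cost y ≤ cost z := by
      intro n
      induction n with
      | zero => intro z hz; rw [hinj (a₁ := z) (a₂ := y) (by omega)]
      | succ n ih =>
        intro z hz
        push_cast at hz
        have hz' := hmem z
        have hy' := hmem y
        obtain ⟨w, hw⟩ := hsurj (pos z + 1) (by omega) (by omega)
        refine (ih w (by omega)).trans (((hP z w (by omega)).1.2 ?_).le)
        obtain ⟨v, hv⟩ := hsurj (pos y - 1) (by omega) (by omega)
        rcases Nat.eq_zero_or_pos n with rfl | hn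
        · rw [hinj (a₁ := w) (a₂ := y) (by omega)]
          exact h₂ z (by omega)
        · exact hanti z w v y (by omega) (by omega) (by omega) (h₂ v (by omega))
    intro z
    rcases le_total (pos y) (pos z) with h | h
    · exact up (pos z - pos y).toNat z (by omega)
    · exact down (pos y - pos z).toNat z (by omega)

theorem abs_sub_lt_abs_sub_iff {l h x : ℚ} (hlh : l < h) : |h - x| < |l - x| ↔ l + h < 2 * x := by
  rw [← sq_lt_sq]
  constructor <;> intro H <;> nlinarith

theorem abs_sub_lt_abs_sub_iff' {l h x : ℚ} (hlh : l < h) : |l - x| < |h - x| ↔ 2 * x < l + h := by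
  rw [← sq_lt_sq]
  constructor <;> intro H <;> nlinarith

theorem abs_sub_eq_abs_sub_iff {l h x : ℚ} (hlh : l < h) : |h - x| = |l - x| ↔ l + h = 2 * x := by
  rw [eq_iff_le_not_lt, ← not_lt, abs_sub_lt_abs_sub_iff hlh, abs_sub_lt_abs_sub_iff' hlh,
    eq_iff_le_not_lt, not_lt]

/-! ### Neighbouring numbers and their costs -/

namespace FloatNum

variable {p e : ℕ}

/-- Neighbours of equal sign have consecutive bit-vectors, hence opposite parities. The two numbers
next to zero differ only in the sign bit, whose weight `2 ^ (e + p)` is even. So parity cannot break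
that tie, and the preference for the positive number is needed. -/
theorem parity_of_adjacent (he : 2 ≤ e) {y z : FloatNum p e}
    (h : position z.toRaw = position y.toRaw + 1) :
    (y.sign = z.sign ∧ (Even z.toBits.toNat ↔ ¬ Even y.toBits.toNat)) ∨
    (y.val < 0 ∧ 0 < z.val ∧ y.val = - z.val ∧ (Even z.toBits.toNat ↔ Even y.toBits.toNat)) := by
  rw [toNat_toBits he, toNat_toBits he, val_eq he, val_eq he]
  have hs : y.toRaw.1 = y.sign := rfl
  have hs' : z.toRaw.1 = z.sign := rfl
  have he' : Even (2 ^ (e + p)) := (even_two).pow_of_ne_zero (by omega)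
  rw [position, position, hs, hs'] at h
  rw [signedMagnitude, signedMagnitude, hs, hs']
  have hm := magnitude_pos p 0
  cases hy : y.sign <;> cases hz : z.sign <;> rw [hy, hz] at h <;>
    simp only [cond_true, cond_false] at h
  · left
    have : z.toRaw.2 = y.toRaw.2 + 1 := by omega
    rw [this]
    refine ⟨rfl, ?_⟩
    simp only [Nat.even_add, Bool.toNat_false, zero_mul, zero_add, Nat.not_even_one, iff_false]
    tauto
  · omega
  · right
    have h1 : z.toRaw.2 = 0 := by omega
    have h2 : y.toRaw.2 = 0 := by omega
    rw [h1, h2]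
    simp only [cond_true, cond_false]
    refine ⟨?_, by positivity, ?_, ?_⟩
    · rw [div_lt_iff₀ (by positivity)]; simpa using hm
    · simp [neg_div]
    · simp [Nat.even_add, he']
  · left
    have : y.toRaw.2 = z.toRaw.2 + 1 := by omega
    rw [this]
    refine ⟨rfl, ?_⟩
    simp only [Nat.even_add, Bool.toNat_true, one_mul, he', true_iff, Nat.not_even_one, iff_false]
    tauto

end FloatNum

namespace FloatArith

variable (F : FloatArith)

/-- Neighbours never have equal cost, whence two strict inequalities with complementary conditions.
This makes the lexicographic minimum accessible through comparisons of adjacent numbers and yields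
its uniqueness. -/
theorem roundingCost_lt_iff (x : ℚ) {y z : F.Num} (h : position z.toRaw = position y.toRaw + 1) :
    (F.roundingCost x z < F.roundingCost x y ↔
      F.mode.PreferUpper y.val z.val x (Even z.toBits.toNat)) ∧
    (F.roundingCost x y < F.roundingCost x z ↔
      ¬ F.mode.PreferUpper y.val z.val x (Even z.toBits.toNat)) := by
  have he := F.two_le_e
  have hlt : y.val < z.val := (FloatNum.val_lt_iff he _ _).2 (by omega)
  have h1 := FloatNum.parity_of_adjacent he h
  have hA := abs_sub_lt_abs_sub_iff (x := x) hlt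
  have hA' := abs_sub_lt_abs_sub_iff' (x := x) hlt
  have hB := abs_sub_eq_abs_sub_iff (x := x) hlt
  have hB' : |y.val - x| = |z.val - x| ↔ y.val + z.val = 2 * x := by rw [← hB, eq_comm]
  have hy := FloatNum.val_neg_iff he y
  have hy' := FloatNum.val_pos_iff he y
  have hz := FloatNum.val_neg_iff he z
  have hz' := FloatNum.val_pos_iff he z
  have hsgn : (y.val < 0 ∧ z.val < 0 ∧ (Even z.toBits.toNat ↔ ¬ Even y.toBits.toNat)) ∨
      (0 < y.val ∧ 0 < z.val ∧ (Even z.toBits.toNat ↔ ¬ Even y.toBits.toNat)) ∨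
      (y.val < 0 ∧ 0 < z.val ∧ y.val = - z.val ∧ (Even z.toBits.toNat ↔ Even y.toBits.toNat)) := by
    rcases h1 with ⟨h1, h2⟩ | h1
    · rw [hy, hy', hz, hz', h1]
      cases z.sign <;> simp [h2]
    · exact .inr (.inr h1)
  clear h1 hy hy' hz hz' h
  cases hm : F.mode <;> simp only [roundingCost, RoundingMode.PreferUpper, hm] <;>
    simp only [Prod.Lex.toLex_lt_toLex, hA, hA', hB, hB'] <;> clear hA hA' hB hB' hm <;>
    generalize y.val = l at * <;> generalize z.val = h at *
  · rcases lt_trichotomy (l + h) (2 * x) with t | t | t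
    · simp [t, t.not_gt, t.ne]
    · simp only [t, lt_self_iff_false, false_or, true_and]
      rcases hsgn with ⟨a, b, c⟩ | ⟨a, b, c⟩ | ⟨a, b, -, c⟩
      · by_cases ey : Even (FloatNum.toBits y).toNat <;> simp [c, ey, a.not_gt, b.not_gt]
      · by_cases ey : Even (FloatNum.toBits y).toNat <;> simp [c, ey, a, b, a.not_gt]
      · by_cases ey : Even (FloatNum.toBits y).toNat <;> simp [c, ey, a, b, a.not_gt]
    · simp [t, t.not_gt, t.ne']
  · rcases lt_trichotomy (l + h) (2 * x) with t | t | t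
    · simp [t, t.not_gt, t.ne]
    · simp only [t, lt_self_iff_false, false_or, true_and]
      rcases hsgn with ⟨a, b, c⟩ | ⟨a, b, c⟩ | ⟨a, b, d, c⟩
      · simp [abs_of_neg a, abs_of_neg b, hlt, b.not_gt, hlt.not_gt, a.not_gt]
      · simp [abs_of_pos a, abs_of_pos b, hlt, b, hlt.not_gt, a]
      · simp [abs_of_pos b, b, b.not_gt, d]
    · simp [t, t.not_gt, t.ne']
  · rcases le_or_gt 0 x with hx | hx <;> rcases hsgn with ⟨a, b, -⟩ | ⟨a, b, -⟩ | ⟨a, b, -, -⟩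
    · simp only [abs_of_neg a, abs_of_neg b, abs_of_nonneg hx]
      grind
    · simp only [abs_of_pos a, abs_of_pos b, abs_of_nonneg hx]
      grind
    · grind
    · simp only [abs_of_neg a, abs_of_neg b, abs_of_neg hx]
      grind
    · simp only [abs_of_pos a, abs_of_pos b, abs_of_neg hx]
      grind
    · grind
  · clear hsgn
    grind
  · clear hsgn
    grind

/-- The number of positive numbers. -/
def numPos : ℕ := (2 ^ F.e - 2) * 2 ^ F.p

/-- The value of the number with a given sign and rank. -/
def rawVal (r : Bool × ℕ) : ℚ := signedMagnitude F.p r / 2 ^ FloatNum.unitExponent F.p F.e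

/-- The bit-vector, as a natural number, of the number with a given sign and rank. -/
def rawBits (r : Bool × ℕ) : ℕ := r.1.toNat * 2 ^ (F.e + F.p) + 2 ^ F.p + r.2

variable {F} in
theorem rawVal_toRaw (y : F.Num) : F.rawVal y.toRaw = y.val := (FloatNum.val_eq F.two_le_e y).symm

variable {F} in
theorem rawBits_toRaw (y : F.Num) : F.rawBits y.toRaw = y.toBits.toNat :=
  (FloatNum.toNat_toBits F.two_le_e y).symm

/-- Whether `h` is preferred to its lower neighbour `l` when rounding `x`. -/
def PreferUpper (x : ℚ) (l h : Bool × ℕ) : Prop :=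
  F.mode.PreferUpper (F.rawVal l) (F.rawVal h) x (Even (F.rawBits h))

end FloatArith

/-- The next larger number. -/
def nextUp (r : Bool × ℕ) : Bool × ℕ :=
  bif r.1 then bif decide (r.2 = 0) then (false, 0) else (true, r.2 - 1) else (false, r.2 + 1)

/-- The next smaller number. -/
def nextDown (r : Bool × ℕ) : Bool × ℕ :=
  bif r.1 then (true, r.2 + 1) else bif decide (r.2 = 0) then (true, 0) else (false, r.2 - 1)

theorem position_nextUp (r : Bool × ℕ) : position (nextUp r) = position r + 1 := by
  obtain ⟨_ | _, M⟩ := r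
  · simp [position, nextUp]
  · by_cases h : M = 0
    · simp [position, nextUp, h]
    · simp [position, nextUp, h]; omega

theorem position_nextDown (r : Bool × ℕ) : position (nextDown r) = position r - 1 := by
  obtain ⟨_ | _, M⟩ := r
  · by_cases h : M = 0
    · simp [position, nextDown, h]
    · simp [position, nextDown, h]; omega
  · simp [position, nextDown]; omega

/-! ### Local characterization of rounding -/

namespace FloatArith

variable (F : FloatArith)

/-- The set of numbers is too large to be searched, but by monotonicity of the preference a local
optimum is global. A neighbour out of range imposes no condition, and this is how saturation enters.
-/
theorem toRaw_round_eq_iff (x : ℚ) (r : Bool × ℕ) : (F.round x).toRaw = r ↔ r.2 < F.numPos ∧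
    ((nextUp r).2 < F.numPos → ¬ F.PreferUpper x r (nextUp r)) ∧
    ((nextDown r).2 < F.numPos → F.PreferUpper x (nextDown r) r) := by
  have he := F.two_le_e
  have hinj : Function.Injective fun y : F.Num => position y.toRaw :=
    position_injective.comp FloatNum.toRaw_injective
  have hlt : ∀ y : F.Num, y.toRaw.2 < F.numPos := FloatNum.toRaw_snd_lt he
  have hex : ∀ r : Bool × ℕ, r.2 < F.numPos → ∃ y : F.Num, y.toRaw = r :=
    fun r h => FloatNum.exists_toRaw he h
  have hanti : ∀ i j k l : F.Num, position j.toRaw = position i.toRaw + 1 →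
      position l.toRaw = position k.toRaw + 1 → position j.toRaw ≤ position k.toRaw →
      F.PreferUpper x k.toRaw l.toRaw → F.PreferUpper x i.toRaw j.toRaw := by
    intro i j k l h1 h2 h3 h4
    unfold PreferUpper at *
    refine h4.anti ?_ ?_ ?_
    · rw [rawVal_toRaw, rawVal_toRaw, FloatNum.val_lt_iff he]; omega
    · rw [rawVal_toRaw, rawVal_toRaw, ← not_lt, FloatNum.val_lt_iff he]; omega
    · rw [rawVal_toRaw, rawVal_toRaw, FloatNum.val_lt_iff he]; omega
  have key : ∀ y : F.Num, (∀ z, F.roundingCost x y ≤ F.roundingCost x z) ↔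
      (∀ z : F.Num, position z.toRaw = position y.toRaw + 1 → ¬ F.PreferUpper x y.toRaw z.toRaw) ∧
      (∀ z : F.Num, position y.toRaw = position z.toRaw + 1 → F.PreferUpper x z.toRaw y.toRaw) := by
    refine isMin_iff_of_chain (a := -F.numPos) (b := F.numPos - 1) hinj ?_ ?_ _
      (fun y z : F.Num => F.PreferUpper x y.toRaw z.toRaw) ?_ hanti
    · intro y
      have := hlt y
      unfold position
      cases y.toRaw.1 <;> simp <;> omega
    · intro n h1 h2
      rcases le_or_gt 0 n with hn | hn
      · obtain ⟨y, hy⟩ := hex (false, n.toNat) (by dsimp only; omega)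
        exact ⟨y, by rw [hy]; simp [position]; omega⟩
      · obtain ⟨y, hy⟩ := hex (true, (-1 - n).toNat) (by dsimp only; omega)
        exact ⟨y, by rw [hy]; simp [position]; omega⟩
    · intro y z h
      have := F.roundingCost_lt_iff x h
      unfold PreferUpper
      rwa [rawVal_toRaw, rawVal_toRaw, rawBits_toRaw]
  have key' : ∀ y : F.Num, (∀ z, F.roundingCost x y ≤ F.roundingCost x z) ↔
      ((nextUp y.toRaw).2 < F.numPos → ¬ F.PreferUpper x y.toRaw (nextUp y.toRaw)) ∧
      ((nextDown y.toRaw).2 < F.numPos → F.PreferUpper x (nextDown y.toRaw) y.toRaw) := by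
    intro y
    rw [key]
    have hu := position_nextUp y.toRaw
    have hd := position_nextDown y.toRaw
    constructor
    · rintro ⟨h1, h2⟩
      constructor
      · intro h
        obtain ⟨z, hz⟩ := hex _ h
        rw [← hz] at hu ⊢
        exact h1 z hu
      · intro h
        obtain ⟨z, hz⟩ := hex _ h
        rw [← hz] at hd ⊢
        exact h2 z (by omega)
    · rintro ⟨h1, h2⟩
      constructor
      · intro z hz
        have e : nextUp y.toRaw = z.toRaw := position_injective (by omega)
        rw [e] at h1
        exact h1 (hlt z)
      · intro z hz
        have e : nextDown y.toRaw = z.toRaw := position_injective (by omega)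
        rw [e] at h2
        exact h2 (hlt z)
  have hmin : ∀ z, F.roundingCost x (F.round x) ≤ F.roundingCost x z :=
    Classical.choose_spec (Finite.exists_min (F.roundingCost x))
  -- Two distinct minimizers cannot exist. At the lower one the upper neighbour would be rejected,
  -- while the higher one would be preferred to its lower neighbour, against the monotonicity of the
  -- preference.
  have hle : ∀ y z : F.Num, (∀ w, F.roundingCost x y ≤ F.roundingCost x w) →
      (∀ w, F.roundingCost x z ≤ F.roundingCost x w) → position z.toRaw ≤ position y.toRaw := by
    intro y z hy hz
    by_contra! h
    have h1 := ((key y).1 hy).1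
    have h2 := ((key z).1 hz).2
    have hsurj : ∀ r, position y.toRaw ≤ position r → position r ≤ position z.toRaw →
        r.2 < F.numPos := by
      intro r h3 h4
      have := hlt y
      have := hlt z
      unfold position at *
      cases hr : r.1 <;> cases hy1 : y.toRaw.1 <;> cases hz1 : z.toRaw.1 <;>
        simp only [hr, hy1, hz1, cond_true, cond_false] at * <;> omega
    have e1 := position_nextUp y.toRaw
    have e2 := position_nextDown z.toRaw
    obtain ⟨u, hu⟩ := hex (nextUp y.toRaw) (hsurj _ (by omega) (by omega))
    obtain ⟨v, hv⟩ := hex (nextDown z.toRaw) (hsurj _ (by omega) (by omega))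
    rw [← hu] at e1
    rw [← hv] at e2
    refine h1 u e1 ?_
    rcases eq_or_lt_of_le (show position y.toRaw ≤ position v.toRaw by omega) with h3 | h3
    · rw [show y = v from hinj h3, show u = z from hinj (a₁ := u) (by dsimp only; omega)]
      exact h2 v (by omega)
    · exact hanti y u v z e1 (by omega) (by omega) (h2 v (by omega))
  constructor
  · rintro rfl
    exact ⟨hlt _, (key' _).1 hmin⟩
  · rintro ⟨hr, h⟩
    obtain ⟨y, rfl⟩ := hex r hr
    have hy := (key' y).2 h
    rw [hinj (le_antisymm (hle _ _ hy hmin) (hle _ _ hmin hy))]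

end FloatArith

/-! ### Signs of sums of dyadic numbers -/

/-- The value `± m * 2 ^ E` of a term `(s, m, E)`. -/
def termVal (t : Bool × ℕ × ℕ) : ℤ := (bif t.1 then -1 else 1) * (t.2.1 * 2 ^ t.2.2)

/-- The value of a sum of terms. -/
def termSum (l : List (Bool × ℕ × ℕ)) : ℤ := (l.map termVal).sum

@[simp] theorem termSum_nil : termSum [] = 0 := rfl

@[simp] theorem termSum_cons (t : Bool × ℕ × ℕ) (l : List (Bool × ℕ × ℕ)) :
    termSum (t :: l) = termVal t + termSum l := List.sum_cons

@[simp] theorem termSum_append (l m : List (Bool × ℕ × ℕ)) :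
    termSum (l ++ m) = termSum l + termSum m := by simp [termSum]

/-- Insertion into a list sorted by descending exponents. -/
def insertTerm (t : Bool × ℕ × ℕ) (l : List (Bool × ℕ × ℕ)) : List (Bool × ℕ × ℕ) :=
  l.filter (fun u => decide (t.2.2 < u.2.2)) ++ t :: l.filter fun u => decide (u.2.2 ≤ t.2.2)

/-- Sorting by descending exponents. -/
def sortTerms (l : List (Bool × ℕ × ℕ)) : List (Bool × ℕ × ℕ) := l.foldr insertTerm []

theorem insertTerm_perm (t : Bool × ℕ × ℕ) (l : List (Bool × ℕ × ℕ)) :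
    (insertTerm t l).Perm (t :: l) := by
  refine List.perm_middle.trans (List.Perm.cons t ?_)
  have := List.filter_append_perm (fun u : Bool × ℕ × ℕ => decide (t.2.2 < u.2.2)) l
  simpa only [← decide_not, not_lt] using this

theorem sortTerms_perm (l : List (Bool × ℕ × ℕ)) : (sortTerms l).Perm l := by
  induction l with
  | nil => exact .refl _
  | cons t l ih => exact (insertTerm_perm _ _).trans (ih.cons t)

theorem pairwise_sortTerms (l : List (Bool × ℕ × ℕ)) :
    (sortTerms l).Pairwise fun t u => u.2.2 ≤ t.2.2 := by
  induction l with
  | nil => exact .nil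
  | cons t l ih =>
    show (insertTerm t (sortTerms l)).Pairwise _
    unfold insertTerm
    rw [List.pairwise_append, List.pairwise_cons]
    refine ⟨ih.filter _, ⟨?_, ih.filter _⟩, ?_⟩
    · intro u hu
      simpa using (List.mem_filter.1 hu).2
    · intro u hu v hv
      have hu := (List.mem_filter.1 hu).2
      rw [decide_eq_true_eq] at hu
      rcases List.mem_cons.1 hv with rfl | hv
      · exact hu.le
      · have hv := (List.mem_filter.1 hv).2
        rw [decide_eq_true_eq] at hv
        omega

/-- One step of the evaluation of a sorted sum. The state `(d, a, b, E)` represents the partial sum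
`(a - b) * 2 ^ E`; `d` indicates that the rest of the sum is smaller in magnitude. -/
def sumStep (c : List Bool) (s : Bool × ℕ × ℕ × ℕ) (t : Bool × ℕ × ℕ) : Bool × ℕ × ℕ × ℕ :=
  bif s.1 then s else
  bif decide (s.2.1 = s.2.2.1) then
    (false, bif t.1 then 0 else t.2.1, bif t.1 then t.2.1 else 0, t.2.2) else
  bif decide (c.length ≤ s.2.2.2 - t.2.2) then (true, s.2) else
  (false, s.2.1 * 2 ^ min (s.2.2.2 - t.2.2) c.length + (bif t.1 then 0 else t.2.1),
    s.2.2.1 * 2 ^ min (s.2.2.2 - t.2.2) c.length + (bif t.1 then t.2.1 else 0), t.2.2)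

/-- The sum of the absolute values of the mantissas, in binary. -/
def mantissaSum (l : List (Bool × ℕ × ℕ)) : List Bool :=
  Computability.encodeNat (l.map fun t => t.2.1).sum

theorem sum_lt_two_pow_length_mantissaSum (l : List (Bool × ℕ × ℕ)) :
    (l.map fun t => t.2.1).sum < 2 ^ (mantissaSum l).length := by
  rw [mantissaSum, length_encodeNat]
  exact Nat.lt_size_self _

/-- The decision whether a sum of terms is positive. -/
def sumPos (l : List (Bool × ℕ × ℕ)) : Bool :=
  let s := (sortTerms l).foldl
    (sumStep (mantissaSum l)) (false, 0, 0, 0)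
  decide (s.2.2.1 < s.2.1)

theorem foldl_sumStep_true (c : List Bool) (s : ℕ × ℕ × ℕ) (l : List (Bool × ℕ × ℕ)) :
    l.foldl (sumStep c) (true, s) = (true, s) := by
  induction l with
  | nil => rfl
  | cons t l ih => exact ih

theorem abs_termSum_le {l : List (Bool × ℕ × ℕ)} {E : ℕ} (h : ∀ t ∈ l, t.2.2 ≤ E) :
    |termSum l| ≤ (l.map fun t => t.2.1).sum * 2 ^ E := by
  induction l with
  | nil => simp
  | cons t l ih =>
    have h1 := ih fun u hu => h u (List.mem_cons_of_mem _ hu)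
    have h2 : |termVal t| ≤ t.2.1 * 2 ^ E := by
      have : (2 : ℤ) ^ t.2.2 ≤ 2 ^ E := pow_le_pow_right₀ (by norm_num) (h t List.mem_cons_self)
      have h3 : (t.2.1 : ℤ) * 2 ^ t.2.2 ≤ t.2.1 * 2 ^ E := by gcongr
      rw [termVal, abs_mul, abs_of_nonneg (by positivity : (0 : ℤ) ≤ t.2.1 * 2 ^ t.2.2)]
      cases t.1 <;> simpa using h3
    rw [termSum_cons, List.map_cons, List.sum_cons, Nat.cast_add, add_mul]
    exact (abs_add_le _ _).trans (add_le_add h2 h1)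

/-- The length of `c` exceeds the bit length of all remaining mantissas together. A nonzero partial
sum is at least `2 ^ E` in magnitude, so it outweighs a rest whose exponents lie at least `c.length`
below `E`. Otherwise the shift is shorter than `c` and the mantissas stay small. For `a = b` the
exponent `E` has no meaning, so it is left unconstrained in `hE`. -/
theorem foldl_sumStep_lt_iff (c : List Bool) (l : List (Bool × ℕ × ℕ)) (a b E : ℕ)
    (hsort : l.Pairwise fun t u => u.2.2 ≤ t.2.2) (hE : a = b ∨ ∀ t ∈ l, t.2.2 ≤ E)
    (hc : (l.map fun t => t.2.1).sum < 2 ^ c.length) :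
    (l.foldl (sumStep c) (false, a, b, E)).2.2.1 < (l.foldl (sumStep c) (false, a, b, E)).2.1 ↔
      0 < ((a : ℤ) - b) * 2 ^ E + termSum l := by
  induction l generalizing a b E with
  | nil =>
    simp only [List.foldl_nil, termSum_nil, add_zero]
    rw [mul_pos_iff_of_pos_right (by positivity)]
    omega
  | cons t l ih =>
    rw [List.pairwise_cons] at hsort
    rw [List.map_cons, List.sum_cons] at hc
    have ih := fun a b => ih a b t.2.2 hsort.2 (.inr hsort.1) (by omega)
    have hv : termVal t = (((bif t.1 then 0 else t.2.1 : ℕ) : ℤ) -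
        (bif t.1 then t.2.1 else 0 : ℕ)) * 2 ^ t.2.2 := by
      rw [termVal]; cases t.1 <;> simp
    rw [List.foldl_cons, termSum_cons]
    -- A vanishing partial sum is replaced by the next term outright, so a drop of the exponent,
    -- however large, causes no shift.
    by_cases hab : a = b
    · have e : sumStep c (false, a, b, E) t =
        (false, bif t.1 then 0 else t.2.1, bif t.1 then t.2.1 else 0, t.2.2) := by
        simp [sumStep, hab]
      rw [e, ih, hab, hv]
      ring_nf
    · have hE := hE.resolve_left hab
      have hEt := hE t List.mem_cons_self
      by_cases hg : c.length ≤ E - t.2.2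
      · have e : sumStep c (false, a, b, E) t = (true, a, b, E) := by simp [sumStep, hab, hg]
        rw [e, foldl_sumStep_true, ← termSum_cons]
        have h1 : |termSum (t :: l)| < 2 ^ E := by
          refine (abs_termSum_le (E := t.2.2) ?_).trans_lt ?_
          · intro u hu
            rcases List.mem_cons.1 hu with rfl | hu
            · exact le_rfl
            · exact hsort.1 u hu
          · have h2 : 2 ^ c.length * 2 ^ t.2.2 ≤ 2 ^ E := by
              rw [← pow_add]; exact Nat.pow_le_pow_right (by norm_num) (by omega)
            have h3 := Nat.mul_lt_mul_of_pos_right hc (Nat.two_pow_pos t.2.2)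
            rw [List.map_cons, List.sum_cons]
            exact_mod_cast h3.trans_le h2
        rw [abs_lt] at h1
        dsimp only
        have h2 : (0 : ℤ) < 2 ^ E := by positivity
        constructor
        · intro h
          have : (1 : ℤ) ≤ a - b := by omega
          nlinarith
        · intro h
          by_contra h'
          have : (a : ℤ) - b ≤ -1 := by omega
          nlinarith
      · have e : sumStep c (false, a, b, E) t =
          (false, a * 2 ^ (E - t.2.2) + (bif t.1 then 0 else t.2.1),
            b * 2 ^ (E - t.2.2) + (bif t.1 then t.2.1 else 0), t.2.2) := by
          -- The minimum in `sumStep` is attained by the gap here. It is present only so that the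
          -- power can be computed with a unary bound on its exponent, as in `PolyFn.two_pow_min`.
          simp [sumStep, hab, hg, Nat.min_eq_left (show E - t.2.2 ≤ c.length by omega)]
        rw [e, ih, hv]
        have h2 : (2 : ℤ) ^ E = 2 ^ (E - t.2.2) * 2 ^ t.2.2 := by
          rw [← pow_add, Nat.sub_add_cancel hEt]
        rw [h2, Nat.cast_add, Nat.cast_add, Nat.cast_mul, Nat.cast_mul, Nat.cast_pow, Nat.cast_ofNat]
        ring_nf

theorem sumPos_eq_true_iff (l : List (Bool × ℕ × ℕ)) : sumPos l = true ↔ 0 < termSum l := by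
  have hp := sortTerms_perm l
  unfold sumPos
  rw [decide_eq_true_eq, foldl_sumStep_lt_iff _ _ 0 0 0 (pairwise_sortTerms l) (.inl rfl)]
  · rw [termSum, (hp.map termVal).sum_eq]
    simp [termSum]
  · rw [(hp.map _).sum_eq]
    exact sum_lt_two_pow_length_mantissaSum l

/-! ### Polynomial time of the sign test -/

section

variable {α β γ δ : Type} [TEnc α] [TEnc β] [TEnc γ] [TEnc δ]

theorem PolyFn.filter {l : γ → List α} {p : γ × α → Bool} (hl : PolyFn l) (hp : PolyFn p) :
    PolyFn fun x => (l x).filter fun a => p (x, a) := by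
  have : PolyFn fun z : γ × α => bif p z then [z.2] else [] := by fun_prop
  have := PolyFn.flatMap hl this
  refine (funext fun x => ?_ : (fun x => (l x).filter fun a => p (x, a)) = _) ▸ this
  induction l x with
  | nil => rfl
  | cons a l ih => cases h : p (x, a) <;> simp [h, ih]

theorem sz_perm {l m : List α} (h : l.Perm m) : sz l = sz m := by
  induction h with
  | nil => rfl
  | cons x _ ih => rw [sz_cons, sz_cons, ih]
  | swap x y l => simp only [sz_cons]; omega
  | trans _ _ h1 h2 => exact h1.trans h2

theorem sum_lt_two_pow_sz (l : List ℕ) : l.sum < 2 ^ sz l := by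
  induction l with
  | nil => simp
  | cons a l ih =>
    have h1 := lt_two_pow_sz a
    have h2 : 2 ^ sz a ≤ 2 ^ (sz a + sz l) := Nat.pow_le_pow_right (by norm_num) (by omega)
    have h3 : 2 ^ sz l ≤ 2 ^ (sz a + sz l) := Nat.pow_le_pow_right (by norm_num) (by omega)
    rw [List.sum_cons, sz_cons, pow_succ]
    omega

@[fun_prop]
theorem PolyFn.sum {l : γ → List ℕ} (hl : PolyFn l) : PolyFn fun x => (l x).sum := by
  have : PolyFn fun l : List ℕ => l.foldr (fun a s => a + s) 0 := by
    refine PolyFn.foldr (step := fun z : List ℕ × ℕ × ℕ => z.2.1 + z.2.2) .id (.const 0)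
      (by fun_prop) (B := fun n => 4 * n + 1) (by fun_prop) ?_
    intro x l₁ l₂ h
    have h1 : l₂.foldr (fun a s => a + s) 0 = l₂.sum := rfl
    have h2 := sz_nat_le_of_lt (sum_lt_two_pow_sz l₂)
    have h3 := sz_append l₁ l₂
    have h4 := sz_pos l₁
    dsimp only at h ⊢
    rw [h1, h]
    omega
  exact this.comp hl

theorem PolyFn.sortTerms : PolyFn sortTerms := by
  have hi : PolyFn fun z : List (Bool × ℕ × ℕ) × (Bool × ℕ × ℕ) × List (Bool × ℕ × ℕ) =>
      insertTerm z.2.1 z.2.2 := by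
    have h1 : PolyFn fun z : List (Bool × ℕ × ℕ) × (Bool × ℕ × ℕ) × List (Bool × ℕ × ℕ) =>
        z.2.2.filter fun u => decide (z.2.1.2.2 < u.2.2) :=
      PolyFn.filter (p := fun w : (List (Bool × ℕ × ℕ) × (Bool × ℕ × ℕ) × List (Bool × ℕ × ℕ)) ×
        Bool × ℕ × ℕ => decide (w.1.2.1.2.2 < w.2.2.2)) (by fun_prop) (by fun_prop)
    have h2 : PolyFn fun z : List (Bool × ℕ × ℕ) × (Bool × ℕ × ℕ) × List (Bool × ℕ × ℕ) =>
        z.2.2.filter fun u => decide (u.2.2 ≤ z.2.1.2.2) :=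
      PolyFn.filter (p := fun w : (List (Bool × ℕ × ℕ) × (Bool × ℕ × ℕ) × List (Bool × ℕ × ℕ)) ×
        Bool × ℕ × ℕ => decide (w.2.2.2 ≤ w.1.2.1.2.2)) (by fun_prop) (by fun_prop)
    unfold insertTerm
    fun_prop
  refine PolyFn.foldr .id (.const []) hi (B := fun n => n) (by fun_prop) ?_
  intro x l₁ l₂ h
  have h1 := sz_perm (sortTerms_perm l₂)
  have h3 := sz_append l₁ l₂
  have h4 := sz_pos l₁
  dsimp only at h ⊢
  rw [h]
  exact (show sz (QuantFNN.sortTerms l₂) ≤ _ by omega)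

/-- A step shifts by at most `c.length` bits and adds less than `2 ^ c.length`, so each term
lengthens the mantissas by at most `c.length + 1` bits. Exponents are only copied from terms. -/
theorem foldl_sumStep_bound (c : List Bool) (l : List (Bool × ℕ × ℕ))
    (hl : ∀ t ∈ l, t.2.1 < 2 ^ c.length) :
    let s := l.foldl (sumStep c) (false, 0, 0, 0)
    s.2.1 < 2 ^ ((c.length + 1) * l.length) ∧ s.2.2.1 < 2 ^ ((c.length + 1) * l.length) ∧
      (s.2.2.2 = 0 ∨ ∃ t ∈ l, s.2.2.2 = t.2.2) := by
  induction l using List.reverseRecOn with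
  | nil => simp
  | append_singleton l t ih =>
    obtain ⟨h1, h2, h3⟩ := ih fun u hu => hl u (by simp [hu])
    have ht := hl t (by simp)
    rw [List.foldl_append, List.foldl_cons, List.foldl_nil, List.length_append,
      List.length_singleton]
    generalize l.foldl (sumStep c) (false, 0, 0, 0) = s at *
    have e : 2 ^ ((c.length + 1) * (l.length + 1)) =
        2 * (2 ^ ((c.length + 1) * l.length) * 2 ^ c.length) := by ring
    have hpos : 0 < 2 ^ ((c.length + 1) * l.length) := by positivity
    have hpos' : 0 < 2 ^ c.length := by positivity
    have h4 : 2 ^ c.length ≤ 2 ^ ((c.length + 1) * l.length) * 2 ^ c.length :=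
      Nat.le_mul_of_pos_left _ hpos
    have h5 : 2 ^ ((c.length + 1) * l.length) ≤ 2 ^ ((c.length + 1) * l.length) * 2 ^ c.length :=
      Nat.le_mul_of_pos_right _ hpos'
    have key : ∀ (a g m : ℕ), a < 2 ^ ((c.length + 1) * l.length) → m ≤ t.2.1 →
        a * 2 ^ min g c.length + m < 2 ^ ((c.length + 1) * (l.length + 1)) := by
      intro a g m ha hm
      have h6 : a * 2 ^ min g c.length ≤ a * 2 ^ c.length := by
        gcongr
        · norm_num
        · exact Nat.min_le_right _ _
      have h7 : (a + 1) * 2 ^ c.length ≤ 2 ^ ((c.length + 1) * l.length) * 2 ^ c.length := by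
        gcongr; omega
      rw [e]
      rw [add_mul] at h7
      omega
    have hA : (bif t.1 then 0 else t.2.1) ≤ t.2.1 := by cases t.1 <;> simp
    have hB : (bif t.1 then t.2.1 else 0) ≤ t.2.1 := by cases t.1 <;> simp
    have h3' : s.2.2.2 = 0 ∨ ∃ u ∈ l ++ [t], s.2.2.2 = u.2.2 :=
      h3.imp_right fun ⟨u, hu, h⟩ => ⟨u, by simp [hu], h⟩
    unfold sumStep
    cases s.1
    · cases decide (s.2.1 = s.2.2.1)
      · cases decide (c.length ≤ s.2.2.2 - t.2.2)
        · exact ⟨key _ _ _ h1 hA, key _ _ _ h2 hB, .inr ⟨t, by simp, rfl⟩⟩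
        · simp only [cond_true, cond_false]
          exact ⟨by omega, by omega, h3'⟩
      · simp only [cond_true, cond_false]
        exact ⟨by omega, by omega, .inr ⟨t, by simp, rfl⟩⟩
    · simp only [cond_true]
      exact ⟨by omega, by omega, h3'⟩

@[fun_prop]
theorem PolyFn.mantissaSum : PolyFn mantissaSum := by
  have : PolyFn fun l : List (Bool × ℕ × ℕ) => (l.map fun t => t.2.1).sum :=
    (PolyFn.map (f := fun z : List (Bool × ℕ × ℕ) × Bool × ℕ × ℕ => z.2.2.1) .id
      (by fun_prop)).sum
  exact PolyFn.encodeNat.comp this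

@[fun_prop]
theorem PolyFn.sumPos : PolyFn sumPos := by
  have hN := PolyFn.mantissaSum
  have hp : PolyFn fun z : (List (Bool × ℕ × ℕ)) × (Bool × ℕ × ℕ × ℕ) × Bool × ℕ × ℕ =>
      2 ^ min (z.2.1.2.2.2 - z.2.2.2.2) (QuantFNN.mantissaSum z.1).length :=
    PolyFn.two_pow_min (by fun_prop) (by fun_prop)
  have hs : PolyFn fun z : (List (Bool × ℕ × ℕ)) × (Bool × ℕ × ℕ × ℕ) × Bool × ℕ × ℕ =>
      sumStep (QuantFNN.mantissaSum z.1) z.2.1 z.2.2 := by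
    unfold sumStep
    fun_prop
  obtain ⟨k, hk⟩ := hN.sz_le
  have hf : PolyFn fun l : List (Bool × ℕ × ℕ) => (QuantFNN.sortTerms l).foldl
      (sumStep (QuantFNN.mantissaSum l)) (false, 0, 0, 0) := by
    refine PolyFn.foldl (seed := fun _ => (false, 0, 0, 0)) PolyFn.sortTerms (.const _) hs
      (B := fun n => 3 + (4 * (((n + 2) ^ k + 1) * n) + 1) + (4 * (((n + 2) ^ k + 1) * n) + 1) +
        (n + 1) + 3)
      (by fun_prop) ?_
    intro l l₁ l₂ h
    have hc := hk l
    have hsum := sum_lt_two_pow_length_mantissaSum l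
    have hlen := length_le_sz (QuantFNN.mantissaSum l)
    dsimp only at h ⊢
    generalize QuantFNN.mantissaSum l = c at *
    have hmem : ∀ t ∈ l₁, t ∈ l := fun t ht =>
      (sortTerms_perm l).mem_iff.1 (by rw [h]; simp [ht])
    have hl₁ : l₁.length ≤ sz l := by
      have := length_le_sz l
      rw [← (sortTerms_perm l).length_eq, h, List.length_append] at this
      omega
    obtain ⟨h1, h2, h3⟩ := foldl_sumStep_bound c l₁ fun t ht =>
      (List.single_le_sum (by simp) _ (List.mem_map.2 ⟨t, hmem t ht, rfl⟩)).trans_lt hsum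
    generalize l₁.foldl (sumStep c) (false, 0, 0, 0) = s at *
    have e : (c.length + 1) * l₁.length ≤ ((sz l + 2) ^ k + 1) * sz l := by
      gcongr; omega
    have h1 := sz_nat_le_of_lt h1
    have h2 := sz_nat_le_of_lt h2
    have h4 := sz_bool_le s.1
    have h3 : sz s.2.2.2 ≤ sz l + 1 := by
      rcases h3 with h3 | ⟨t, ht, h3⟩
      · rw [h3]; have := sz_pos l; have := sz_nat_le_self 0; omega
      · have := sz_le_of_mem (hmem t ht)
        rw [h3]
        have e2 : sz t = sz t.1 + (sz t.2.1 + sz t.2.2 + 1) + 1 := rfl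
        omega
    have e2 : sz s = sz s.1 + (sz s.2.1 + (sz s.2.2.1 + sz s.2.2.2 + 1) + 1) + 1 := rfl
    rw [e2]
    omega
  unfold QuantFNN.sumPos
  fun_prop

end

/-! ### Computing the rounding map -/

/-- The rounding mode with a given number. -/
def RoundingMode.ofNat : ℕ → RoundingMode
  | 0 => .nearestEven
  | 1 => .nearestAway
  | 2 => .towardZero
  | 3 => .towardPos
  | _ => .towardNeg

/-- A representation of a floating-point arithmetic: the number of the rounding mode, and the widths
`p` and `e - 2` in unary. -/
abbrev RawArith : Type := ℕ × List Unit × List Unit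

/-- The represented arithmetic. -/
def RawArith.arith (c : RawArith) : FloatArith :=
  ⟨c.2.1.length, c.2.2.length + 2, .ofNat c.1, by omega⟩

/-- A representation of a rational number: `(l, d, S)` represents `l / ((d + 1) * 2 ^ S)` where `l` is
a sum of terms. -/
abbrev RawRat : Type := List (Bool × ℕ × ℕ) × ℕ × ℕ

/-- The represented rational number. -/
def RawRat.val (x : RawRat) : ℚ := termSum x.1 / ((x.2.1 + 1) * 2 ^ x.2.2)

/-- The exponent of the unit of the represented arithmetic. -/
def RawArith.unit (c : RawArith) : ℕ := c.2.1.length + (2 * 2 ^ c.2.2.length - 2)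

theorem RawArith.unit_eq (c : RawArith) :
    c.unit = FloatNum.unitExponent c.arith.p c.arith.e := by
  rw [unit, FloatNum.unitExponent]
  show _ = c.2.1.length + (2 ^ (c.2.2.length + 1) - 2)
  rw [pow_succ, mul_comm]

/-- The multiple by `(d + 1) * 2 ^ (S + U)` of the difference of `2 ^ k * x` and a sum of
floating-point numbers. -/
def RawRat.diff (c : RawArith) (x : RawRat) (k : ℕ) (l : List (Bool × ℕ)) : List (Bool × ℕ × ℕ) :=
  (x.1.map fun t => (t.1, t.2.1, t.2.2 + c.unit + k)) ++
    l.map fun r => (!r.1, (x.2.1 + 1) * (2 ^ c.2.1.length + r.2 % 2 ^ c.2.1.length),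
      r.2 / 2 ^ c.2.1.length + x.2.2)

/-- Clearing the denominators only adds to the binary exponents and multiplies mantissas; no power
of two with a large exponent is expanded. The factor `2 ^ k` allows comparing `2 * x` with `l + h`
in place of `x` with the midpoint. -/
theorem RawRat.termSum_diff (c : RawArith) (x : RawRat) (k : ℕ) (l : List (Bool × ℕ)) :
    (termSum (x.diff c k l) : ℚ) = (2 ^ k * x.val - (l.map c.arith.rawVal).sum) *
      ((x.2.1 + 1) * 2 ^ x.2.2 * 2 ^ c.unit) := by
  have h1 : ∀ l : List (Bool × ℕ × ℕ), (termSum (l.map fun t =>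
      (t.1, t.2.1, t.2.2 + c.unit + k)) : ℚ) = termSum l * (2 ^ c.unit * 2 ^ k) := by
    intro l
    induction l with
    | nil => simp
    | cons t l ih =>
      rw [List.map_cons, termSum_cons, termSum_cons, Int.cast_add, Int.cast_add, ih, termVal,
        termVal]
      dsimp only
      push_cast
      ring
  have h2 : (termSum (l.map fun r =>
      (!r.1, (x.2.1 + 1) * (2 ^ c.2.1.length + r.2 % 2 ^ c.2.1.length),
      r.2 / 2 ^ c.2.1.length + x.2.2)) : ℚ) = - (l.map c.arith.rawVal).sum *
      ((x.2.1 + 1) * 2 ^ x.2.2 * 2 ^ c.unit) := by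
    induction l with
    | nil => simp
    | cons r l ih =>
      have e : c.arith.rawVal r = signedMagnitude c.2.1.length r / 2 ^ c.unit := by
        rw [c.unit_eq]; rfl
      have e2 : (termVal (!r.1, (x.2.1 + 1) * (2 ^ c.2.1.length + r.2 % 2 ^ c.2.1.length),
          r.2 / 2 ^ c.2.1.length + x.2.2) : ℚ) =
          -c.arith.rawVal r * ((x.2.1 + 1) * 2 ^ x.2.2 * 2 ^ c.unit) := by
        rw [e, signedMagnitude, magnitude, termVal]
        cases r.1 <;> simp <;> field_simp <;> ring
      rw [List.map_cons, termSum_cons, Int.cast_add, ih, List.map_cons, List.sum_cons, e2]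
      ring
  rw [diff, termSum_append, Int.cast_add, h1, h2, val]
  field_simp
  ring

/-- The decision of `∑ l < 2 ^ k * x`. -/
def RawRat.gt (c : RawArith) (x : RawRat) (k : ℕ) (l : List (Bool × ℕ)) : Bool :=
  sumPos (x.diff c k l)

/-- The decision of `2 ^ k * x < ∑ l`. -/
def RawRat.lt (c : RawArith) (x : RawRat) (k : ℕ) (l : List (Bool × ℕ)) : Bool :=
  sumPos ((x.diff c k l).map fun t => (!t.1, t.2))

theorem RawRat.gt_eq_true_iff (c : RawArith) (x : RawRat) (k : ℕ) (l : List (Bool × ℕ)) :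
    x.gt c k l = true ↔ (l.map c.arith.rawVal).sum < 2 ^ k * x.val := by
  rw [gt, sumPos_eq_true_iff, ← Int.cast_pos (R := ℚ), termSum_diff,
    mul_pos_iff_of_pos_right (by positivity), sub_pos]

theorem RawRat.lt_eq_true_iff (c : RawArith) (x : RawRat) (k : ℕ) (l : List (Bool × ℕ)) :
    x.lt c k l = true ↔ 2 ^ k * x.val < (l.map c.arith.rawVal).sum := by
  have h : ∀ l : List (Bool × ℕ × ℕ), termSum (l.map fun t => (!t.1, t.2)) = - termSum l := by
    intro l
    induction l with
    | nil => rfl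
    | cons t l ih =>
      rw [List.map_cons, termSum_cons, termSum_cons, ih, termVal, termVal]
      cases t.1 <;> simp <;> ring
  rw [lt, sumPos_eq_true_iff, h, ← Int.cast_pos (R := ℚ), Int.cast_neg, termSum_diff, ← neg_mul,
    mul_pos_iff_of_pos_right (by positivity), neg_sub, sub_pos]

/-- The decision of the preference of the upper one of two neighbours. -/
def RawArith.preferUpper (c : RawArith) (x : RawRat) (l h : Bool × ℕ) : Bool :=
  bif decide (c.1 = 0) then x.gt c 1 [l, h] || (!x.lt c 1 [l, h] &&
    (!(h.1.toNat * (2 * 2 * 2 ^ c.2.2.length * 2 ^ c.2.1.length) + 2 ^ c.2.1.length + h.2).bodd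
      || (l.1 && !h.1))) else
  bif decide (c.1 = 1) then x.gt c 1 [l, h] || (!x.lt c 1 [l, h] && !h.1) else
  bif decide (c.1 = 2) then (bif x.lt c 0 [] then h.1 && x.gt c 0 [l] else l.1 || !x.lt c 0 [h]) else
  bif decide (c.1 = 3) then x.gt c 0 [l] else !x.lt c 0 [h]

theorem FloatArith.rawVal_neg_iff (F : FloatArith) (r : Bool × ℕ) : F.rawVal r < 0 ↔ r.1 = true := by
  have h := magnitude_pos F.p r.2
  rw [rawVal, div_lt_iff₀ (by positivity), zero_mul, ← Int.cast_zero, Int.cast_lt, signedMagnitude]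
  cases r.1 <;> simp; omega

theorem FloatArith.rawVal_pos_iff (F : FloatArith) (r : Bool × ℕ) :
    0 < F.rawVal r ↔ r.1 = false := by
  have h := magnitude_pos F.p r.2
  rw [rawVal, lt_div_iff₀ (by positivity), zero_mul, ← Int.cast_zero, Int.cast_lt, signedMagnitude]
  cases r.1 <;> simp; omega

theorem RawArith.preferUpper_eq_true_iff (c : RawArith) (x : RawRat) (l h : Bool × ℕ) :
    c.preferUpper x l h = true ↔ c.arith.PreferUpper x.val l h := by
  have hbits : c.arith.rawBits h =
      h.1.toNat * (2 * 2 * 2 ^ c.2.2.length * 2 ^ c.2.1.length) + 2 ^ c.2.1.length + h.2 := by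
    rw [FloatArith.rawBits]
    show _ * 2 ^ (c.2.2.length + 2 + c.2.1.length) + 2 ^ c.2.1.length + _ = _
    rw [pow_add, pow_add]; ring
  have hm : c.arith.mode = .ofNat c.1 := rfl
  have heven : ∀ n : ℕ, Even n ↔ n.bodd = false := by
    intro n
    rw [Nat.even_iff, Nat.mod_two_of_bodd]
    cases n.bodd <;> simp
  rw [FloatArith.PreferUpper, hm, hbits, heven]
  have hl := c.arith.rawVal_neg_iff l
  have hh := c.arith.rawVal_neg_iff h
  have hh' := c.arith.rawVal_pos_iff h
  have g1 := x.gt_eq_true_iff c 1 [l, h]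
  have g2 := x.lt_eq_true_iff c 1 [l, h]
  have g3 := x.gt_eq_true_iff c 0 [l]
  have g4 := x.lt_eq_true_iff c 0 []
  have g5 := x.lt_eq_true_iff c 0 [h]
  simp only [List.map_cons, List.map_nil, List.sum_cons, List.sum_nil, add_zero, pow_one, pow_zero,
    one_mul] at g1 g2 g3 g4 g5
  rw [preferUpper]
  generalize Nat.bodd (_ + _ + _) = b
  generalize c.arith.rawVal l = L at *
  generalize c.arith.rawVal h = H at *
  generalize x.val = X at *
  -- The sign test decides strict inequalities only, so a tie is recognized by the failure of both.
  have htri : L + H = 2 * X ↔ ¬ L + H < 2 * X ∧ ¬ 2 * X < L + H := by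
    constructor
    · intro h; constructor <;> linarith
    · rintro ⟨h1, h2⟩; linarith
  rcases c.1 with _ | _ | _ | _ | n <;>
    simp only [RoundingMode.ofNat, RoundingMode.PreferUpper, ← g1, ← g2, ← g3, htri, hl, hh, hh']
  · simp
    grind
  · simp
    grind
  · rw [← not_lt, ← g4, ← not_lt (a := X), ← g5]
    cases x.lt c 0 [] <;> simp
  · simp
  · rw [← not_lt, ← g5]
    simp

/-- The decision whether a pair of a sign and a rank is the result of rounding. -/
def RawArith.isRound (c : RawArith) (x : RawRat) (r : Bool × ℕ) : Bool :=
  let n := (2 * 2 * 2 ^ c.2.2.length - 2) * 2 ^ c.2.1.length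
  decide (r.2 < n) && (!decide ((nextUp r).2 < n) || !c.preferUpper x r (nextUp r)) &&
    (!decide ((nextDown r).2 < n) || c.preferUpper x (nextDown r) r)

theorem RawArith.numPos_eq (c : RawArith) :
    c.arith.numPos = (2 * 2 * 2 ^ c.2.2.length - 2) * 2 ^ c.2.1.length := by
  show (2 ^ (c.2.2.length + 2) - 2) * 2 ^ c.2.1.length = _
  rw [pow_add, mul_comm (2 ^ c.2.2.length)]
  norm_num

/-- The result of rounding, as a pair of a sign and a rank. -/
noncomputable def RawArith.round (c : RawArith) (x : RawRat) : Bool × ℕ :=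
  (c.arith.round x.val).toRaw

theorem RawArith.isRound_eq_true_iff (c : RawArith) (x : RawRat) (r : Bool × ℕ) :
    c.isRound x r = true ↔ c.round x = r := by
  rw [round, FloatArith.toRaw_round_eq_iff, c.numPos_eq, isRound]
  simp only [Bool.and_eq_true, Bool.or_eq_true, Bool.not_eq_true', decide_eq_true_eq,
    decide_eq_false_iff_not, ← preferUpper_eq_true_iff, and_assoc, Bool.not_eq_true]
  tauto

/-! ### Polynomial time of the rounding map -/

section

variable {α β γ δ : Type} [TEnc α] [TEnc β] [TEnc γ] [TEnc δ]

@[fun_prop]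
theorem PolyFn.nextUp {r : α → Bool × ℕ} (hr : PolyFn r) : PolyFn fun x => nextUp (r x) := by
  unfold QuantFNN.nextUp; fun_prop

@[fun_prop]
theorem PolyFn.nextDown {r : α → Bool × ℕ} (hr : PolyFn r) : PolyFn fun x => nextDown (r x) := by
  unfold QuantFNN.nextDown; fun_prop

@[fun_prop]
theorem PolyFn.unit {c : α → RawArith} (hc : PolyFn c) : PolyFn fun x => (c x).unit := by
  unfold RawArith.unit; fun_prop

theorem PolyFn.diff {c : α → RawArith} {x : α → RawRat} {l : α → List (Bool × ℕ)} (k : ℕ)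
    (hc : PolyFn c) (hx : PolyFn x) (hl : PolyFn l) :
    PolyFn fun z => (x z).diff (c z) k (l z) := by
  have h1 : PolyFn fun z => (x z).1.map fun t => (t.1, t.2.1, t.2.2 + (c z).unit + k) :=
    PolyFn.map (f := fun w : α × Bool × ℕ × ℕ => (w.2.1, w.2.2.1, w.2.2.2 + (c w.1).unit + k))
      (by fun_prop) (by fun_prop)
  have h2 : PolyFn fun z => (l z).map fun r =>
      (!r.1, ((x z).2.1 + 1) * (2 ^ (c z).2.1.length + r.2 % 2 ^ (c z).2.1.length),
      r.2 / 2 ^ (c z).2.1.length + (x z).2.2) :=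
    PolyFn.map (f := fun w : α × Bool × ℕ =>
      (!w.2.1, ((x w.1).2.1 + 1) * (2 ^ (c w.1).2.1.length + w.2.2 % 2 ^ (c w.1).2.1.length),
      w.2.2 / 2 ^ (c w.1).2.1.length + (x w.1).2.2)) hl (by fun_prop)
  exact h1.append h2

@[fun_prop]
theorem PolyFn.gt {c : α → RawArith} {x : α → RawRat} {l : α → List (Bool × ℕ)} (k : ℕ)
    (hc : PolyFn c) (hx : PolyFn x) (hl : PolyFn l) :
    PolyFn fun z => (x z).gt (c z) k (l z) :=
  PolyFn.sumPos.comp (.diff k hc hx hl)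

@[fun_prop]
theorem PolyFn.lt {c : α → RawArith} {x : α → RawRat} {l : α → List (Bool × ℕ)} (k : ℕ)
    (hc : PolyFn c) (hx : PolyFn x) (hl : PolyFn l) :
    PolyFn fun z => (x z).lt (c z) k (l z) :=
  PolyFn.sumPos.comp (PolyFn.map (f := fun w : α × Bool × ℕ × ℕ => (!w.2.1, w.2.2))
    (.diff k hc hx hl) (by fun_prop))

@[fun_prop]
theorem PolyFn.preferUpper {c : α → RawArith} {x : α → RawRat} {l h : α → Bool × ℕ}
    (hc : PolyFn c) (hx : PolyFn x) (hl : PolyFn l) (hh : PolyFn h) :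
    PolyFn fun z => (c z).preferUpper (x z) (l z) (h z) := by
  unfold RawArith.preferUpper
  fun_prop

theorem RawArith.numPos_lt (c : RawArith) :
    c.arith.numPos < 2 ^ (c.2.2.length + 2 + c.2.1.length) := by
  rw [c.numPos_eq, pow_add, pow_add, mul_comm (2 ^ c.2.2.length)]
  refine Nat.mul_lt_mul_of_pos_right ?_ (by positivity)
  have : 0 < 2 ^ c.2.2.length := by positivity
  omega

/-- A rank has fewer than `e + p` bits up to a constant, and `c` contains both widths in unary. So
every number of the arithmetic is small compared with `c`, whatever computation it came from. This
prevents growth in sums and through layers. -/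
theorem RawArith.sz_le_of_lt {c : RawArith} {r : Bool × ℕ} (h : r.2 < c.arith.numPos) :
    sz r ≤ 4 * sz c + 20 := by
  have h1 := sz_nat_le_of_lt (h.trans c.numPos_lt)
  have h2 := length_le_sz c.2.1
  have h3 := length_le_sz c.2.2
  have h4 := sz_bool_le r.1
  have e1 : sz c = sz c.1 + (sz c.2.1 + sz c.2.2 + 1) + 1 := rfl
  have e2 : sz r = sz r.1 + sz r.2 + 1 := rfl
  omega

theorem RawArith.round_lt (c : RawArith) (x : RawRat) : (c.round x).2 < c.arith.numPos :=
  FloatNum.toRaw_snd_lt c.arith.two_le_e _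

-- The rounded number is guessed, and `isRound` recognizes it by looking at its two neighbours only.
@[fun_prop]
theorem PolyFn.round {c : α → RawArith} {x : α → RawRat} (hc : PolyFn c) (hx : PolyFn x) :
    PolyFn fun z => (c z).round (x z) := by
  have : PolyFn fun z : RawArith × RawRat => z.1.round z.2 := by
    refine PolyFn.of_graph (R := fun z r => z.1.isRound z.2 r) ?_
      (fun z => (z.1.isRound_eq_true_iff z.2 _).2 rfl)
      (fun z r h => ((z.1.isRound_eq_true_iff z.2 r).1 h).symm) (B := fun n => 4 * n + 20)
      (by fun_prop) fun z => ?_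
    · unfold RawArith.isRound
      fun_prop
    · have := RawArith.sz_le_of_lt (z.1.round_lt z.2)
      have e : sz z = sz z.1 + sz z.2 + 1 := rfl
      omega
  exact this.comp (hc.prodMk hx)

end

/-! ### Networks on raw data -/

/-- A floating-point number as a term, in the unit of the arithmetic. -/
def RawArith.term (c : RawArith) (r : Bool × ℕ) : Bool × ℕ × ℕ :=
  (r.1, 2 ^ c.2.1.length + r.2 % 2 ^ c.2.1.length, r.2 / 2 ^ c.2.1.length)

theorem RawArith.rawVal_eq (c : RawArith) (r : Bool × ℕ) :
    c.arith.rawVal r = termVal (c.term r) / 2 ^ c.unit := by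
  rw [c.unit_eq, FloatArith.rawVal]
  congr 2
  rw [termVal, term, signedMagnitude, magnitude]
  show (bif r.1 then _ else _) = _
  cases r.1 <;> simp <;> rfl

/-- Addition. -/
noncomputable def RawArith.add (c : RawArith) (a b : Bool × ℕ) : Bool × ℕ :=
  c.round ([c.term a, c.term b], 0, c.unit)

/-- Multiplication. -/
noncomputable def RawArith.mul (c : RawArith) (a b : Bool × ℕ) : Bool × ℕ :=
  c.round ([(bif a.1 then !b.1 else b.1, (c.term a).2.1 * (c.term b).2.1,
    (c.term a).2.2 + (c.term b).2.2)], 0, c.unit + c.unit)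

/-- The ReLU function. -/
noncomputable def RawArith.relu (c : RawArith) (a : Bool × ℕ) : Bool × ℕ :=
  c.round (bif a.1 then [] else [c.term a], 0, c.unit)

/-- Sums. -/
noncomputable def RawArith.sum (c : RawArith) (l : List (Bool × ℕ)) : Bool × ℕ :=
  listCase l (c.round ([], 0, 0)) fun a l => l.foldl c.add a

/-- The rounded value of a fraction. -/
noncomputable def RawArith.frac (c : RawArith) (a : Bool × ℕ × ℕ) : Bool × ℕ :=
  c.round ([(a.1, a.2.1, 0)], a.2.2, 0)

/-- The output of a neuron. -/
noncomputable def RawArith.neuron (c : RawArith)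
    (w : List (Bool × ℕ × ℕ) × Bool × ℕ × ℕ) (x : List (Bool × ℕ)) : Bool × ℕ :=
  c.relu (c.add (c.sum (((w.1.map c.frac).zip x).map fun z => c.mul z.1 z.2)) (c.frac w.2))

/-- The decision whether a neuron has `n` inputs and its parameters are represented canonically. -/
def neuronOk (n : ℕ) (w : List (Bool × ℕ × ℕ) × Bool × ℕ × ℕ) : Bool :=
  decide (w.1.length = n) && w.1.all (fun a => !a.1 || !decide (a.2.1 = 0)) &&
    (!w.2.1 || !decide (w.2.2.1 = 0))

/-- The effect of a layer on a vector, together with a check of the dimensions. -/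
noncomputable def RawArith.layerStep (c : RawArith) (s : Bool × List (Bool × ℕ))
    (L : List (List (Bool × ℕ × ℕ) × Bool × ℕ × ℕ)) : Bool × List (Bool × ℕ) :=
  (s.1 && L.all (neuronOk s.2.length), L.map fun w => c.neuron w s.2)

/-- The output of a network, together with a check of the dimensions. -/
noncomputable def RawArith.net (c : RawArith)
    (N : List (List (List (Bool × ℕ × ℕ) × Bool × ℕ × ℕ))) (x : List (Bool × ℕ)) :
    Bool × List (Bool × ℕ) :=
  N.foldl c.layerStep (true, x)

/-! ### Polynomial time of network evaluation -/

section

variable {α β γ δ : Type} [TEnc α] [TEnc β] [TEnc γ] [TEnc δ]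

@[fun_prop]
theorem PolyFn.term {c : α → RawArith} {r : α → Bool × ℕ} (hc : PolyFn c) (hr : PolyFn r) :
    PolyFn fun x => (c x).term (r x) := by
  unfold RawArith.term; fun_prop

@[fun_prop]
theorem PolyFn.rawAdd {c : α → RawArith} {a b : α → Bool × ℕ} (hc : PolyFn c) (ha : PolyFn a)
    (hb : PolyFn b) : PolyFn fun x => (c x).add (a x) (b x) := by
  unfold RawArith.add; fun_prop

@[fun_prop]
theorem PolyFn.rawMul {c : α → RawArith} {a b : α → Bool × ℕ} (hc : PolyFn c) (ha : PolyFn a)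
    (hb : PolyFn b) : PolyFn fun x => (c x).mul (a x) (b x) := by
  unfold RawArith.mul; fun_prop

@[fun_prop]
theorem PolyFn.rawRelu {c : α → RawArith} {a : α → Bool × ℕ} (hc : PolyFn c) (ha : PolyFn a) :
    PolyFn fun x => (c x).relu (a x) := by
  unfold RawArith.relu; fun_prop

@[fun_prop]
theorem PolyFn.rawFrac {c : α → RawArith} {a : α → Bool × ℕ × ℕ} (hc : PolyFn c) (ha : PolyFn a) :
    PolyFn fun x => (c x).frac (a x) := by
  unfold RawArith.frac; fun_prop

@[fun_prop]
theorem PolyFn.rawSum {c : α → RawArith} {l : α → List (Bool × ℕ)} (hc : PolyFn c) (hl : PolyFn l) :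
    PolyFn fun x => (c x).sum (l x) := by
  have h : PolyFn fun z : RawArith × (Bool × ℕ) × List (Bool × ℕ) => z.2.2.foldl z.1.add z.2.1 := by
    refine PolyFn.foldl (step := fun w : (RawArith × (Bool × ℕ) × List (Bool × ℕ)) × (Bool × ℕ) ×
      Bool × ℕ => w.1.1.add w.2.1 w.2.2) (by fun_prop) (by fun_prop) (by fun_prop)
      (B := fun n => 5 * n + 20) (by fun_prop) ?_
    rintro ⟨c, a, l⟩ l₁ l₂ -
    have e : sz (c, a, l) = sz c + (sz a + sz l + 1) + 1 := rfl
    rw [e]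
    -- Every partial sum after the first summand is a value of `round`, so its size does not depend
    -- on how many summands were added.
    induction l₁ using List.reverseRecOn with
    | nil => exact (show sz a ≤ _ by omega)
    | append_singleton l₁ b _ =>
      rw [List.foldl_append]
      exact (RawArith.sz_le_of_lt (c.round_lt _)).trans (by omega)
  have h2 : PolyFn fun x => QuantFNN.listCase (l x) ((c x).round ([], 0, 0)) fun a l => l.foldl (c x).add a :=
    PolyFn.listCase (g := fun w : α × (Bool × ℕ) × List (Bool × ℕ) =>
      w.2.2.foldl (c w.1).add w.2.1) hl (by fun_prop)
      (h.comp (f := fun w : α × (Bool × ℕ) × List (Bool × ℕ) => (c w.1, w.2)) (by fun_prop))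
  exact h2

@[fun_prop]
theorem PolyFn.neuron {c : α → RawArith} {w : α → List (Bool × ℕ × ℕ) × Bool × ℕ × ℕ}
    {x : α → List (Bool × ℕ)} (hc : PolyFn c) (hw : PolyFn w) (hx : PolyFn x) :
    PolyFn fun z => (c z).neuron (w z) (x z) := by
  have h1 : PolyFn fun z => (w z).1.map (c z).frac :=
    PolyFn.map (f := fun v : α × Bool × ℕ × ℕ => (c v.1).frac v.2) (by fun_prop) (by fun_prop)
  have h2 : PolyFn fun z => (((w z).1.map (c z).frac).zip (x z)).map fun y => (c z).mul y.1 y.2 :=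
    PolyFn.map (f := fun v : α × (Bool × ℕ) × Bool × ℕ => (c v.1).mul v.2.1 v.2.2)
      (h1.zip hx) (by fun_prop)
  exact (hc.rawSum h2 |> hc.rawAdd <| hc.rawFrac (PolyFn.snd.comp hw)) |> hc.rawRelu

@[fun_prop]
theorem PolyFn.neuronOk {n : α → ℕ} {w : α → List (Bool × ℕ × ℕ) × Bool × ℕ × ℕ}
    (hn : PolyFn n) (hw : PolyFn w) : PolyFn fun z => neuronOk (n z) (w z) := by
  have h1 : PolyFn fun z => (w z).1.all fun a => !a.1 || !decide (a.2.1 = 0) :=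
    PolyFn.all (p := fun v : α × Bool × ℕ × ℕ => !v.2.1 || !decide (v.2.2.1 = 0)) (by fun_prop)
      (by fun_prop)
  have h2 : PolyFn fun z => decide ((w z).1.length = n z) := by fun_prop
  have h3 : PolyFn fun z => !(w z).2.1 || !decide ((w z).2.2.1 = 0) := by fun_prop
  exact (h2.and h1).and h3

theorem PolyFn.layerStep {c : α → RawArith} {s : α → Bool × List (Bool × ℕ)}
    {L : α → List (List (Bool × ℕ × ℕ) × Bool × ℕ × ℕ)} (hc : PolyFn c) (hs : PolyFn s)
    (hL : PolyFn L) : PolyFn fun z => (c z).layerStep (s z) (L z) := by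
  have h1 : PolyFn fun z => (L z).all fun w => QuantFNN.neuronOk (s z).2.length w :=
    PolyFn.all (p := fun v : α × List (Bool × ℕ × ℕ) × Bool × ℕ × ℕ =>
      QuantFNN.neuronOk (s v.1).2.length v.2) hL (by fun_prop)
  have h2 : PolyFn fun z => (L z).map fun w => (c z).neuron w (s z).2 :=
    PolyFn.map (f := fun v : α × List (Bool × ℕ × ℕ) × Bool × ℕ × ℕ =>
      (c v.1).neuron v.2 (s v.1).2) hL (by fun_prop)
  exact ((PolyFn.fst.comp hs).and h1).prodMk h2

@[fun_prop]
theorem PolyFn.net {c : α → RawArith} {N : α → List (List (List (Bool × ℕ × ℕ) × Bool × ℕ × ℕ))}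
    {x : α → List (Bool × ℕ)} (hc : PolyFn c) (hN : PolyFn N) (hx : PolyFn x) :
    PolyFn fun z => (c z).net (N z) (x z) := by
  have h : PolyFn fun z : RawArith × List (List (List (Bool × ℕ × ℕ) × Bool × ℕ × ℕ)) ×
      List (Bool × ℕ) => z.2.1.foldl z.1.layerStep (true, z.2.2) := by
    refine PolyFn.foldl (step := fun w : (RawArith × List (List (List (Bool × ℕ × ℕ) × Bool × ℕ × ℕ))
      × List (Bool × ℕ)) × (Bool × List (Bool × ℕ)) ×
      List (List (Bool × ℕ × ℕ) × Bool × ℕ × ℕ) => w.1.1.layerStep w.2.1 w.2.2)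
      (by fun_prop) (by fun_prop) (.layerStep (by fun_prop) (by fun_prop) (by fun_prop))
      (B := fun n => 10 + n + n * (4 * n + 21)) (by fun_prop) ?_
    rintro ⟨c, N, x⟩ l₁ l₂ h
    have e : sz (c, N, x) = sz c + (sz N + sz x + 1) + 1 := rfl
    dsimp only at h ⊢
    generalize sz (c, N, x) = n at *
    -- After at least one layer the vector has one entry per neuron of the last layer, and each
    -- entry is a value of `round`.
    induction l₁ using List.reverseRecOn with
    | nil =>
      have e2 : sz (true, x) = sz true + sz x + 1 := rfl
      have := sz_bool_le true
      exact (show sz (true, x) ≤ _ by omega)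
    | append_singleton l₁ L _ =>
      rw [List.foldl_append]
      generalize l₁.foldl c.layerStep (true, x) = s
      have h1 := sz_bool_le (s.1 && L.all (QuantFNN.neuronOk s.2.length))
      have h2 : sz (L.map fun w => c.neuron w s.2) ≤ L.length * (4 * sz c + 20 + 1) + 1 := by
        have := sz_list_le (l := L.map fun w => c.neuron w s.2) (M := 4 * sz c + 20) (by
          simp only [List.mem_map, forall_exists_index, and_imp, forall_apply_eq_imp_iff₂]
          exact fun w _ => RawArith.sz_le_of_lt (c.round_lt _))
        rwa [List.length_map] at this
      have h3 : L.length ≤ sz N := by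
        have := sz_le_of_mem (a := L) (l := N) (by rw [h]; simp)
        have := length_le_sz L
        omega
      have h4 : L.length * (4 * sz c + 20 + 1) ≤ n * (4 * n + 21) :=
        Nat.mul_le_mul (by omega) (by omega)
      exact (show sz (s.1 && L.all (QuantFNN.neuronOk s.2.length)) +
        sz (L.map fun w => c.neuron w s.2) + 1 ≤ _ by omega)
  exact h.comp (hc.prodMk (hN.prodMk hx))

end

/-! ### Agreement of the raw operations with the arithmetic -/

namespace RawArith

variable (c : RawArith)

theorem round_eq {x : RawRat} {y : ℚ} (h : x.val = y) : c.round x = (c.arith.round y).toRaw := by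
  rw [round, h]

theorem add_toRaw (a b : c.arith.Num) : c.add a.toRaw b.toRaw = (c.arith.add a b).toRaw := by
  refine c.round_eq ?_
  rw [← FloatArith.rawVal_toRaw, ← FloatArith.rawVal_toRaw, c.rawVal_eq, c.rawVal_eq, RawRat.val]
  simp [add_div]

theorem mul_toRaw (a b : c.arith.Num) : c.mul a.toRaw b.toRaw = (c.arith.mul a b).toRaw := by
  refine c.round_eq ?_
  rw [← FloatArith.rawVal_toRaw, ← FloatArith.rawVal_toRaw, c.rawVal_eq, c.rawVal_eq, RawRat.val]
  have e : termSum [(bif a.toRaw.1 then !b.toRaw.1 else b.toRaw.1, (c.term a.toRaw).2.1 *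
      (c.term b.toRaw).2.1, (c.term a.toRaw).2.2 + (c.term b.toRaw).2.2)] =
      termVal (c.term a.toRaw) * termVal (c.term b.toRaw) := by
    rw [termSum_cons, termSum_nil, add_zero, termVal, termVal, termVal]
    have e1 : (c.term a.toRaw).1 = a.toRaw.1 := rfl
    have e2 : (c.term b.toRaw).1 = b.toRaw.1 := rfl
    rw [e1, e2]
    cases a.toRaw.1 <;> cases b.toRaw.1 <;> simp <;> ring
  dsimp only
  rw [e]
  push_cast
  rw [pow_add]
  field_simp
  simp

theorem relu_toRaw (a : c.arith.Num) : c.relu a.toRaw = (c.arith.relu a).toRaw := by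
  refine c.round_eq ?_
  have h1 := c.arith.rawVal_neg_iff a.toRaw
  have h2 := c.arith.rawVal_pos_iff a.toRaw
  rw [← FloatArith.rawVal_toRaw a, RawRat.val]
  cases h : a.toRaw.1
  · rw [max_eq_right (h2.2 h).le, c.rawVal_eq]
    simp
  · rw [max_eq_left (h1.2 h).le]
    simp

theorem sum_toRaw (l : List c.arith.Num) : c.sum (l.map FloatNum.toRaw) = (c.arith.sum l).toRaw := by
  cases l with
  | nil => exact c.round_eq (by simp [RawRat.val])
  | cons a l =>
    show (l.map FloatNum.toRaw).foldl c.add a.toRaw = (l.foldl c.arith.add a).toRaw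
    induction l generalizing a with
    | nil => rfl
    | cons b l ih => rw [List.map_cons, List.foldl_cons, List.foldl_cons, add_toRaw, ih]

end RawArith

/-! ### Networks and their raw representations -/

/-- The representation of a fraction: sign, absolute value of the numerator, denominator minus one. -/
def Frac.raw (a : Frac) : Bool × ℕ × ℕ := (decide (a.num < 0), a.num.natAbs, a.den - 1)

/-- A negative sign on the numerator 0 is the only defect a raw fraction can have. It must be
excluded, since its string is not the code of any fraction. -/
theorem Frac.exists_raw {r : Bool × ℕ × ℕ} (h : (!r.1 || !decide (r.2.1 = 0)) = true) :
    ∃ a : Frac, a.raw = r := by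
  obtain ⟨s, n, d⟩ := r
  refine ⟨⟨bif s then -n else n, ⟨d + 1, d.succ_pos⟩⟩, ?_⟩
  cases s
  · simp [raw]
  · have : n ≠ 0 := by simpa using h
    simp [raw]; omega

theorem Frac.raw_ok (a : Frac) : (!a.raw.1 || !decide (a.raw.2.1 = 0)) = true := by
  simp [raw]; omega

theorem RawArith.frac_raw (c : RawArith) (a : Frac) :
    c.frac a.raw = (c.arith.round a.val).toRaw := by
  refine c.round_eq ?_
  have h1 : ((a.den : ℕ) - 1 : ℕ) + (1 : ℚ) = (a.den : ℕ) := by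
    have := a.den.pos
    exact_mod_cast Nat.sub_add_cancel this
  have h2 : (bif decide (a.num < 0) then -1 else 1) * (a.num.natAbs : ℤ) = a.num := by
    rcases lt_or_ge a.num 0 with h | h
    · simp [h, abs_of_neg h]
    · simp [h.not_gt, abs_of_nonneg h]
  rw [RawRat.val, Frac.val, Frac.raw, termSum_cons, termSum_nil, termVal]
  dsimp only
  rw [h1, pow_zero, mul_one, h2]
  simp

/-- The representation of a layer. -/
def Layer.raw {n m : ℕ} (L : Layer n m) : List (List (Bool × ℕ × ℕ) × Bool × ℕ × ℕ) :=
  List.ofFn fun i => (List.ofFn fun j => (L.A i j).raw, (L.b i).raw)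

/-- The representation of a network. -/
def FNN.raw : {n m : ℕ} → FNN n m → List (List (List (Bool × ℕ × ℕ) × Bool × ℕ × ℕ))
  | _, _, .single L => [L.raw]
  | _, _, .cons L N => L.raw :: N.raw

theorem RawArith.neuron_raw (c : RawArith) {n m : ℕ} (L : Layer n m) (x : Fin n → c.arith.Num)
    (i : Fin m) : c.neuron (List.ofFn fun j => (L.A i j).raw, (L.b i).raw)
      (List.ofFn fun j => (x j).toRaw) = (L.eval c.arith x i).toRaw := by
  rw [neuron, Layer.eval, ← relu_toRaw, ← add_toRaw, FloatArith.dot, ← sum_toRaw, frac_raw]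
  congr 3
  refine List.ext_getElem (by simp) fun k h1 h2 => ?_
  simp [frac_raw, mul_toRaw]

theorem neuronOk_raw {n m : ℕ} (L : Layer n m) : L.raw.all (neuronOk n) = true := by
  simp only [Layer.raw, List.all_eq_true, List.mem_ofFn, forall_exists_index,
    forall_apply_eq_imp_iff]
  intro i
  simp only [neuronOk, List.length_ofFn, decide_true, Bool.true_and, (L.b i).raw_ok, Bool.and_true,
    List.all_eq_true, List.mem_ofFn, forall_exists_index, forall_apply_eq_imp_iff]
  exact fun j => (L.A i j).raw_ok

theorem RawArith.layerStep_raw (c : RawArith) {n m : ℕ} (L : Layer n m)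
    (x : Fin n → c.arith.Num) : c.layerStep (true, List.ofFn fun j => (x j).toRaw) L.raw =
      (true, List.ofFn fun i => (L.eval c.arith x i).toRaw) := by
  rw [layerStep]
  simp only [List.length_ofFn, neuronOk_raw, Bool.true_and, Prod.mk.injEq, true_and]
  rw [Layer.raw, List.map_ofFn]
  congr 1
  funext i
  exact c.neuron_raw L x i

theorem RawArith.net_raw (c : RawArith) {n m : ℕ} (N : FNN n m) (x : Fin n → c.arith.Num) :
    c.net N.raw (List.ofFn fun j => (x j).toRaw) =
      (true, List.ofFn fun i => (N.eval c.arith x i).toRaw) := by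
  induction N with
  | single L => exact c.layerStep_raw L x
  | cons L N ih =>
    rw [net, FNN.raw, List.foldl_cons, layerStep_raw]
    exact ih _

theorem Layer.exists_raw {n : ℕ} {L : List (List (Bool × ℕ × ℕ) × Bool × ℕ × ℕ)}
    (h : L.all (neuronOk n) = true) : ∃ M : Layer n L.length, M.raw = L := by
  have hL : ∀ i : Fin L.length, ∃ (a : Fin n → Frac) (b : Frac),
      (List.ofFn fun j => (a j).raw, b.raw) = L[i] := by
    intro i
    have := List.all_eq_true.1 h L[i] (List.getElem_mem _)
    rw [Fin.getElem_fin] at *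
    generalize L[(i : ℕ)] = w at *
    obtain ⟨l, b⟩ := w
    simp only [neuronOk, Bool.and_eq_true, decide_eq_true_eq] at this
    obtain ⟨⟨rfl, h1⟩, h2⟩ := this
    obtain ⟨b, rfl⟩ := Frac.exists_raw h2
    choose a ha using fun j : Fin l.length =>
      Frac.exists_raw (List.all_eq_true.1 h1 l[j] (List.getElem_mem _))
    refine ⟨a, b, ?_⟩
    simp [ha]
  choose A b hA using hL
  refine ⟨⟨A, b⟩, ?_⟩
  simp only [raw, hA]
  simp

theorem RawArith.layerStep_false (c : RawArith) (x : List (Bool × ℕ))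
    (N : List (List (List (Bool × ℕ × ℕ) × Bool × ℕ × ℕ))) :
    (N.foldl c.layerStep (false, x)).1 = false := by
  induction N generalizing x with
  | nil => rfl
  | cons L N ih => exact ih _

/-- Dimensions are not part of the raw data. The flag returned by `net` certifies that each layer
fits the length of the vector it receives, which is what is needed to rebuild a typed network. -/
theorem FNN.exists_raw (c : RawArith) {x : List (Bool × ℕ)}
    {N : List (List (List (Bool × ℕ × ℕ) × Bool × ℕ × ℕ))} (hN : N ≠ [])
    (h : (c.net N x).1 = true) : ∃ (m : ℕ) (M : FNN x.length m), M.raw = N := by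
  induction N generalizing x with
  | nil => exact absurd rfl hN
  | cons L N ih =>
    rw [RawArith.net, List.foldl_cons, RawArith.layerStep, Bool.true_and] at h
    cases hL : L.all (neuronOk x.length) with
    | false => simp [hL, RawArith.layerStep_false] at h
    | true =>
      obtain ⟨K, hK⟩ := Layer.exists_raw hL
      rw [hL] at h
      cases N with
      | nil => exact ⟨_, .single K, by rw [FNN.raw, hK]⟩
      | cons L' N =>
        obtain ⟨m, M, hM⟩ := ih (by simp) h
        revert M
        -- The input dimension of the remaining network is the length of the computed vector; it has
        -- to be identified with the number of neurons of the layer before `cons` can be applied.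
        rw [List.length_map]
        intro M hM
        exact ⟨m, .cons K M, by rw [FNN.raw, hM, hK]⟩

/-! ### Symbols -/

/-- The tree representing a symbol. -/
def Sym.tree : Sym → BinTree
  | .bit b => .node (enc b) .nil
  | .sep => .nil
  | .var => .node .nil (.node .nil .nil)
  | .const => .node (.node .nil .nil) (.node .nil .nil)
  | .eq => .node .nil (.node .nil (.node .nil .nil))
  | .not => .node (.node .nil .nil) (.node .nil (.node .nil .nil))
  | .and => .node .nil (.node (.node .nil .nil) (.node .nil .nil))
  | .or => .node (.node .nil .nil) (.node (.node .nil .nil) (.node .nil .nil))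

instance : TEnc Sym :=
  ⟨Sym.tree, fun x y h => by cases x <;> cases y <;> simp_all [Sym.tree, enc_inj.eq_iff]⟩

section

variable {α β γ δ : Type} [TEnc α] [TEnc β] [TEnc γ] [TEnc δ]

@[fun_prop]
theorem PolyFn.bit {b : α → Bool} (hb : PolyFn b) : PolyFn fun x => Sym.bit (b x) := by
  obtain ⟨c, k, h⟩ := hb
  exact .of_runs (.pair c .nil) (fun n => (n + 2) ^ k + 2 * n + 2 * n) (by fun_prop)
    fun x => (h x).pair (Code.Runs.nil _)

@[fun_prop]
theorem PolyFn.symEncodeNat {n : α → ℕ} (hn : PolyFn n) : PolyFn fun x => QuantFNN.encodeNat (n x) := by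
  have h1 : PolyFn fun x => Computability.encodeNat (n x) := PolyFn.encodeNat.comp hn
  have h2 : PolyFn fun x => (Computability.encodeNat (n x)).map Sym.bit :=
    PolyFn.map (f := fun z : α × Bool => Sym.bit z.2) h1 (by fun_prop)
  exact h2.append (.const [Sym.sep])

@[fun_prop]
theorem PolyFn.lor {f g : α → ℕ} (hf : PolyFn f) (hg : PolyFn g) :
    PolyFn fun x => f x ||| g x := by
  have := PolyFn.bitRec (f := fun z => bif z.2.2 then 1 + 2 * (z.1.div2 ||| z.2.1.div2) else
      z.1 ||| z.2.1)
    (digit := fun z => z.2.2 || (z.1 || z.2.1)) (carry := fun _ => false)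
    (by fun_prop) (by fun_prop) (by intro c; cases c <;> rfl) (by
      intro m n c
      cases c
      · simp only [cond_false, Bool.false_or]
        conv_lhs => rw [← Nat.bit_bodd_div2 m, ← Nat.bit_bodd_div2 n, Nat.lor_bit]
      · simp only [cond_true, cond_false, Bool.true_or, Nat.bit_val, Bool.toNat_true]
        omega) (by
      have or_le : ∀ m n : ℕ, m ||| n ≤ m + n := by
        intro m
        induction m using Nat.binaryRec' with
        | zero => intro n; simp
        | bit b m _ ih =>
          intro n
          conv_lhs => rw [← Nat.bit_bodd_div2 n, Nat.lor_bit]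
          have h1 := ih n.div2
          have h2 := eq_bit n
          rw [Nat.bit_val, Nat.bit_val]
          have h3 : (b || n.bodd).toNat ≤ b.toNat + n.bodd.toNat := by
            cases b <;> cases n.bodd <;> decide
          omega
      intro m n c
      have h1 := or_le m n
      have h2 := or_le m.div2 n.div2
      have h3 := eq_bit m
      have h4 := eq_bit n
      cases c <;> simp <;> omega)
  have h : PolyFn fun z : ℕ × ℕ => z.1 ||| z.2 :=
    this.comp (f := fun z : ℕ × ℕ => (z.1, z.2, false)) (by fun_prop)
  exact h.comp (hf.prodMk hg)

end

/-! ### Formulas as lists of tokens -/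

/-- The string for a token `(kind, argument)`. -/
def tokEncode (t : ℕ × ℕ) : List Sym :=
  bif decide (t.1 = 0) then .var :: encodeNat t.2 else
  bif decide (t.1 = 1) then .const :: encodeNat t.2 else
  bif decide (t.1 = 2) then [.eq] else
  bif decide (t.1 = 3) then [.not] else
  bif decide (t.1 = 4) then [.and] else [.or]

/-- The binary operations on values. A value is a bit, which tells formulas from terms, together
with a number. -/
def tokBinary (k : ℕ) (x y : Bool × ℕ) : Option (Bool × ℕ) :=
  bif decide (k = 4) then bif decide (x.1 = y.1) then some (x.1, x.2 &&& y.2) else none else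
  bif !x.1 && !y.1 then
    bif decide (k = 2) then some (true, (decide (x.2 = y.2)).toNat) else some (false, x.2 ||| y.2)
  else none

/-- The effect of a token on a stack of values, where `N` is two to the width of the bit-vectors
and `θ` lists the values of the variables. -/
def tokStep (N : ℕ) (θ : List ℕ) (t : ℕ × ℕ) (s : List (Bool × ℕ)) : Option (List (Bool × ℕ)) :=
  bif decide (t.1 = 0) then θ[t.2]?.elim none fun v => some ((false, v) :: s) else
  bif decide (t.1 = 1) then bif decide (t.2 < N) then some ((false, t.2) :: s) else none else
  bif decide (t.1 = 3) then
    listCase s none fun x s => some ((x.1, bif x.1 then 1 - x.2 else N - 1 - x.2) :: s) else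
  listCase s none fun x s => listCase s none fun y s =>
    (tokBinary t.1 x y).elim none fun z => some (z :: s)

/-- The evaluation of a list of tokens from right to left. -/
def tokEval (N : ℕ) (θ : List ℕ) (l : List (ℕ × ℕ)) : Option (List (Bool × ℕ)) :=
  l.foldr (fun t s => s.elim none fun s => tokStep N θ t s) (some [])

/-- Bitwise operations and complements stay below `2 ^ K`, and each token raises the stack by at
most one entry. Together these bound the evaluation polynomially in the number of tokens and `K`. -/
theorem tokStep_bound {N K : ℕ} {θ : List ℕ} (hN : N ≤ 2 ^ K) (hK : 0 < K) (hθ : ∀ v ∈ θ, v < 2 ^ K)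
    {t : ℕ × ℕ} {s s' : List (Bool × ℕ)} (hs : ∀ v ∈ s, v.2 < 2 ^ K)
    (h : tokStep N θ t s = some s') :
    (∀ v ∈ s', v.2 < 2 ^ K) ∧ s'.length ≤ s.length + 1 := by
  have h1 : 1 < 2 ^ K := Nat.one_lt_two_pow hK.ne'
  unfold tokStep at h
  cases h0 : decide (t.1 = 0)
  · cases h1 : decide (t.1 = 1)
    · cases h3 : decide (t.1 = 3)
      · rw [h0, h1, h3] at h
        simp only [cond_false] at h
        rcases s with _ | ⟨x, _ | ⟨y, s⟩⟩
        · simp at h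
        · simp at h
        · simp only [listCase_cons] at h
          have hx := hs x (by simp)
          have hy := hs y (by simp)
          have hz : ∀ z, tokBinary t.1 x y = some z → z.2 < 2 ^ K := by
            intro z hz
            unfold tokBinary at hz
            have a1 : x.2 &&& y.2 < 2 ^ K := Nat.and_le_left.trans_lt hx
            have a2 : x.2 ||| y.2 < 2 ^ K := Nat.or_lt_two_pow hx hy
            have a3 := (decide (x.2 = y.2)).toNat_le
            simp only [Bool.cond_eq_ite] at hz
            split_ifs at hz <;> cases hz <;> dsimp only <;> omega
          cases hb : tokBinary t.1 x y with
          | none => simp [hb] at h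
          | some z =>
            simp only [hb, Option.elim_some, Option.some.injEq] at h
            subst h
            refine ⟨?_, by simp⟩
            intro v hv
            rcases List.mem_cons.1 hv with rfl | hv
            · exact hz _ hb
            · exact hs v (by simp [hv])
      · rw [h0, h1, h3] at h
        rcases s with _ | ⟨x, s⟩
        · simp at h
        · simp only [cond_false, cond_true, listCase_cons, Option.some.injEq] at h
          subst h
          refine ⟨?_, by simp⟩
          intro v hv
          rcases List.mem_cons.1 hv with rfl | hv
          · cases x.1 <;> simp <;> omega
          · exact hs v (by simp [hv])
    · rw [h0, h1] at h
      cases h2 : decide (t.2 < N)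
      · simp [h2] at h
      · rw [h2] at h
        simp only [cond_false, cond_true, Option.some.injEq] at h
        subst h
        refine ⟨?_, by simp⟩
        intro v hv
        rcases List.mem_cons.1 hv with rfl | hv
        · rw [decide_eq_true_eq] at h2
          dsimp only; omega
        · exact hs v hv
  · rw [h0] at h
    cases h2 : θ[t.2]? with
    | none => simp [h2] at h
    | some w =>
      simp only [h2, cond_true, Option.elim_some, Option.some.injEq] at h
      subst h
      refine ⟨?_, by simp⟩
      intro v hv
      rcases List.mem_cons.1 hv with rfl | hv
      · exact hθ _ (List.mem_of_getElem? h2)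
      · exact hs v hv

section

variable {α β γ δ : Type} [TEnc α] [TEnc β] [TEnc γ] [TEnc δ]

@[fun_prop]
theorem PolyFn.tokEncode {t : α → ℕ × ℕ} (ht : PolyFn t) : PolyFn fun x => tokEncode (t x) := by
  unfold QuantFNN.tokEncode
  fun_prop

@[fun_prop]
theorem PolyFn.tokBinary {k : α → ℕ} {x y : α → Bool × ℕ} (hk : PolyFn k) (hx : PolyFn x)
    (hy : PolyFn y) : PolyFn fun z => tokBinary (k z) (x z) (y z) := by
  unfold QuantFNN.tokBinary
  fun_prop

theorem PolyFn.tokStep {N : α → ℕ} {θ : α → List ℕ} {t : α → ℕ × ℕ} {s : α → List (Bool × ℕ)}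
    (hN : PolyFn N) (hθ : PolyFn θ) (ht : PolyFn t) (hs : PolyFn s) :
    PolyFn fun z => tokStep (N z) (θ z) (t z) (s z) := by
  have h0 : PolyFn fun z => (θ z)[(t z).2]?.elim none fun v => Option.some ((false, v) :: s z) :=
    PolyFn.optionElim (g := fun w : α × ℕ => Option.some ((false, w.2) :: s w.1)) (by fun_prop)
      (by fun_prop) (by fun_prop)
  have h1 : PolyFn fun z => QuantFNN.listCase (s z) none fun x s =>
      Option.some ((x.1, bif x.1 then 1 - x.2 else N z - 1 - x.2) :: s) :=
    PolyFn.listCase (g := fun w : α × (Bool × ℕ) × List (Bool × ℕ) =>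
      Option.some ((w.2.1.1, bif w.2.1.1 then 1 - w.2.1.2 else N w.1 - 1 - w.2.1.2) :: w.2.2))
      hs (by fun_prop) (by fun_prop)
  have h2 : PolyFn fun z => QuantFNN.listCase (s z) none fun x s =>
      QuantFNN.listCase s none fun y s =>
        (QuantFNN.tokBinary (t z).1 x y).elim none fun z => Option.some (z :: s) := by
    refine PolyFn.listCase (g := fun w : α × (Bool × ℕ) × List (Bool × ℕ) =>
      QuantFNN.listCase w.2.2 none fun y s =>
        (QuantFNN.tokBinary (t w.1).1 w.2.1 y).elim none fun z => Option.some (z :: s)) hs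
        (by fun_prop) ?_
    refine PolyFn.listCase (g := fun w : (α × (Bool × ℕ) × List (Bool × ℕ)) × (Bool × ℕ) ×
        List (Bool × ℕ) => (QuantFNN.tokBinary (t w.1.1).1 w.1.2.1 w.2.1).elim none fun z =>
          Option.some (z :: w.2.2)) (by fun_prop) (by fun_prop) ?_
    exact PolyFn.optionElim (g := fun w : ((α × (Bool × ℕ) × List (Bool × ℕ)) × (Bool × ℕ) ×
        List (Bool × ℕ)) × Bool × ℕ => Option.some (w.2 :: w.1.2.2)) (by fun_prop) (by fun_prop)
        (by fun_prop)
  have h3 : PolyFn fun z => bif decide ((t z).2 < N z) then Option.some ((false, (t z).2) :: s z)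
      else none := by fun_prop
  have e0 : PolyFn fun z => decide ((t z).1 = 0) := by fun_prop
  have e1 : PolyFn fun z => decide ((t z).1 = 1) := by fun_prop
  have e3 : PolyFn fun z => decide ((t z).1 = 3) := by fun_prop
  exact e0.cond h0 (e1.cond h3 (e3.cond h1 h2))

@[fun_prop]
theorem PolyFn.tokEval {N : α → ℕ} {θ : α → List ℕ} {l : α → List (ℕ × ℕ)}
    (hN : PolyFn N) (hθ : PolyFn θ) (hl : PolyFn l) :
    PolyFn fun z => tokEval (N z) (θ z) (l z) := by
  have hs : PolyFn fun w : (ℕ × List ℕ × List (ℕ × ℕ)) × (ℕ × ℕ) × Option (List (Bool × ℕ)) =>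
      w.2.2.elim none fun s => QuantFNN.tokStep w.1.1 w.1.2.1 w.2.1 s :=
    PolyFn.optionElim (g := fun v : ((ℕ × List ℕ × List (ℕ × ℕ)) × (ℕ × ℕ) ×
      Option (List (Bool × ℕ))) × List (Bool × ℕ) =>
      QuantFNN.tokStep v.1.1.1 v.1.1.2.1 v.1.2.1 v.2) (by fun_prop) (by fun_prop)
      (.tokStep (by fun_prop) (by fun_prop) (by fun_prop) (by fun_prop))
  have : PolyFn fun z : ℕ × List ℕ × List (ℕ × ℕ) => QuantFNN.tokEval z.1 z.2.1 z.2.2 := by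
    refine PolyFn.foldr (seed := fun _ => Option.some []) (by fun_prop) (by fun_prop) hs
      (B := fun n => n * (4 * n + 1 + 4 + 1) + 3) (by fun_prop) ?_
    rintro ⟨N, θ, l⟩ l₁ l₂ h
    have e : sz (N, θ, l) = sz N + (sz θ + sz l + 1) + 1 := rfl
    dsimp only at h ⊢
    generalize sz (N, θ, l) = n at *
    have key : ∀ s : List (Bool × ℕ), l₂.foldr (fun t s => s.elim none fun s => QuantFNN.tokStep N θ t s) (Option.some []) =
        Option.some s → (∀ v ∈ s, v.2 < 2 ^ n) ∧ s.length ≤ l₂.length := by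
      clear h
      induction l₂ with
      | nil => rintro s ⟨⟩; simp
      | cons t l₂ ih =>
        intro s hs
        rw [List.foldr_cons] at hs
        generalize l₂.foldr (fun t s => s.elim none fun s => QuantFNN.tokStep N θ t s) (Option.some [])
          = o at *
        cases o with
        | none => simp at hs
        | some s' =>
          obtain ⟨h1, h2⟩ := ih s' rfl
          have h3 := tokStep_bound (N := N) (K := n) (θ := θ)
            ((lt_two_pow_sz N).le.trans (Nat.pow_le_pow_right (by norm_num) (by omega)))
            (by omega) (fun v hv => (lt_two_pow_sz v).trans_le
              (Nat.pow_le_pow_right (by norm_num) (by have := sz_le_of_mem hv; omega))) h1 hs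
          exact ⟨h3.1, by rw [List.length_cons]; omega⟩
    generalize l₂.foldr (fun t s => s.elim none fun s => QuantFNN.tokStep N θ t s) (Option.some []) = o at *
    cases o with
    | none => exact (show sz (none : Option (List (Bool × ℕ))) ≤ _ by rw [sz_none]; omega)
    | some s =>
      obtain ⟨h1, h2⟩ := key s rfl
      have h3 := sz_list_le (l := s) (M := 4 * n + 1 + 4) fun v hv => by
        have := sz_nat_le_of_lt (h1 v hv)
        have := sz_bool_le v.1
        have e2 : sz v = sz v.1 + sz v.2 + 1 := rfl
        omega
      have h4 : s.length ≤ n := by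
        have := length_le_sz l
        rw [h, List.length_append, ← h] at this
        omega
      have h5 : s.length * (4 * n + 1 + 4 + 1) ≤ n * (4 * n + 1 + 4 + 1) :=
        Nat.mul_le_mul_right _ h4
      exact (show sz (Option.some s) ≤ _ by rw [sz_some]; omega)
  exact this.comp (hN.prodMk (hθ.prodMk hl))

end

/-! ### Formulas and their lists of tokens -/

theorem tokEval_cons (N : ℕ) (θ : List ℕ) (t : ℕ × ℕ) (l : List (ℕ × ℕ)) :
    tokEval N θ (t :: l) = (tokEval N θ l).elim none fun s => tokStep N θ t s := rfl

section

variable {w n : ℕ} (θ : Fin n → BitVec w)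

open Classical in
/-- The value of a formula as a number. -/
noncomputable def BVFormula.toNat (φ : BVFormula w n) : ℕ := if φ.Sat θ then 1 else 0

/-- The value of a term or formula. -/
noncomputable def itemVal : BVTerm w n ⊕ BVFormula w n → Bool × ℕ
  | .inl t => (false, (t.eval θ).toNat)
  | .inr φ => (true, φ.toNat θ)

/-- The string for a term or formula. -/
def itemEncode : BVTerm w n ⊕ BVFormula w n → List Sym
  | .inl t => t.encode
  | .inr φ => φ.encode

/-- The symbol for conjunction is shared by terms and formulas; the tags of the operands decide
which of the two is built. The argument `m` is arbitrary because the string of an operator does not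
contain it. -/
theorem exists_itemVal_tokBinary {a b : BVTerm w n ⊕ BVFormula w n} {k m : ℕ} {z : Bool × ℕ}
    (h0 : k ≠ 0) (h1 : k ≠ 1) (h3 : k ≠ 3)
    (h : tokBinary k (itemVal θ a) (itemVal θ b) = some z) :
    ∃ c : BVTerm w n ⊕ BVFormula w n, z = itemVal θ c ∧
      tokEncode (k, m) ++ (itemEncode a ++ itemEncode b) = itemEncode c := by
  simp only [tokBinary, Bool.cond_eq_ite, decide_eq_true_eq] at h
  simp only [tokEncode, Bool.cond_eq_ite, decide_eq_true_eq, if_neg h0, if_neg h1, if_neg h3]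
  rcases a with s | φ <;> rcases b with t | ψ
  · by_cases h4 : k = 4
    · subst h4
      exact ⟨.inl (.and s t), by simpa [itemVal, BVTerm.eval] using h.symm, by
        simp [itemEncode, BVTerm.encode]⟩
    · by_cases h2 : k = 2
      · subst h2
        refine ⟨.inr (.eq s t), ?_, by simp [itemEncode, BVFormula.encode]⟩
        simp only [itemVal, BVFormula.toNat, BVFormula.Sat, BitVec.toNat_inj] at h ⊢
        simp only [reduceIte, Nat.reduceEqDiff, Bool.not_false, Bool.and_self,
          Option.some.injEq] at h
        rw [← h]
        by_cases he : s.eval θ = t.eval θ <;> simp [he]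
      · exact ⟨.inl (.or s t), by simpa [itemVal, BVTerm.eval, h4, h2] using h.symm, by
          simp [itemEncode, BVTerm.encode, h4, h2]⟩
  · simp [itemVal] at h
  · simp [itemVal] at h
  · by_cases h4 : k = 4
    · subst h4
      refine ⟨.inr (.and φ ψ), ?_, by simp [itemEncode, BVFormula.encode]⟩
      simp only [itemVal, BVFormula.toNat, BVFormula.Sat, reduceIte, Option.some.injEq] at h ⊢
      rw [← h]
      by_cases h5 : φ.Sat θ <;> by_cases h6 : ψ.Sat θ <;> simp [h5, h6]
    · simp [itemVal, h4] at h

/-- Evaluation doubles as parsing. By induction every stack entry is the value of some term or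
formula, and the codes of these items concatenate to the string of the tokens read so far. -/
theorem exists_items_of_tokEval {l : List (ℕ × ℕ)} {s : List (Bool × ℕ)}
    (h : tokEval (2 ^ w) (List.ofFn fun i => (θ i).toNat) l = some s) :
    ∃ I : List (BVTerm w n ⊕ BVFormula w n), s = I.map (itemVal θ) ∧
      l.flatMap tokEncode = I.flatMap itemEncode := by
  induction l generalizing s with
  | nil => cases h; exact ⟨[], rfl, rfl⟩
  | cons t l ih =>
    rw [tokEval_cons] at h
    cases hl : tokEval (2 ^ w) (List.ofFn fun i => (θ i).toNat) l with
    | none => simp [hl] at h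
    | some s' =>
      rw [hl, Option.elim_some] at h
      obtain ⟨I, rfl, hI⟩ := ih hl
      rw [List.flatMap_cons, hI]
      obtain ⟨k, m⟩ := t
      simp only [tokStep, Bool.cond_eq_ite, decide_eq_true_eq] at h
      split_ifs at h with h0 h1 h2 h3
      · subst h0
        cases hm : (List.ofFn fun i => (θ i).toNat)[m]? with
        | none => simp [hm] at h
        | some v =>
          rw [hm, Option.elim_some, Option.some.injEq] at h
          obtain ⟨hm', rfl⟩ := List.getElem?_eq_some_iff.1 hm
          rw [List.length_ofFn] at hm'
          refine ⟨.inl (.var ⟨m, hm'⟩) :: I, ?_, rfl⟩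
          rw [← h, List.getElem_ofFn]
          rfl
      · subst h1
        exact ⟨.inl (.const ⟨m, h2⟩) :: I, (Option.some.inj h).symm, rfl⟩
      · subst h3
        rcases I with _ | ⟨a, I⟩
        · simp at h
        · rw [List.map_cons, listCase_cons, Option.some.injEq] at h
          rcases a with t | φ
          · refine ⟨.inl (.not t) :: I, ?_, rfl⟩
            rw [← h]
            simp [itemVal, BVTerm.eval]
          · refine ⟨.inr (.not φ) :: I, ?_, rfl⟩
            rw [← h]
            by_cases hφ : φ.Sat θ <;> simp [itemVal, BVFormula.toNat, BVFormula.Sat, hφ]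
      · rcases I with _ | ⟨a, _ | ⟨b, I⟩⟩
        · simp at h
        · simp at h
        · simp only [List.map_cons, listCase_cons] at h
          cases hz : tokBinary k (itemVal θ a) (itemVal θ b) with
          | none => simp [hz] at h
          | some z =>
            rw [hz, Option.elim_some, Option.some.injEq] at h
            obtain ⟨c, hc, hc'⟩ := exists_itemVal_tokBinary (m := m) θ h0 h1 h3 hz
            refine ⟨c :: I, by rw [← h, hc, List.map_cons], ?_⟩
            rw [List.flatMap_cons, List.flatMap_cons, List.flatMap_cons, ← hc']
            simp only [List.append_assoc]

/-- The final stack has a single entry tagged as a formula, so the tokens spell exactly one formula;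
its value 1 says that it holds. -/
theorem exists_sat_of_tokEval {l : List (ℕ × ℕ)}
    (h : tokEval (2 ^ w) (List.ofFn fun i => (θ i).toNat) l = some [(true, 1)]) :
    ∃ φ : BVFormula w n, φ.Sat θ ∧ l.flatMap tokEncode = φ.encode := by
  obtain ⟨I, h1, h2⟩ := exists_items_of_tokEval θ h
  rcases I with _ | ⟨a, _ | ⟨b, I⟩⟩
  · simp at h1
  · rcases a with t | φ
    · simp [itemVal] at h1
    · refine ⟨φ, ?_, by simpa [itemEncode] using h2⟩
      by_contra hφ
      simp [itemVal, BVFormula.toNat, hφ] at h1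
  · simp at h1

/-- The tokens of a term. -/
def BVTerm.toks : BVTerm w n → List (ℕ × ℕ)
  | .var i => [(0, i)]
  | .const c => [(1, c)]
  | .not t => (3, 0) :: t.toks
  | .and t₁ t₂ => (4, 0) :: (t₁.toks ++ t₂.toks)
  | .or t₁ t₂ => (5, 0) :: (t₁.toks ++ t₂.toks)

/-- The tokens of a formula. -/
def BVFormula.toks : BVFormula w n → List (ℕ × ℕ)
  | .eq t₁ t₂ => (2, 0) :: (t₁.toks ++ t₂.toks)
  | .not φ => (3, 0) :: φ.toks
  | .and φ₁ φ₂ => (4, 0) :: (φ₁.toks ++ φ₂.toks)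

theorem BVTerm.flatMap_toks (t : BVTerm w n) : t.toks.flatMap tokEncode = t.encode := by
  induction t with
  | var i => simp [toks, encode, tokEncode]
  | const c => simp [toks, encode, tokEncode]
  | not t ih => simp [toks, encode, tokEncode, ih]
  | and t₁ t₂ h₁ h₂ => simp [toks, encode, tokEncode, h₁, h₂]
  | or t₁ t₂ h₁ h₂ => simp [toks, encode, tokEncode, h₁, h₂]

theorem BVFormula.flatMap_toks (φ : BVFormula w n) : φ.toks.flatMap tokEncode = φ.encode := by
  induction φ with
  | eq t₁ t₂ => simp [toks, encode, tokEncode, BVTerm.flatMap_toks]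
  | not φ ih => simp [toks, encode, tokEncode, ih]
  | and φ₁ φ₂ h₁ h₂ => simp [toks, encode, tokEncode, h₁, h₂]

/-- Reading prefix notation from right to left, the second operand is pushed before the first. So
the stack is extended by exactly one value, on top of whatever the later tokens produced. -/
theorem BVTerm.tokEval_toks (t : BVTerm w n) {l : List (ℕ × ℕ)} {s : List (Bool × ℕ)}
    (h : tokEval (2 ^ w) (List.ofFn fun i => (θ i).toNat) l = some s) :
    tokEval (2 ^ w) (List.ofFn fun i => (θ i).toNat) (t.toks ++ l) =
      some (itemVal θ (.inl t) :: s) := by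
  induction t generalizing l s with
  | var i => simp [toks, tokEval_cons, h, tokStep, itemVal, eval]
  | const c => simp [toks, tokEval_cons, h, tokStep, itemVal, eval]
  | not t ih => simp [toks, tokEval_cons, ih h, tokStep, itemVal, eval]
  | and t₁ t₂ h₁ h₂ => simp [toks, tokEval_cons, h₁ (h₂ h), tokStep, itemVal, eval, tokBinary]
  | or t₁ t₂ h₁ h₂ => simp [toks, tokEval_cons, h₁ (h₂ h), tokStep, itemVal, eval, tokBinary]

theorem BVFormula.tokEval_toks (φ : BVFormula w n) {l : List (ℕ × ℕ)} {s : List (Bool × ℕ)}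
    (h : tokEval (2 ^ w) (List.ofFn fun i => (θ i).toNat) l = some s) :
    tokEval (2 ^ w) (List.ofFn fun i => (θ i).toNat) (φ.toks ++ l) =
      some (itemVal θ (.inr φ) :: s) := by
  induction φ generalizing l s with
  | eq t₁ t₂ =>
    have := t₁.tokEval_toks θ (t₂.tokEval_toks θ h)
    by_cases he : t₁.eval θ = t₂.eval θ <;>
      simp [toks, tokEval_cons, this, tokStep, itemVal, toNat, Sat, tokBinary, he]
    exact fun h => he (BitVec.toNat_inj.1 h)
  | not φ ih =>
    by_cases he : φ.Sat θ <;> simp [toks, tokEval_cons, ih h, tokStep, itemVal, toNat, Sat, he]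
  | and φ₁ φ₂ h₁ h₂ =>
    by_cases he : φ₁.Sat θ <;> by_cases he' : φ₂.Sat θ <;>
      simp [toks, tokEval_cons, h₁ (h₂ h), tokStep, itemVal, toNat, Sat, tokBinary, he, he']

theorem BVFormula.tokEval_toks_of_sat {φ : BVFormula w n} (h : φ.Sat θ) :
    tokEval (2 ^ w) (List.ofFn fun i => (θ i).toNat) φ.toks = some [(true, 1)] := by
  have := φ.tokEval_toks θ (l := []) (s := []) rfl
  rw [List.append_nil] at this
  rw [this, itemVal, toNat, if_pos h]

end

/-! ### The encoding of instances on raw data -/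

/-- The string for a fraction. -/
def fracEncode (a : Bool × ℕ × ℕ) : List Sym :=
  .bit a.1 :: (encodeNat a.2.1 ++ encodeNat (a.2.2 + 1))

/-- The string for the parameters of a neuron. -/
def neuronEncode (w : List (Bool × ℕ × ℕ) × Bool × ℕ × ℕ) : List Sym :=
  w.1.flatMap fracEncode ++ fracEncode w.2

/-- The string for a layer. -/
def layerEncode (L : List (List (Bool × ℕ × ℕ) × Bool × ℕ × ℕ)) : List Sym :=
  (L.map fun _ => .bit true) ++ [.sep] ++ L.flatMap neuronEncode

/-- The string for a network. -/
def netEncode (N : List (List (List (Bool × ℕ × ℕ) × Bool × ℕ × ℕ))) : List Sym :=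
  (N.zip ((N.tail.map fun _ => true) ++ [false])).flatMap fun z => .bit z.2 :: layerEncode z.1

theorem Frac.encode_eq (a : Frac) : a.encode = fracEncode a.raw := by
  have h : (a.den : ℕ) - 1 + 1 = a.den := Nat.sub_add_cancel a.den.pos
  rw [encode, fracEncode, raw]
  dsimp only
  rw [h, List.cons_append]

theorem Layer.encode_eq {n m : ℕ} (L : Layer n m) : L.encode = layerEncode L.raw := by
  have h : (List.ofFn fun _ : Fin m => Sym.bit true) = List.replicate m (.bit true) :=
    List.ofFn_const _ _
  rw [encode, layerEncode, raw, encodeUnary, List.map_ofFn, List.flatMap_def, List.map_ofFn]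
  refine congrArg₂ _ (congrArg₂ _ h.symm rfl) (congrArg List.flatten (congrArg List.ofFn ?_))
  funext i
  simp only [Function.comp_apply, neuronEncode, List.flatMap_def, List.map_ofFn, Frac.encode_eq]
  rfl

theorem netEncode_cons (L : List (List (Bool × ℕ × ℕ) × Bool × ℕ × ℕ))
    (N : List (List (List (Bool × ℕ × ℕ) × Bool × ℕ × ℕ))) :
    netEncode (L :: N) = .bit (!N.isEmpty) :: (layerEncode L ++ netEncode N) := by
  cases N <;> simp [netEncode]

theorem FNN.raw_ne_nil {n m : ℕ} (N : FNN n m) : N.raw ≠ [] := by cases N <;> simp [raw]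

theorem FNN.encode_eq {n m : ℕ} (N : FNN n m) : N.encode = netEncode N.raw := by
  induction N with
  | single L => rw [encode, raw, netEncode_cons, L.encode_eq]; simp [netEncode]
  | cons L N ih =>
    have : (!N.raw.isEmpty) = true := by simp [N.raw_ne_nil]
    rw [encode, raw, netEncode_cons, L.encode_eq, ih, this]

/-- A representation of an instance with an input. -/
abbrev RawInstance : Type :=
  RawArith × List (Bool × ℕ) × List (List (List (Bool × ℕ × ℕ) × Bool × ℕ × ℕ)) ×
    List (ℕ × ℕ) × List (ℕ × ℕ)

/-- The string for an instance. -/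
def RawInstance.encode (r : RawInstance) : List Sym :=
  encodeNat r.1.1 ++ encodeNat r.1.2.1.length ++ encodeNat (r.1.2.2.length + 2) ++
    ((r.2.1.map fun _ => .bit true) ++ [.sep]) ++ netEncode r.2.2.1 ++
      r.2.2.2.1.flatMap tokEncode ++ r.2.2.2.2.flatMap tokEncode

/-- Two to the width of the bit-vectors. -/
def RawArith.numBits (c : RawArith) : ℕ := 2 * (4 * 2 ^ c.2.2.length * 2 ^ c.2.1.length)

theorem RawArith.numBits_eq (c : RawArith) : c.numBits = 2 ^ c.arith.width := by
  show _ = 2 ^ (1 + (c.2.2.length + 2) + c.2.1.length)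
  rw [numBits, pow_add, pow_add, pow_add]
  ring

/-- The bit-vector representing a floating-point number, as a natural number. -/
def RawArith.bits (c : RawArith) (r : Bool × ℕ) : ℕ :=
  (bif r.1 then 4 * 2 ^ c.2.2.length * 2 ^ c.2.1.length else 0) + 2 ^ c.2.1.length + r.2

theorem RawArith.bits_eq (c : RawArith) (y : c.arith.Num) : c.bits y.toRaw = y.toBits.toNat := by
  rw [← FloatArith.rawBits_toRaw, FloatArith.rawBits]
  show _ = y.toRaw.1.toNat * 2 ^ (c.2.2.length + 2 + c.2.1.length) + 2 ^ c.2.1.length + y.toRaw.2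
  rw [bits, pow_add, pow_add]
  cases y.toRaw.1 <;> simp; ring

/-- The decision whether a list of tokens is a formula that is satisfied. -/
def tokSat (N : ℕ) (θ : List ℕ) (l : List (ℕ × ℕ)) : Bool :=
  decide (tokEval N θ l = some [(true, 1)])

/-- The verification of a certificate against the reverse of the code of an instance. -/
noncomputable def RawInstance.check (z : RawInstance × List Sym) : Bool :=
  decide (z.1.1.1 < 5) &&
    (z.1.2.1.all fun r =>
      decide (r.2 < (2 * 2 * 2 ^ z.1.1.2.2.length - 2) * 2 ^ z.1.1.2.1.length)) &&
    !z.1.2.2.1.isEmpty && (z.1.1.net z.1.2.2.1 z.1.2.1).1 &&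
    tokSat z.1.1.numBits (z.1.2.1.map z.1.1.bits) z.1.2.2.2.1 &&
    tokSat z.1.1.numBits ((z.1.1.net z.1.2.2.1 z.1.2.1).2.map z.1.1.bits) z.1.2.2.2.2 &&
    decide (RawInstance.encode z.1 = z.2.reverse)

/-! ### Polynomial time of the check -/

section

variable {α β γ δ : Type} [TEnc α] [TEnc β] [TEnc γ] [TEnc δ]

@[fun_prop]
theorem PolyFn.fracEncode {a : α → Bool × ℕ × ℕ} (ha : PolyFn a) :
    PolyFn fun x => fracEncode (a x) := by
  unfold QuantFNN.fracEncode
  fun_prop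

@[fun_prop]
theorem PolyFn.neuronEncode {w : α → List (Bool × ℕ × ℕ) × Bool × ℕ × ℕ} (hw : PolyFn w) :
    PolyFn fun x => neuronEncode (w x) := by
  have : PolyFn fun x => (w x).1.flatMap QuantFNN.fracEncode :=
    PolyFn.flatMap (f := fun v : α × Bool × ℕ × ℕ => QuantFNN.fracEncode v.2) (by fun_prop)
      (by fun_prop)
  unfold QuantFNN.neuronEncode
  fun_prop

@[fun_prop]
theorem PolyFn.layerEncode {L : α → List (List (Bool × ℕ × ℕ) × Bool × ℕ × ℕ)} (hL : PolyFn L) :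
    PolyFn fun x => layerEncode (L x) := by
  have h1 : PolyFn fun x => (L x).flatMap QuantFNN.neuronEncode :=
    PolyFn.flatMap (f := fun v : α × List (Bool × ℕ × ℕ) × Bool × ℕ × ℕ =>
      QuantFNN.neuronEncode v.2) (by fun_prop) (by fun_prop)
  have h2 : PolyFn fun x => (L x).map fun _ => Sym.bit true :=
    PolyFn.map (f := fun _ : α × List (Bool × ℕ × ℕ) × Bool × ℕ × ℕ => Sym.bit true)
      (by fun_prop) (by fun_prop)
  unfold QuantFNN.layerEncode
  fun_prop

@[fun_prop]
theorem PolyFn.netEncode {N : α → List (List (List (Bool × ℕ × ℕ) × Bool × ℕ × ℕ))}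
    (hN : PolyFn N) : PolyFn fun x => netEncode (N x) := by
  have h1 : PolyFn fun x => (N x).tail.map fun _ => true :=
    PolyFn.map (f := fun _ : α × List (List (Bool × ℕ × ℕ) × Bool × ℕ × ℕ) => true)
      (by fun_prop) (by fun_prop)
  exact PolyFn.flatMap (f := fun v : α × List (List (Bool × ℕ × ℕ) × Bool × ℕ × ℕ) × Bool =>
      Sym.bit v.2.2 :: QuantFNN.layerEncode v.2.1) (hN.zip (h1.append (by fun_prop))) (by fun_prop)

@[fun_prop]
theorem PolyFn.rawInstanceEncode {r : α → RawInstance} (hr : PolyFn r) :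
    PolyFn fun x => (r x).encode := by
  have h1 : PolyFn fun x => (r x).2.2.2.1.flatMap QuantFNN.tokEncode :=
    PolyFn.flatMap (f := fun v : α × ℕ × ℕ => QuantFNN.tokEncode v.2) (by fun_prop) (by fun_prop)
  have h2 : PolyFn fun x => (r x).2.2.2.2.flatMap QuantFNN.tokEncode :=
    PolyFn.flatMap (f := fun v : α × ℕ × ℕ => QuantFNN.tokEncode v.2) (by fun_prop) (by fun_prop)
  have h3 : PolyFn fun x => (r x).2.1.map fun _ => Sym.bit true :=
    PolyFn.map (f := fun _ : α × Bool × ℕ => Sym.bit true) (by fun_prop) (by fun_prop)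
  unfold RawInstance.encode
  fun_prop

@[fun_prop]
theorem PolyFn.numBits {c : α → RawArith} (hc : PolyFn c) : PolyFn fun x => (c x).numBits := by
  unfold RawArith.numBits
  fun_prop

@[fun_prop]
theorem PolyFn.bits {c : α → RawArith} {r : α → Bool × ℕ} (hc : PolyFn c) (hr : PolyFn r) :
    PolyFn fun x => (c x).bits (r x) := by
  unfold RawArith.bits
  fun_prop

@[fun_prop]
theorem PolyFn.mapBits {c : α → RawArith} {l : α → List (Bool × ℕ)} (hc : PolyFn c)
    (hl : PolyFn l) : PolyFn fun x => (l x).map (c x).bits :=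
  PolyFn.map (f := fun v : α × Bool × ℕ => (c v.1).bits v.2) hl (by fun_prop)

@[fun_prop]
theorem PolyFn.tokSat {N : α → ℕ} {θ : α → List ℕ} {l : α → List (ℕ × ℕ)}
    (hN : PolyFn N) (hθ : PolyFn θ) (hl : PolyFn l) : PolyFn fun z => tokSat (N z) (θ z) (l z) :=
  PolyFn.decide_eq (g := fun _ => Option.some [(true, 1)]) (.tokEval hN hθ hl) (.const _)

theorem polyFn_check : PolyFn RawInstance.check := by
  have : PolyFn fun z : RawInstance × List Sym => z.1.2.1.all fun r =>
      decide (r.2 < (2 * 2 * 2 ^ z.1.1.2.2.length - 2) * 2 ^ z.1.1.2.1.length) :=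
    PolyFn.all (p := fun w : (RawInstance × List Sym) × Bool × ℕ =>
      decide (w.2.2 < (2 * 2 * 2 ^ w.1.1.1.2.2.length - 2) * 2 ^ w.1.1.1.2.1.length))
      (by fun_prop) (by fun_prop)
  have h1 : PolyFn fun z : RawInstance × List Sym => decide (z.1.1.1 < 5) := by fun_prop
  have h2 : PolyFn fun z : RawInstance × List Sym => !z.1.2.2.1.isEmpty := by fun_prop
  have h3 : PolyFn fun z : RawInstance × List Sym => z.1.1.net z.1.2.2.1 z.1.2.1 := by fun_prop
  have h4 : PolyFn fun z : RawInstance × List Sym => tokSat z.1.1.numBits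
    (z.1.2.1.map z.1.1.bits) z.1.2.2.2.1 := by fun_prop
  have h5 : PolyFn fun z : RawInstance × List Sym =>
      (z.1.1.net z.1.2.2.1 z.1.2.1).2.map z.1.1.bits :=
    PolyFn.mapBits (by fun_prop) (PolyFn.snd.comp h3)
  have h6 : PolyFn fun z : RawInstance × List Sym => tokSat z.1.1.numBits
    ((z.1.1.net z.1.2.2.1 z.1.2.1).2.map z.1.1.bits) z.1.2.2.2.2 :=
    .tokSat (by fun_prop) h5 (by fun_prop)
  have h7 : PolyFn fun z : RawInstance × List Sym => z.1.encode := by fun_prop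
  have h8 : PolyFn fun z : RawInstance × List Sym => z.2.reverse := by fun_prop
  exact (((((h1.and this).and h2).and (PolyFn.fst.comp h3)).and h4).and h6).and (h7.decide_eq h8)

end

/-! ### Certificates -/

theorem RoundingMode.encode_ofNat {k : ℕ} (h : k < 5) : (ofNat k).encode = encodeNat k := by
  interval_cases k <;> rfl

theorem RawArith.exists_arith (F : FloatArith) : ∃ c : RawArith, c.1 < 5 ∧ c.arith = F := by
  obtain ⟨p, e, mode, he⟩ := F
  have h : ∃ k < 5, RoundingMode.ofNat k = mode := by
    cases mode
    exacts [⟨0, by decide, rfl⟩, ⟨1, by decide, rfl⟩, ⟨2, by decide, rfl⟩, ⟨3, by decide, rfl⟩,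
      ⟨4, by decide, rfl⟩]
  obtain ⟨k, hk, rfl⟩ := h
  refine ⟨(k, List.replicate p (), List.replicate (e - 2) ()), hk, ?_⟩
  simp only [arith, List.length_replicate]
  congr
  omega

/-- The token lists are only required to have the right strings, since those in a guessed
certificate may carry meaningless arguments on operators. In this form the identity serves both
directions. -/
theorem Instance.encode_eq {c : RawArith} (hc : c.1 < 5) {xs : List (Bool × ℕ)} {n m : ℕ}
    (hn : xs.length = n) (N : FNN n m) (φ₁ : BVFormula c.arith.width n)
    (φ₂ : BVFormula c.arith.width m) {t₁ t₂ : List (ℕ × ℕ)}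
    (h₁ : t₁.flatMap tokEncode = φ₁.encode) (h₂ : t₂.flatMap tokEncode = φ₂.encode) :
    (Instance.mk c.arith n m N φ₁ φ₂).encode =
      RawInstance.encode (c, xs, N.raw, t₁, t₂) := by
  have h : xs.map (fun _ => Sym.bit true) = List.replicate n (.bit true) :=
    hn ▸ List.map_const'
  simp only [encode, RawInstance.encode, h₁, h₂, N.encode_eq, encodeUnary, h]
  rw [← RoundingMode.encode_ofNat hc]
  rfl

theorem RawArith.map_bits (c : RawArith) {n : ℕ} (x : Fin n → c.arith.Num) :
    (List.ofFn fun i => (x i).toRaw).map c.bits = List.ofFn fun i => (x i).toBits.toNat := by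
  rw [List.map_ofFn]
  exact congrArg List.ofFn (funext fun i => c.bits_eq (x i))

/-- Each test of the check restores one typing condition: the mode number, the range of the ranks,
the dimensions, well-formedness of the formulas. The rebuilt instance has code `s` by the final
comparison. Membership asks for some instance with this code, so unique decoding is irrelevant. -/
theorem RawInstance.mem_of_check {r : RawInstance} {s : List Sym}
    (h : RawInstance.check (r, s.reverse) = true) : s ∈ ReachFloatBV := by
  obtain ⟨c, xs, N, t₁, t₂⟩ := r
  simp only [check, Bool.and_eq_true, decide_eq_true_eq, List.reverse_reverse, tokSat,
    Bool.not_eq_true', List.isEmpty_eq_false_iff] at h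
  obtain ⟨⟨⟨⟨⟨⟨h1, h2⟩, h3⟩, h4⟩, h5⟩, h6⟩, rfl⟩ := h
  obtain ⟨m, M, rfl⟩ := FNN.exists_raw c h3 h4
  have hx : ∀ i : Fin xs.length, ∃ y : c.arith.Num, y.toRaw = xs[i] := fun i => by
    refine FloatNum.exists_toRaw c.arith.two_le_e (lt_of_lt_of_eq ?_ c.numPos_eq.symm)
    exact of_decide_eq_true (List.all_eq_true.1 h2 xs[i] (List.getElem_mem _))
  choose x hx using hx
  have hxs : (List.ofFn fun i => (x i).toRaw) = xs := by simp [hx]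
  have hnet := c.net_raw M x
  rw [hxs] at hnet
  rw [hnet, c.numBits_eq, c.map_bits] at h6
  rw [c.numBits_eq] at h5
  nth_rw 1 [← hxs] at h5
  rw [c.map_bits] at h5
  obtain ⟨φ₁, hφ₁, e₁⟩ := exists_sat_of_tokEval _ h5
  obtain ⟨φ₂, hφ₂, e₂⟩ := exists_sat_of_tokEval _ h6
  exact ⟨⟨c.arith, xs.length, m, M, φ₁, φ₂⟩, Instance.encode_eq h1 rfl M φ₁ φ₂ e₁ e₂, x, hφ₁, hφ₂⟩

/-! ### Size of the certificate -/

theorem lt_two_pow_length_encodeNat (n : ℕ) : n < 2 ^ (encodeNat n).length := by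
  rw [encodeNat, List.length_append, List.length_map, length_encodeNat]
  exact (Nat.lt_size_self n).trans_le (Nat.pow_le_pow_right (by norm_num) (by omega))

theorem sz_nat_add_three_le {m n : ℕ} (h : m ≤ n) : sz m + 3 ≤ 4 * (encodeNat n).length := by
  have := sz_nat_le_of_lt (h.trans_lt (Nat.lt_size_self n))
  rw [encodeNat, List.length_append, List.length_map, length_encodeNat, List.length_singleton]
  omega

theorem sz_list_le_flatMap {α β : Type} [TEnc α] {l : List α} {f : α → List β} {K : ℕ}
    (h : ∀ a ∈ l, sz a + 1 ≤ K * (f a).length) : sz l ≤ K * (l.flatMap f).length + 1 := by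
  induction l with
  | nil => simp [sz_nil]
  | cons a l ih =>
    have h1 := h a (by simp)
    have h2 := ih fun b hb => h b (by simp [hb])
    rw [sz_cons, List.flatMap_cons, List.length_append, mul_add]
    omega

theorem sz_add_three_le_fracEncode (a : Bool × ℕ × ℕ) :
    sz a + 3 ≤ 4 * (fracEncode a).length := by
  obtain ⟨s, n, d⟩ := a
  have h1 := sz_bool_le s
  have h2 := sz_nat_add_three_le (le_refl n)
  have h3 := sz_nat_add_three_le (show d ≤ d + 1 by omega)
  rw [sz_pair, sz_pair, fracEncode, List.length_cons, List.length_append]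
  dsimp only
  omega

theorem sz_lt_neuronEncode (w : List (Bool × ℕ × ℕ) × Bool × ℕ × ℕ) :
    sz w + 1 ≤ 4 * (neuronEncode w).length := by
  obtain ⟨l, b⟩ := w
  have h1 := sz_list_le_flatMap (l := l) fun a _ =>
    (Nat.add_le_add_left (by norm_num) (sz a)).trans (sz_add_three_le_fracEncode a)
  have h2 := sz_add_three_le_fracEncode b
  rw [sz_pair, neuronEncode, List.length_append]
  dsimp only
  omega

theorem sz_lt_layerEncode (L : List (List (Bool × ℕ × ℕ) × Bool × ℕ × ℕ)) :
    sz L + 1 ≤ 4 * (layerEncode L).length := by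
  have h1 := sz_list_le_flatMap (l := L) fun w _ => sz_lt_neuronEncode w
  rw [layerEncode, List.length_append, List.length_append, List.length_singleton]
  omega

theorem sz_le_netEncode (N : List (List (List (Bool × ℕ × ℕ) × Bool × ℕ × ℕ))) :
    sz N ≤ 4 * (netEncode N).length + 1 := by
  induction N with
  | nil => simp [sz_nil]
  | cons L N ih =>
    have := sz_lt_layerEncode L
    rw [sz_cons, netEncode_cons, List.length_cons, List.length_append]
    omega

/-- The string of an operator is a single symbol and cannot pay for an argument, so the argument is
required to be 0. -/
theorem sz_lt_tokEncode {t : ℕ × ℕ} (h1 : t.1 ≤ 5) (h2 : 2 ≤ t.1 → t.2 = 0) :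
    sz t + 1 ≤ 16 * (tokEncode t).length := by
  obtain ⟨k, m⟩ := t
  dsimp only at h1 h2
  have h3 := sz_nat_le_of_lt (show k < 2 ^ 3 by omega)
  have h4 := sz_nat_add_three_le (le_refl m)
  rw [sz_pair]
  rcases lt_or_ge k 2 with hk | hk
  · interval_cases k <;> simp only [tokEncode] <;> simp <;> omega
  · obtain rfl := h2 hk
    have h5 := sz_nat_le_of_lt (show 0 < 2 ^ 0 by norm_num)
    have : 0 < (tokEncode (k, 0)).length := by
      interval_cases k <;> simp [tokEncode]
    omega

theorem BVTerm.mem_toks {w n : ℕ} (t : BVTerm w n) :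
    ∀ u ∈ t.toks, u.1 ≤ 5 ∧ (2 ≤ u.1 → u.2 = 0) := by
  induction t with
  | var i => simp [toks]
  | const c => simp [toks]
  | not t ih => simpa [toks] using ih
  | and t₁ t₂ h₁ h₂ => exact List.forall_mem_cons.2 ⟨by simp, List.forall_mem_append.2 ⟨h₁, h₂⟩⟩
  | or t₁ t₂ h₁ h₂ => exact List.forall_mem_cons.2 ⟨by simp, List.forall_mem_append.2 ⟨h₁, h₂⟩⟩

theorem BVFormula.mem_toks {w n : ℕ} (φ : BVFormula w n) :
    ∀ u ∈ φ.toks, u.1 ≤ 5 ∧ (2 ≤ u.1 → u.2 = 0) := by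
  induction φ with
  | eq t₁ t₂ => exact List.forall_mem_cons.2 ⟨by simp, List.forall_mem_append.2 ⟨t₁.mem_toks, t₂.mem_toks⟩⟩
  | not φ ih => simpa [toks] using ih
  | and φ₁ φ₂ h₁ h₂ => exact List.forall_mem_cons.2 ⟨by simp, List.forall_mem_append.2 ⟨h₁, h₂⟩⟩

theorem BVFormula.sz_toks_le {w n : ℕ} (φ : BVFormula w n) :
    sz φ.toks ≤ 16 * φ.encode.length + 1 := by
  rw [← φ.flatMap_toks]
  exact sz_list_le_flatMap fun u hu => sz_lt_tokEncode (φ.mem_toks u hu).1 (φ.mem_toks u hu).2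

theorem RawArith.sz_le {c : RawArith} {T : ℕ} (hT : 0 < T) (h1 : c.1 < 5)
    (h2 : c.2.1.length ≤ T) (h3 : c.2.2.length ≤ T) : sz c ≤ 21 * T := by
  obtain ⟨k, p, e⟩ := c
  have a1 := sz_nat_le_of_lt (show k < 2 ^ 3 by dsimp only at h1; omega)
  have a2 := sz_list_le (l := p) (M := 1) fun _ _ => le_rfl
  have a3 := sz_list_le (l := e) (M := 1) fun _ _ => le_rfl
  rw [sz_pair, sz_pair]
  dsimp only at h2 h3
  omega

/-- In the application `T` is `2 ^ |s|`, which bounds the widths because they are written in binary.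
Network and formulas are linear in the code. The input vector dominates: fewer than `T` entries,
each of size at most `4 * (21 * T) + 20 ≤ 104 * T`. -/
theorem RawInstance.sz_le {c : RawArith} {xs : List (Bool × ℕ)}
    {N : List (List (List (Bool × ℕ × ℕ) × Bool × ℕ × ℕ))} {t₁ t₂ : List (ℕ × ℕ)} {n T : ℕ}
    (hn : n < T) (hc : sz c ≤ 21 * T) (hxs : ∀ r ∈ xs, r.2 < c.arith.numPos)
    (hxs' : xs.length ≤ n) (hN : sz N ≤ 4 * n + 1) (h₁ : sz t₁ ≤ 16 * n + 1)
    (h₂ : sz t₂ ≤ 16 * n + 1) : sz (c, xs, N, t₁, t₂) ≤ 2 ^ 8 * T ^ 2 := by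
  have h3 := sz_list_le (l := xs) (M := 104 * T) fun r hr => by
    have := c.sz_le_of_lt (hxs r hr)
    omega
  have h4 : xs.length * (104 * T + 1) ≤ T * (104 * T + 1) := Nat.mul_le_mul_right _ (by omega)
  simp only [sz_pair]
  nlinarith

/-- The certificate is the raw form of a reachable instance together with a witnessing input.
Writing the widths in unary is what makes it exponentially large. -/
theorem RawInstance.exists_check {s : List Sym} (h : s ∈ ReachFloatBV) :
    ∃ r : RawInstance, sz r ≤ 2 ^ (2 * s.length + 8) ∧ RawInstance.check (r, s.reverse) = true := by
  obtain ⟨⟨F, n, m, N, φ₁, φ₂⟩, rfl, x, h₁, h₂⟩ := h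
  obtain ⟨c, hc, rfl⟩ := RawArith.exists_arith F
  dsimp only at x h₁ h₂
  have hx : ∀ r ∈ List.ofFn fun i => (x i).toRaw, r.2 < c.arith.numPos := by
    simp only [List.mem_ofFn, forall_exists_index, forall_apply_eq_imp_iff]
    exact fun i => (x i).toRaw_snd_lt c.arith.two_le_e
  rw [Instance.encode_eq (xs := List.ofFn fun i => (x i).toRaw) hc (by simp) N φ₁ φ₂
    φ₁.flatMap_toks φ₂.flatMap_toks]
  refine ⟨(c, List.ofFn fun i => (x i).toRaw, N.raw, φ₁.toks, φ₂.toks), ?_, ?_⟩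
  rotate_left
  · simp only [check, Bool.and_eq_true, decide_eq_true_eq, List.reverse_reverse, tokSat,
      Bool.not_eq_true', List.isEmpty_eq_false_iff, c.net_raw N x, c.map_bits, c.numBits_eq,
      List.all_eq_true, N.raw_ne_nil, ne_eq, not_false_eq_true, hc, and_true, true_and]
    exact ⟨⟨fun r hr => c.numPos_eq ▸ hx r hr, φ₁.tokEval_toks_of_sat _ h₁⟩,
      φ₂.tokEval_toks_of_sat _ h₂⟩
  -- The exponent is split so that the bound reads `2 ^ 8 * T ^ 2` with `T` two to the length of the
  -- code.
  · rw [RawInstance.encode, pow_add, mul_comm, mul_comm 2, pow_mul]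
    simp only [List.length_append, List.length_map, List.length_ofFn, φ₁.flatMap_toks,
      φ₂.flatMap_toks]
    have a1 := lt_two_pow_length_encodeNat c.2.1.length
    have a2 := lt_two_pow_length_encodeNat (c.2.2.length + 2)
    have a3 := sz_le_netEncode N.raw
    have a4 := φ₁.sz_toks_le
    have a5 := φ₂.sz_toks_le
    refine RawInstance.sz_le Nat.lt_two_pow_self (RawArith.sz_le (by positivity) hc ?_ ?_) hx ?_ ?_
      ?_ ?_
    · exact a1.le.trans (Nat.pow_le_pow_right (by norm_num) (by omega))
    · exact (show c.2.2.length ≤ 2 ^ (encodeNat (c.2.2.length + 2)).length by omega).trans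
        (Nat.pow_le_pow_right (by norm_num) (by omega))
    · rw [List.length_ofFn]; omega
    · omega
    · omega
    · omega

end QuantFNN

theorem mainTheorem5 : QuantFNN.InNEXPTIME QuantFNN.ReachFloatBV :=
  QuantFNN.inNEXPTIME_of_check QuantFNN.polyFn_check (.C 2 * .X + .C 8)
    (fun s hs => by
      simpa only [Polynomial.eval_add, Polynomial.eval_mul, Polynomial.eval_C, Polynomial.eval_X]
        using QuantFNN.RawInstance.exists_check hs)
    fun _ _ h => QuantFNN.RawInstance.mem_of_check h
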